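/- Let $n\ge 1$ and write points of $\mathbb R^{n+1}$ as $x=(x',t)=(x_1,\dots,x_n,t)$, $y=(y',\tau)$. Let $\mathbb D^{n+1}_+=\{x: x_n>0,\ t>0\}$, $\mathcal I_r(x)=\{y:\ |x'-y'|<r,\ |t-\tau|<r^2\}$, and for $x\in \mathbb D^{n+1}_+$, $r>0$ put $D_r(x)=\mathbb D^{n+1}_+\cap \mathcal I_r(x)$. Let $1<p<\infty$ and let $\varphi:\mathbb R^{n+1}\times(0,\infty)\to(0,\infty)$ be measurable and such that, for some constant $C_0$, $$\int_r^\infty\Big(1+\ln\frac sr\Big)\frac{\operatorname{ess\,inf}_{s<\zeta<\infty}\varphi(x,\zeta)\,\zeta^{\frac{n+2}p}}{s^{\frac{n+2}p+1}}\,ds\le C_0\,\varphi(x,r)\qquad\text{for all }(x,r)\in\mathbb R^{n+1}\times(0,\infty).$$ The space $M_{p,\varphi}(\mathbb D^{n+1}_+)$ consists of the real functions $f$ that belong to $L_p(D_r(x))$ for all $x\in\mathbb D^{n+1}_+$, $r>0$, and satisfy $$\|f\|_{p,\varphi;\mathbb D^{n+1}_+}=\sup_{x\in\mathbb D^{n+1}_+,\,r>0}\varphi(x,r)^{-1}\Big(r^{-(n+2)}\int_{D_r(x)}|f(y)|^p\,dy\Big)^{1/p}<\infty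 .$$ The space $BMO(\mathbb D^{n+1}_+)$ consists of the real functions $a$ that are integrable on every $D_r(x)$ and satisfy $$\|a\|_*=\sup_{x\in\mathbb D^{n+1}_+,\,r>0}\frac1{|D_r(x)|}\int_{D_r(x)}|a(y)-a_{D_r(x)}|\,dy<\infty,$$ where $a_{D_r(x)}$ is the mean of $a$ over $D_r(x)$. Let $\mathcal K(x,\xi)$, $x\in\mathbb R^{n+1}$, $\xi\in\mathbb R^{n+1}\setminus\{0\}$, be a variable parabolic Calderón–Zygmund kernel: a measurable real function such that for a.e. $x$: $\mathcal K(x,\cdot)\in C^\infty(\mathbb R^{n+1}\setminus\{0\})$; $\mathcal K(x,(\mu\xi',\mu^2\xi_{n+1}))=\mu^{-n-2}\mathcal K(x,\xi)$ for all $\mu>0$; $\mathcal K(x,\cdot)$ is integrable on the Euclidean unit sphere $\mathbb S^n\subset\mathbb R^{n+1}$ with $\int_{\mathbb S^n}\mathcal K(x,\xi)\,d\sigma_\xi=0$; and such that $D^\beta_\xi\mathcal K\in L_\infty(\mathbb R^{n+1}\times\mathbb S^n)$ for every multi-index $\beta$. Let $\mathbf a=\{a^{ij}\}_{i,j=1}^n$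 be a measurable matrix function which for a.e. $x\in\mathbb D^{n+1}_+$ is symmetric and satisfies $\Lambda^{-1}|\xi|^2\le a^{ij}(x)\xi_i\xi_j\le\Lambda|\xi|^2$ for all $\xi\in\mathbb R^n$, with a constant $\Lambda>0$. Let $\mathbf a^n$ be its last row, and define the generalized reflection $$\mathcal T(x)=\Big(x'-2x_n\frac{\mathbf a^n(x',t)}{a^{nn}(x',t)},\ t\Big),\qquad x=(x',t)\in\mathbb D^{n+1}_+ .$$ For $f\in M_{p,\varphi}(\mathbb D^{n+1}_+)$ and $a\in BMO(\mathbb D^{n+1}_+)$ put $$\widetilde{\mathfrak K}f(x)=\int_{\mathbb D^{n+1}_+}\mathcal K(x,\mathcal T(x)-y)f(y)\,dy,\qquad \widetilde{\mathfrak C}[a,f](x)=\int_{\mathbb D^{n+1}_+}\mathcal K(x,\mathcal T(x)-y)[a(y)-a(x)]f(y)\,dy .$$ Then these integrals converge absolutely for a.e. $x\in\mathbb D^{n+1}_+$, the functions $\widetilde{\mathfrak K}f$ and $\widetilde{\mathfrak C}[a,f]$ belong to $M_{p,\varphi}(\mathbb D^{n+1}_+)$, and there is a constant $C>0$, independent of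 $a$ and $f$, such that for all $a\in BMO(\mathbb D^{n+1}_+)$ and $f\in M_{p,\varphi}(\mathbb D^{n+1}_+)$ $$\|\widetilde{\mathfrak K}f\|_{p,\varphi;\mathbb D^{n+1}_+}\le C\|f\|_{p,\varphi;\mathbb D^{n+1}_+},\qquad \|\widetilde{\mathfrak C}[a,f]\|_{p,\varphi;\mathbb D^{n+1}_+}\le C\|a\|_*\|f\|_{p,\varphi;\mathbb D^{n+1}_+}.$$ Moreover $\widetilde{\mathfrak K}$ and $\widetilde{\mathfrak C}[a,\cdot]$ are continuous on $M_{p,\varphi}(\mathbb D^{n+1}_+)$: for all $f,g\in M_{p,\varphi}(\mathbb D^{n+1}_+)$, $\|\widetilde{\mathfrak K}f-\widetilde{\mathfrak K}g\|_{p,\varphi;\mathbb D^{n+1}_+}\le C\|f-g\|_{p,\varphi;\mathbb D^{n+1}_+}$ and $\|\widetilde{\mathfrak C}[a,f]-\widetilde{\mathfrak C}[a,g]\|_{p,\varphi;\mathbb D^{n+1}_+}\le C\|a\|_*\|f-g\|_{p,\varphi;\mathbb D^{n+1}_+}$. -/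

import Mathlib

open MeasureTheory
open scoped ENNReal ContDiff

noncomputable section

/-- The space `ℝⁿ⁺¹ = ℝⁿ × ℝ` of points `x = (x', t)`. The spatial coordinates are
`x i.castSucc` for `i : Fin n`, the time coordinate is `x (Fin.last n)`. -/
abbrev ParaSpace (n : ℕ) : Type := EuclideanSpace ℝ (Fin (n + 1))

/-- The index of the last spatial coordinate `xₙ`. -/
def lastSpatial (n : ℕ) [NeZero n] : Fin n :=
  ⟨n - 1, Nat.sub_one_lt (NeZero.ne n)⟩

/-- The Euclidean length `|x'|` of the spatial part of `x = (x', t)`. -/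
def spatialNorm {n : ℕ} (x : ParaSpace n) : ℝ :=
  Real.sqrt (∑ i : Fin n, x i.castSucc ^ 2)

/-- The parabolic cylinder `{y : |x' - y'| < r, |t - τ| < r²}`. -/
def paraCylinder {n : ℕ} (x : ParaSpace n) (r : ℝ) : Set (ParaSpace n) :=
  {y | spatialNorm (x - y) < r ∧ |x (Fin.last n) - y (Fin.last n)| < r ^ 2}

/-- The domain `{xₙ > 0, t > 0} = ℝⁿ⁻¹ × ℝ₊ × ℝ₊`. -/
def upperDomain (n : ℕ) [NeZero n] : Set (ParaSpace n) :=
  {x | 0 < x (lastSpatial n).castSucc ∧ 0 < x (Fin.last n)}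

/-- The parabolic dilation `(ξ', τ) ↦ (μ ξ', μ² τ)`. -/
def paraDilation {n : ℕ} (μ : ℝ) (ξ : ParaSpace n) : ParaSpace n :=
  WithLp.toLp 2 (Fin.snoc (α := fun _ => ℝ) (fun i : Fin n => μ * ξ i.castSucc)
    (μ ^ 2 * ξ (Fin.last n)))

/-- A parabolic Calderón–Zygmund kernel, as a function on `ℝⁿ⁺¹ \ {0}` (the value at `0` is
irrelevant). The sphere carries its usual surface measure. -/
structure IsParaCZKernel {n : ℕ} (k : ParaSpace n → ℝ) : Prop where
  smooth : ContDiffOn ℝ ∞ k {0}ᶜ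
  homogeneous : ∀ μ : ℝ, 0 < μ → ∀ ξ : ParaSpace n, ξ ≠ 0 →
    k (paraDilation μ ξ) = (μ ^ (n + 2))⁻¹ * k ξ
  integrable : Integrable (fun ξ : Metric.sphere (0 : ParaSpace n) 1 => k ξ)
    (volume : Measure (ParaSpace n)).toSphere
  cancel : ∫ ξ : Metric.sphere (0 : ParaSpace n) 1, k ξ
    ∂(volume : Measure (ParaSpace n)).toSphere = 0

/-- A variable parabolic Calderón–Zygmund kernel `K(x, ξ)`. In `bounded`, the partial derivative
`∂_{β 0} ⋯ ∂_{β (m-1)}` in `ξ` stands for a multi-index derivative of order `m`; as it is continuous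
in `ξ`, its essential supremum over `ξ` in the sphere is the supremum. -/
structure IsVariableParaCZKernel {n : ℕ} (K : ParaSpace n → ParaSpace n → ℝ) : Prop where
  measurable : AEMeasurable (fun z : ParaSpace n × ParaSpace n => K z.1 z.2) volume
  kernel : ∀ᵐ x : ParaSpace n, IsParaCZKernel (K x)
  bounded : ∀ (m : ℕ) (β : Fin m → Fin (n + 1)), ∃ M : ℝ, ∀ᵐ x : ParaSpace n,
    ∀ ξ ∈ Metric.sphere (0 : ParaSpace n) 1,
      |iteratedFDeriv ℝ m (K x) ξ (fun j => EuclideanSpace.single (β j) (1 : ℝ))| ≤ M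

/-- Measurable, symmetric, uniformly elliptic and bounded coefficient matrices on `Q`. -/
def IsUniformlyElliptic {n : ℕ} (Q : Set (ParaSpace n))
    (A : ParaSpace n → Matrix (Fin n) (Fin n) ℝ) : Prop :=
  (∀ i j, AEMeasurable (fun x => A x i j) (volume.restrict Q)) ∧
  ∃ Λ : ℝ, 0 < Λ ∧ ∀ᵐ x ∂(volume.restrict Q),
    (∀ i j, A x i j = A x j i) ∧
    ∀ ξ : Fin n → ℝ,
      Λ⁻¹ * ∑ i, ξ i ^ 2 ≤ ∑ i, ∑ j, A x i j * ξ i * ξ j ∧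
      ∑ i, ∑ j, A x i j * ξ i * ξ j ≤ Λ * ∑ i, ξ i ^ 2

/-- The generalized reflection `(x', t) ↦ (x' - 2 xₙ aⁿ(x', t) / aⁿⁿ(x', t), t)`, with `aⁿ` the
last row of the matrix `A`. -/
def genReflection {n : ℕ} [NeZero n] (A : ParaSpace n → Matrix (Fin n) (Fin n) ℝ)
    (x : ParaSpace n) : ParaSpace n :=
  WithLp.toLp 2 (Fin.snoc (α := fun _ => ℝ)
    (fun i : Fin n => x i.castSucc - 2 * x (lastSpatial n).castSucc *
      (A x (lastSpatial n) i / A x (lastSpatial n) (lastSpatial n)))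
    (x (Fin.last n)))

/-- The `BMO(Q)` seminorm, the supremum of the mean oscillations over the sets
`Q_r(x) = Q ∩ paraCylinder x r` with `x ∈ Q`, `r > 0`. -/
def bmoNorm {n : ℕ} (Q : Set (ParaSpace n)) (a : ParaSpace n → ℝ) : ℝ≥0∞ :=
  ⨆ x ∈ Q, ⨆ r : ℝ, ⨆ _ : 0 < r,
    (volume (Q ∩ paraCylinder x r))⁻¹ *
      ∫⁻ y in Q ∩ paraCylinder x r, ‖a y - ⨍ z in Q ∩ paraCylinder x r, a z‖ₑ

/-- `a ∈ BMO(Q)`. -/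
def MemBMO {n : ℕ} (Q : Set (ParaSpace n)) (a : ParaSpace n → ℝ) : Prop :=
  (∀ x ∈ Q, ∀ r : ℝ, 0 < r → IntegrableOn a (Q ∩ paraCylinder x r)) ∧ bmoNorm Q a < ⊤

/-- The norm of the generalized parabolic Morrey space `M_{p,φ}(Q)`. -/
def morreyNorm {n : ℕ} (Q : Set (ParaSpace n)) (p : ℝ) (φ : ParaSpace n → ℝ → ℝ)
    (f : ParaSpace n → ℝ) : ℝ≥0∞ :=
  ⨆ x ∈ Q, ⨆ r : ℝ, ⨆ _ : 0 < r,
    (ENNReal.ofReal (φ x r))⁻¹ *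
      ((ENNReal.ofReal (r ^ (n + 2)))⁻¹ *
        ∫⁻ y in Q ∩ paraCylinder x r, ‖f y‖ₑ ^ p) ^ (1 / p)

/-- `f ∈ M_{p,φ}(Q)`. -/
def MemMorrey {n : ℕ} (Q : Set (ParaSpace n)) (p : ℝ) (φ : ParaSpace n → ℝ → ℝ)
    (f : ParaSpace n → ℝ) : Prop :=
  (∀ x ∈ Q, ∀ r : ℝ, 0 < r →
    MemLp f (ENNReal.ofReal p) (volume.restrict (Q ∩ paraCylinder x r))) ∧
  morreyNorm Q p φ f < ⊤

/-- Measurable positive weights `φ(x, r)` on `ℝⁿ⁺¹ × ℝ₊` with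
`∫_r^∞ (1 + ln (s/r)) (ess inf_{s<ζ<∞} φ(x,ζ) ζ^{(n+2)/p}) s^{-(n+2)/p-1} ds ≤ C φ(x, r)`. -/
structure IsMorreyWeight {n : ℕ} (p : ℝ) (φ : ParaSpace n → ℝ → ℝ) : Prop where
  measurable : AEMeasurable (fun z : ParaSpace n × ℝ => φ z.1 z.2)
    (volume.restrict (Set.univ ×ˢ Set.Ioi (0 : ℝ)))
  pos : ∀ (x : ParaSpace n) (r : ℝ), 0 < r → 0 < φ x r
  integral_le : ∃ C : ℝ, ∀ (x : ParaSpace n) (r : ℝ), 0 < r →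
    ∫⁻ s in Set.Ioi r, ENNReal.ofReal (1 + Real.log (s / r)) *
        (essInf (fun ζ : ℝ => ENNReal.ofReal (φ x ζ * ζ ^ (((n : ℝ) + 2) / p)))
            (volume.restrict (Set.Ioi s)) /
          ENNReal.ofReal (s ^ (((n : ℝ) + 2) / p + 1)))
      ≤ ENNReal.ofReal (C * φ x r)

/-- The nonsingular integral `∫ K(x, 𝒯(x) - y) f(y) dy` over the domain `{yₙ > 0, τ > 0}`. -/
def nonsingIntegral {n : ℕ} [NeZero n] (K : ParaSpace n → ParaSpace n → ℝ)
    (A : ParaSpace n → Matrix (Fin n) (Fin n) ℝ) (f : ParaSpace n → ℝ) (x : ParaSpace n) : ℝ :=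
  ∫ y in upperDomain n, K x (genReflection A x - y) * f y

/-- The nonsingular commutator `∫ K(x, 𝒯(x) - y) [a(y) - a(x)] f(y) dy`. -/
def nonsingCommutator {n : ℕ} [NeZero n] (K : ParaSpace n → ParaSpace n → ℝ)
    (A : ParaSpace n → Matrix (Fin n) (Fin n) ℝ) (a f : ParaSpace n → ℝ) (x : ParaSpace n) : ℝ :=
  ∫ y in upperDomain n, K x (genReflection A x - y) * (a y - a x) * f y

end

/-!
The kernel `K(x, 𝒯(x) - y)` is not singular in the domain: the last spatial coordinate of `𝒯(x)`
is `-xₙ`, so the parabolic distance of `𝒯(x)` and `y` is at least a multiple of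
`d(x, y) = |x' - y'| + |t - τ|^{1/2} + xₙ + yₙ` (`reflDist`). By homogeneity and boundedness on
the sphere, `|K(x, 𝒯(x) - y)| ≤ C d(x, y)^{-(n+2)}` (`exists_enorm_kernel_le`). Both operators are
dominated by one positive operator,
`majorant a κ f (x) = ∫ d(x, y)^{-(n+2)} (κ + |a(x) - a(y)|) f(y) dy`: the integral with `a = 0`,
`κ = 1`, the commutator with any `κ > 0` that bounds the mean oscillations of `a` (`BoxBMO`). It
remains to bound the majorant on the Morrey space by a multiple of `κ`.

Oscillations are measured on parabolic boxes. The Calderón–Zygmund stopping argument on their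
dyadic grids gives the John–Nirenberg inequality in `L^q` form (`BoxBMO.lintegral_rpow_le`), and
with it a bound by `(ℓ₂/ℓ₁)^ε` for the difference of the averages over nested boxes of sides
`ℓ₁ ≤ ℓ₂`.

On `L^p` the majorant is bounded by the Schur test with powers of `xₙ`
(`exists_lintegral_majorant_rpow_le`). For a constant `a` the test rests on
`∫ d(x, y)^{-(n+2)} yₙ^{-σ} dy ≤ C xₙ^{-σ}` for `0 < σ < 1`. In general, `a(x) - a(y)` is split
through the averages of `a` over the Whitney boxes of `x` and `y`. The difference of these
averages is at most a multiple of `κ` times a small power of `d(x, y)² / (xₙ yₙ)`, which the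
potential estimate absorbs, and the oscillation of `a` at `y` about its Whitney average can be
integrated out box by box, as `d(x, ·)` and `yₙ` are essentially constant on Whitney boxes
(`BoxBMO.lintegral_mul_whitney_le`).

For the local estimate on `D_r(x₀)` (`exists_localLp_majorant_le`), the part of `f` in
`D_{4r}(x₀)` is treated by the `L^p` bound, the rest by shells of radius `4^k r`. The averages of
`a` drift linearly in `k` from shell to shell, and this is the logarithm in the condition on `φ`.
As the local norms `‖f‖_{L^p(D_s(x₀))}` increase with `s`, they are bounded by the essential
infimum over `ζ > s` of `‖f‖_{p,φ} φ(x₀, ζ) ζ^{(n+2)/p}`. So the sum over the shells is bounded by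
the integral in the condition on `φ` (`IsMorreyWeight.exists_tsum_le`), hence by `φ(x₀, r)`.
-/

/-! ### The John–Nirenberg inequality on nested partitions -/

section Dyadic

variable {X ι : Type*}

/-- The level-`k` cell of `x`: the fibre of the labelling `π k` through `x`. -/
def cell (π : ℕ → X → ι) (k : ℕ) (x : X) : Set X := {y | π k y = π k x}

/-- A sequence of measurable partitions of a topological space, given by their labellings
`π k`, each refining the previous one and with cells shrinking to points. -/
structure IsDyadicSystem [TopologicalSpace X] [MeasurableSpace X] (π : ℕ → X → ι) : Prop where
  measurableSet_fiber : ∀ k v, MeasurableSet {y | π k y = v}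
  refine_succ : ∀ k x y, π (k + 1) x = π (k + 1) y → π k x = π k y
  exists_cell_subset : ∀ x (U : Set X), IsOpen U → x ∈ U → ∃ k, ∀ l, k ≤ l → cell π l x ⊆ U

/-- Two measures that compare on each fibre of a labelling meeting a saturated set compare on that
set. -/
theorem measure_le_of_forall_fiber [MeasurableSpace X] [Countable ι] {ν₁ ν₂ : Measure X} {f : X → ι}
    (hf : ∀ v, MeasurableSet {y | f y = v}) {E : Set X}
    (hE : ∀ x y, f y = f x → x ∈ E → y ∈ E)
    (h : ∀ x ∈ E, ν₁ {y | f y = f x} ≤ ν₂ {y | f y = f x}) : ν₁ E ≤ ν₂ E := by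
  have hEU : E = ⋃ v ∈ f '' E, {y | f y = v} := by
    ext y
    simp only [Set.mem_iUnion, Set.mem_ofPred_eq, exists_prop]
    constructor
    · intro hy
      exact ⟨f y, ⟨y, hy, rfl⟩, rfl⟩
    · rintro ⟨v, ⟨x, hx, rfl⟩, hyx⟩
      exact hE x y hyx hx
  have hd : (f '' E).PairwiseDisjoint (fun v => {y | f y = v}) := by
    intro v _ w _ hvw
    refine Set.disjoint_left.2 fun y hy hy' => hvw ?_
    exact hy.symm.trans hy'
  rw [hEU, measure_biUnion (Set.to_countable _) hd fun v _ => hf v,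
    measure_biUnion (Set.to_countable _) hd fun v _ => hf v]
  refine ENNReal.tsum_le_tsum ?_
  rintro ⟨v, ⟨x, hx, rfl⟩⟩
  exact h x hx

theorem measurableSet_of_saturated [MeasurableSpace X] [Countable ι] {f : X → ι}
    (hf : ∀ v, MeasurableSet {y | f y = v}) {E : Set X}
    (hE : ∀ x y, f y = f x → x ∈ E → y ∈ E) : MeasurableSet E := by
  have hEU : E = ⋃ v ∈ f '' E, {y | f y = v} := by
    ext y
    simp only [Set.mem_iUnion, Set.mem_ofPred_eq, exists_prop]
    constructor
    · intro hy
      exact ⟨f y, ⟨y, hy, rfl⟩, rfl⟩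
    · rintro ⟨v, ⟨x, hx, rfl⟩, hyx⟩
      exact hE x y hyx hx
  rw [hEU]
  exact MeasurableSet.biUnion (Set.to_countable _) fun v _ => hf v

variable {π : ℕ → X → ι}

theorem mem_cell_self (k : ℕ) (x : X) : x ∈ cell π k x := rfl

theorem cell_eq_of_mem {k : ℕ} {x y : X} (h : y ∈ cell π k x) : cell π k y = cell π k x := by
  ext z
  simp only [cell, Set.mem_ofPred_eq] at h ⊢
  rw [h]

theorem enorm_setAverage_sub_mul_measure_le [MeasurableSpace X] {μ : Measure X} {s : Set X}
    (hs : μ s ≠ ⊤) {a : X → ℝ} (ha : IntegrableOn a s μ) (c : ℝ) :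
    ‖(⨍ y in s, a y ∂μ) - c‖ₑ * μ s ≤ ∫⁻ y in s, ‖a y - c‖ₑ ∂μ := by
  rcases eq_or_ne (μ s) 0 with h0 | h0
  · simp [h0]
  have hfin : IsFiniteMeasure (μ.restrict s) := ⟨by simpa using hs.lt_top⟩
  have hpos : 0 < μ.real s := ENNReal.toReal_pos h0 hs
  have h1 : μ.real s * ((⨍ y in s, a y ∂μ) - c) = ∫ y in s, (a y - c) ∂μ := by
    rw [integral_sub ha (integrable_const c), setAverage_eq, smul_eq_mul, integral_const,
      smul_eq_mul, mul_sub, mul_inv_cancel_left₀ hpos.ne']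
    simp
  calc ‖(⨍ y in s, a y ∂μ) - c‖ₑ * μ s
      = ‖μ.real s * ((⨍ y in s, a y ∂μ) - c)‖ₑ := by
        rw [enorm_mul, mul_comm, Real.enorm_of_nonneg hpos.le, measureReal_def,
          ENNReal.ofReal_toReal hs]
    _ = ‖∫ y in s, (a y - c) ∂μ‖ₑ := by rw [h1]
    _ ≤ _ := enorm_integral_le_lintegral_enorm _

variable [TopologicalSpace X] [MeasurableSpace X]

theorem IsDyadicSystem.measurableSet_cell (hπ : IsDyadicSystem π) (k : ℕ) (x : X) :
    MeasurableSet (cell π k x) := hπ.measurableSet_fiber k _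

theorem IsDyadicSystem.eq_of_le (hπ : IsDyadicSystem π) {k l : ℕ} (hkl : k ≤ l) {x y : X}
    (h : π l x = π l y) : π k x = π k y := by
  induction l, hkl using Nat.le_induction with
  | base => exact h
  | succ l _ ih => exact ih (hπ.refine_succ _ _ _ h)

theorem IsDyadicSystem.cell_anti (hπ : IsDyadicSystem π) {k l : ℕ} (hkl : k ≤ l) (x : X) :
    cell π l x ⊆ cell π k x := fun _ hy => hπ.eq_of_le hkl hy

variable [Countable ι]

/-- **Stopping-time comparison.** If `ν₁ ≤ ν₂` on every cell at which the condition `P` holds for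
the first time, then `ν₁ ≤ ν₂` on the set of points at which `P` holds for some level. -/
theorem IsDyadicSystem.measure_stopping_le (hπ : IsDyadicSystem π) {ν₁ ν₂ : Measure X}
    {P : ℕ → X → Prop} (hP : ∀ i x y, π i y = π i x → P i x → P i y)
    (h : ∀ i x, P i x → (∀ l < i, ¬ P l x) → ν₁ (cell π i x) ≤ ν₂ (cell π i x)) :
    ν₁ {x | ∃ i, P i x} ≤ ν₂ {x | ∃ i, P i x} := by
  classical
  set E : ℕ → Set X := fun i => {x | P i x ∧ ∀ l < i, ¬ P l x} with hE
  have hsat : ∀ i x y, π i y = π i x → x ∈ E i → y ∈ E i := by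
    intro i x y hxy hx
    refine ⟨hP i x y hxy hx.1, fun l hl hPl => hx.2 l hl ?_⟩
    exact hP l y x (hπ.eq_of_le hl.le hxy.symm) hPl
  have hU : {x | ∃ i, P i x} = ⋃ i, E i := by
    ext x
    simp only [Set.mem_ofPred_eq, Set.mem_iUnion]
    constructor
    · intro hx
      exact ⟨Nat.find hx, Nat.find_spec hx, fun l hl => Nat.find_min hx hl⟩
    · rintro ⟨i, hi⟩
      exact ⟨i, hi.1⟩
  have hd : Pairwise (Function.onFun Disjoint E) := by
    intro i j hij
    refine Set.disjoint_left.2 fun x hx hx' => ?_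
    rcases lt_or_gt_of_ne hij with hlt | hlt
    · exact hx'.2 i hlt hx.1
    · exact hx.2 j hlt hx'.1
  have hm : ∀ i, MeasurableSet (E i) := fun i =>
    measurableSet_of_saturated (hπ.measurableSet_fiber i) (hsat i)
  rw [hU, measure_iUnion hd hm, measure_iUnion hd hm]
  refine ENNReal.tsum_le_tsum fun i => ?_
  exact measure_le_of_forall_fiber (hπ.measurableSet_fiber i) (hsat i)
    fun x hx => h i x hx.1 hx.2

variable {μ : Measure X} [μ.OuterRegular]

/-- A one-sided Lebesgue differentiation theorem: a function is almost everywhere bounded by the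
supremum of its averages over the cells. It follows from outer regularity, by comparing a
neighbourhood of the exceptional set with the first cells it contains. -/
theorem IsDyadicSystem.measure_exceptional_eq_zero (hπ : IsDyadicSystem π) {k : ℕ} {x₀ : X}
    (hfin : μ (cell π k x₀) ≠ ⊤) {g : X → ℝ≥0∞} (hg : Measurable g) {c : ℝ≥0∞} (hc : c ≠ ⊤) :
    μ {y | y ∈ cell π k x₀ ∧ (∀ i, k ≤ i → ∫⁻ z in cell π i y, g z ∂μ ≤ c * μ (cell π i y)) ∧
      c < g y} = 0 := by
  set Z₀ : Set X := {y | y ∈ cell π k x₀ ∧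
    ∀ i, k ≤ i → ∫⁻ z in cell π i y, g z ∂μ ≤ c * μ (cell π i y)} with hZ₀
  have hZ₀m : MeasurableSet Z₀ := by
    have : Z₀ = cell π k x₀ ∩ ⋂ i, ⋂ (_ : k ≤ i),
        {y | ∫⁻ z in cell π i y, g z ∂μ ≤ c * μ (cell π i y)} := by
      ext y
      simp [hZ₀]
    rw [this]
    refine (hπ.measurableSet_cell k x₀).inter (MeasurableSet.iInter fun i =>
      MeasurableSet.iInter fun _ => ?_)
    refine measurableSet_of_saturated (hπ.measurableSet_fiber i) fun x y hxy hx => ?_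
    have : cell π i y = cell π i x := cell_eq_of_mem hxy
    simpa only [Set.mem_ofPred_eq, this] using hx
  set Z : Set X := Z₀ ∩ {y | c < g y} with hZ
  have hZm : MeasurableSet Z := hZ₀m.inter (measurableSet_lt measurable_const hg)
  have hZfin : μ Z ≠ ⊤ :=
    ne_top_of_le_ne_top hfin (measure_mono fun y hy => hy.1.1)
  have key : ∫⁻ z in Z, g z ∂μ ≤ c * μ Z := by
    refine ENNReal.le_of_forall_pos_le_add fun ε hε _ => ?_
    obtain ⟨U, hZU, hUo, hU⟩ : ∃ U ⊇ Z, IsOpen U ∧ μ U < μ Z + ε / (c + 1) := by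
      refine Set.exists_isOpen_lt_of_lt Z _ (ENNReal.lt_add_right hZfin ?_)
      exact (ENNReal.div_pos (by exact_mod_cast hε.ne') (by finiteness)).ne'
    set ν₁ : Measure X := (μ.restrict Z).withDensity g
    have hν₁ : ∀ s, MeasurableSet s → ν₁ s = ∫⁻ z in s ∩ Z, g z ∂μ := by
      intro s hs
      rw [withDensity_apply _ hs, Measure.restrict_restrict hs]
    set P : ℕ → X → Prop := fun i x => k ≤ i ∧ x ∈ cell π k x₀ ∧ cell π i x ⊆ U with hP
    have hcmp := hπ.measure_stopping_le (ν₁ := ν₁) (ν₂ := c • μ) (P := P) ?_ ?_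
    · have h1 : Z ⊆ {x | ∃ i, P i x} := by
        intro y hy
        obtain ⟨l, hl⟩ := hπ.exists_cell_subset y U hUo (hZU hy)
        exact ⟨max k l, le_max_left _ _, hy.1.1, hl _ (le_max_right _ _)⟩
      have h2 : {x | ∃ i, P i x} ⊆ U := by
        rintro x ⟨i, -, -, hx⟩
        exact hx rfl
      calc ∫⁻ z in Z, g z ∂μ = ν₁ Z := by rw [hν₁ Z hZm, Set.inter_self]
        _ ≤ ν₁ {x | ∃ i, P i x} := measure_mono h1
        _ ≤ (c • μ) {x | ∃ i, P i x} := hcmp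
        _ ≤ c * μ U := by
          rw [Measure.smul_apply, smul_eq_mul]
          gcongr
        _ ≤ c * (μ Z + ε / (c + 1)) := by gcongr
        _ ≤ c * μ Z + ε := by
          rw [mul_add]
          gcongr
          calc c * (ε / (c + 1)) ≤ (c + 1) * (ε / (c + 1)) := by gcongr; exact le_self_add
            _ ≤ ε := ENNReal.mul_div_le
    · rintro i x y hxy ⟨h1, h2, h3⟩
      refine ⟨h1, ?_, ?_⟩
      · exact (hπ.eq_of_le h1 hxy).trans h2
      · rwa [cell_eq_of_mem (π := π) hxy]
    · rintro i x ⟨h1, h2, h3⟩ -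
      rw [hν₁ _ (hπ.measurableSet_cell i x), Measure.smul_apply, smul_eq_mul]
      rcases (cell π i x ∩ Z).eq_empty_or_nonempty with he | ⟨y, hy, hyZ⟩
      · simp [he]
      · calc ∫⁻ z in cell π i x ∩ Z, g z ∂μ ≤ ∫⁻ z in cell π i x, g z ∂μ :=
              lintegral_mono_set Set.inter_subset_left
          _ ≤ c * μ (cell π i x) := by
            have := hyZ.1.2 i h1
            rwa [cell_eq_of_mem hy] at this
  have hgoal : {y | y ∈ cell π k x₀ ∧
      (∀ i, k ≤ i → ∫⁻ z in cell π i y, g z ∂μ ≤ c * μ (cell π i y)) ∧ c < g y} = Z := by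
    ext y
    exact ⟨fun h => ⟨⟨h.1, h.2.1⟩, h.2.2⟩, fun h => ⟨h.1.1, h.1.2, h.2⟩⟩
  rw [hgoal]
  by_contra hne
  have hlt := setLIntegral_strict_mono (μ := μ) (f := fun _ => c) hZm hne hg
    (by rw [setLIntegral_const]; finiteness)
    (Filter.Eventually.of_forall fun y hy => hy.2)
  rw [setLIntegral_const] at hlt
  exact absurd key (not_le.2 hlt)

/-- **Weak John–Nirenberg inequality.** If the mean oscillations of `a` over the subcells of a cell
are at most `κ` and the measure of a cell is at most `D` times that of each child, then the
distribution function of the oscillation decays geometrically. The induction step is the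
Calderón–Zygmund decomposition: the first cells on which the average of `|a - c|` exceeds `2κ` fill
at most half of the cell, and their averages differ from `c` by at most `2κD`. -/
theorem IsDyadicSystem.measure_oscillation_le (hπ : IsDyadicSystem π) {a : X → ℝ}
    (ham : Measurable a) {D κ : ℝ≥0∞} (hD : 1 ≤ D) (hκ : κ ≠ 0) (hκt : κ ≠ ⊤)
    {x₀ : X} {k₀ : ℕ}
    (h0 : ∀ k, k₀ ≤ k → ∀ x ∈ cell π k₀ x₀, μ (cell π k x) ≠ 0)
    (hfin : μ (cell π k₀ x₀) ≠ ⊤)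
    (hdbl : ∀ k, k₀ ≤ k → ∀ x ∈ cell π k₀ x₀, μ (cell π k x) ≤ D * μ (cell π (k + 1) x))
    (hint : IntegrableOn a (cell π k₀ x₀) μ)
    (hosc : ∀ k, k₀ ≤ k → ∀ x ∈ cell π k₀ x₀,
      ∫⁻ y in cell π k x, ‖a y - ⨍ z in cell π k x, a z ∂μ‖ₑ ∂μ ≤ κ * μ (cell π k x))
    (j : ℕ) : ∀ k, k₀ ≤ k → ∀ x ∈ cell π k₀ x₀,
      μ {y | y ∈ cell π k x ∧ 2 * D * κ * j < ‖a y - ⨍ z in cell π k x, a z ∂μ‖ₑ} ≤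
        2⁻¹ ^ j * μ (cell π k x) := by
  induction j with
  | zero =>
    intro k _ x _
    simp only [pow_zero, one_mul]
    exact measure_mono fun y hy => hy.1
  | succ j ih =>
    intro k hk x hx
    set B := cell π k x with hB
    set c : ℝ := ⨍ z in B, a z ∂μ with hc
    have hBsub : B ⊆ cell π k₀ x₀ := by
      rw [← cell_eq_of_mem hx]
      exact hπ.cell_anti hk x
    have hfinB : μ B ≠ ⊤ := ne_top_of_le_ne_top hfin (measure_mono hBsub)
    have hg : Measurable fun y => ‖a y - c‖ₑ := (ham.sub_const c).enorm
    set T : Set X := {y | y ∈ B ∧ 2 * D * κ * (j + 1 : ℕ) < ‖a y - c‖ₑ} with hT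
    have hTm : MeasurableSet T :=
      (hπ.measurableSet_cell k x).inter (measurableSet_lt measurable_const hg)
    set P : ℕ → X → Prop := fun i y => k ≤ i ∧ y ∈ B ∧
      2 * κ * μ (cell π i y) < ∫⁻ z in cell π i y, ‖a z - c‖ₑ ∂μ with hP
    have hPsat : ∀ i y z, π i z = π i y → P i y → P i z := by
      rintro i y z hyz ⟨h1, h2, h3⟩
      refine ⟨h1, (hπ.eq_of_le h1 hyz).trans h2, ?_⟩
      rwa [cell_eq_of_mem (π := π) hyz]
    set E : Set X := {y | ∃ i, P i y} with hE
    have hEB : E ⊆ B := by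
      rintro y ⟨i, -, hy, -⟩
      exact hy
    -- the stopped cells fill at most half of `B`
    have hhalf : μ E ≤ 2⁻¹ * μ B := by
      have h1 := hπ.measure_stopping_le (ν₁ := (2 * κ) • μ)
        (ν₂ := (μ.restrict B).withDensity fun y => ‖a y - c‖ₑ) hPsat ?_
      · have h2 : (2 * κ) * μ E ≤ κ * μ B := by
          calc (2 * κ) * μ E ≤ ((μ.restrict B).withDensity fun y => ‖a y - c‖ₑ) E := h1
            _ ≤ ((μ.restrict B).withDensity fun y => ‖a y - c‖ₑ) Set.univ :=
              measure_mono (Set.subset_univ _)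
            _ = ∫⁻ y in B, ‖a y - c‖ₑ ∂μ := by
              rw [withDensity_apply _ MeasurableSet.univ, Measure.restrict_univ]
            _ ≤ κ * μ B := hosc k hk x hx
        have h3 : κ * (2 * μ E) ≤ κ * μ B := by
          calc κ * (2 * μ E) = 2 * κ * μ E := by ring
            _ ≤ _ := h2
        have h4 : 2 * μ E ≤ μ B := (ENNReal.mul_le_mul_iff_right hκ hκt).1 h3
        rw [mul_comm, ← div_eq_mul_inv, ENNReal.le_div_iff_mul_le (by simp) (by simp), mul_comm]
        exact h4
      · rintro i y ⟨h1, h2, h3⟩ -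
        have hsub : cell π i y ⊆ B := by
          rw [hB, ← cell_eq_of_mem h2]
          exact hπ.cell_anti h1 y
        rw [Measure.smul_apply, smul_eq_mul, withDensity_apply _ (hπ.measurableSet_cell i y),
          Measure.restrict_restrict (hπ.measurableSet_cell i y),
          Set.inter_eq_left.2 hsub]
        exact h3.le
    -- outside of the stopped cells the oscillation is at most `2κ` almost everywhere
    have hout : μ (T \ E) = 0 := by
      refine measure_mono_null ?_ (hπ.measure_exceptional_eq_zero (k := k) (x₀ := x) hfinB hg
        (c := 2 * κ) (by finiteness))
      rintro y ⟨⟨hyB, hy⟩, hyE⟩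
      refine ⟨hyB, fun i hi => ?_, lt_of_le_of_lt ?_ hy⟩
      · by_contra hcon
        exact hyE ⟨i, hi, hyB, not_le.1 hcon⟩
      · calc 2 * κ = 2 * 1 * κ * 1 := by ring
          _ ≤ 2 * D * κ * (j + 1 : ℕ) := by
            gcongr
            exact_mod_cast Nat.le_add_left 1 j
    -- the parent of a stopped cell is not stopped, so the average over the stopped cell differs
    -- from `c` by at most `2κD`, and the induction hypothesis applies in the stopped cell
    have hin : μ (T ∩ E) ≤ 2⁻¹ ^ j * μ E := by
      have h1 := hπ.measure_stopping_le (ν₁ := μ.restrict T) (ν₂ := (2⁻¹ ^ j : ℝ≥0∞) • μ) hPsat ?_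
      · rw [Measure.restrict_apply' hTm, Set.inter_comm] at h1
        exact h1
      · intro i y hPi hmin
        obtain ⟨h1, h2, h3⟩ := id hPi
        have hyB0 : y ∈ cell π k₀ x₀ := hBsub h2
        -- `B` itself is not stopped, so stopped cells have parents inside `B`
        have hki : k ≠ i := by
          rintro rfl
          have h4 := hosc k hk x hx
          rw [cell_eq_of_mem h2] at h3
          refine absurd (h3.trans_le h4) (not_lt.2 ?_)
          gcongr
          calc κ = 1 * κ := (one_mul κ).symm
            _ ≤ 2 * κ := by gcongr; norm_num
        obtain ⟨l, rfl⟩ : ∃ l, i = l + 1 := ⟨i - 1, by omega⟩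
        have hl : k ≤ l := by omega
        have hpar : ∫⁻ z in cell π l y, ‖a z - c‖ₑ ∂μ ≤ 2 * κ * μ (cell π l y) := by
          by_contra hcon
          exact hmin l (Nat.lt_succ_self l) ⟨hl, h2, not_le.1 hcon⟩
        set B' := cell π (l + 1) y with hB'
        have hsub : B' ⊆ B := by
          rw [hB, ← cell_eq_of_mem h2]
          exact hπ.cell_anti h1 y
        have hfin' : μ B' ≠ ⊤ := ne_top_of_le_ne_top hfinB (measure_mono hsub)
        have havg : ‖(⨍ z in B', a z ∂μ) - c‖ₑ ≤ 2 * D * κ := by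
          have h5 : ‖(⨍ z in B', a z ∂μ) - c‖ₑ * μ B' ≤ 2 * D * κ * μ B' := by
            calc ‖(⨍ z in B', a z ∂μ) - c‖ₑ * μ B' ≤ ∫⁻ z in B', ‖a z - c‖ₑ ∂μ :=
                  enorm_setAverage_sub_mul_measure_le hfin' (hint.mono_set (hsub.trans hBsub)) c
              _ ≤ ∫⁻ z in cell π l y, ‖a z - c‖ₑ ∂μ :=
                  lintegral_mono_set (hπ.cell_anti (Nat.le_succ l) y)
              _ ≤ 2 * κ * μ (cell π l y) := hpar
              _ ≤ 2 * κ * (D * μ B') := by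
                gcongr
                exact hdbl l (hk.trans hl) y hyB0
              _ = 2 * D * κ * μ B' := by ring
          exact (ENNReal.mul_le_mul_iff_left (h0 _ (hk.trans h1) y hyB0) hfin').1 h5
        rw [Measure.restrict_apply' hTm, Measure.smul_apply, smul_eq_mul]
        refine le_trans (measure_mono ?_) (ih (l + 1) (hk.trans h1) y hyB0)
        rintro z ⟨hz, -, hz2⟩
        refine ⟨hz, ?_⟩
        have h6 : ‖a z - c‖ₑ ≤ ‖a z - ⨍ z in B', a z ∂μ‖ₑ + 2 * D * κ := by
          calc ‖a z - c‖ₑ = ‖(a z - ⨍ z in B', a z ∂μ) + ((⨍ z in B', a z ∂μ) - c)‖ₑ := by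
                congr 1; ring
            _ ≤ _ := enorm_add_le _ _
            _ ≤ _ := by gcongr
        have h7 : 2 * D * κ * j + 2 * D * κ < ‖a z - ⨍ z in B', a z ∂μ‖ₑ + 2 * D * κ := by
          refine lt_of_lt_of_le ?_ h6
          convert hz2 using 1
          push_cast
          ring
        exact lt_of_add_lt_add_right h7
    calc μ T ≤ μ (T ∩ E) + μ (T \ E) := measure_le_inter_add_sdiff μ T E
      _ ≤ 2⁻¹ ^ j * (2⁻¹ * μ B) + 0 := by
        rw [hout]
        gcongr
        exact hin.trans (by gcongr)
      _ = 2⁻¹ ^ (j + 1) * μ B := by rw [pow_succ]; ring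

/-- The constant `∑ (2D(j+1))^q 2^{-j}` of the `L^q` form of the John–Nirenberg inequality. -/
noncomputable def jnConst (D : ℝ≥0∞) (q : ℝ) : ℝ≥0∞ :=
  ∑' j : ℕ, (2 * D * (j + 1 : ℕ)) ^ q * 2⁻¹ ^ j

/-- **John–Nirenberg inequality**, `L^q` form. -/
theorem IsDyadicSystem.lintegral_oscillation_rpow_le (hπ : IsDyadicSystem π) {a : X → ℝ}
    (ham : Measurable a) {D κ : ℝ≥0∞} (hD : 1 ≤ D) (hDt : D ≠ ⊤) (hκ : κ ≠ 0) (hκt : κ ≠ ⊤)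
    {x₀ : X} {k₀ : ℕ}
    (h0 : ∀ k, k₀ ≤ k → ∀ x ∈ cell π k₀ x₀, μ (cell π k x) ≠ 0)
    (hfin : μ (cell π k₀ x₀) ≠ ⊤)
    (hdbl : ∀ k, k₀ ≤ k → ∀ x ∈ cell π k₀ x₀, μ (cell π k x) ≤ D * μ (cell π (k + 1) x))
    (hint : IntegrableOn a (cell π k₀ x₀) μ)
    (hosc : ∀ k, k₀ ≤ k → ∀ x ∈ cell π k₀ x₀,
      ∫⁻ y in cell π k x, ‖a y - ⨍ z in cell π k x, a z ∂μ‖ₑ ∂μ ≤ κ * μ (cell π k x))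
    {q : ℝ} (hq : 0 < q) :
    ∫⁻ y in cell π k₀ x₀, ‖a y - ⨍ z in cell π k₀ x₀, a z ∂μ‖ₑ ^ q ∂μ ≤
      jnConst D q * κ ^ q * μ (cell π k₀ x₀) := by
  set B := cell π k₀ x₀ with hB
  set c : ℝ := ⨍ z in B, a z ∂μ with hc
  have hM : 2 * D * κ ≠ ⊤ := by finiteness
  have hM0 : 2 * D * κ ≠ 0 := by
    refine mul_ne_zero (mul_ne_zero (by simp) (zero_lt_one.trans_le hD).ne') hκ
  have hg : Measurable fun y => ‖a y - c‖ₑ := (ham.sub_const c).enorm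
  -- `‖a y - c‖ₑ` is at most `2Dκ(j + 1)` for the last `j` with `y ∈ T j`
  set T : ℕ → Set X := fun j => {y | y ∈ B ∧ 2 * D * κ * j < ‖a y - c‖ₑ} with hT
  have hTm : ∀ j, MeasurableSet (T j) := fun j =>
    (hπ.measurableSet_cell k₀ x₀).inter (measurableSet_lt measurable_const hg)
  have hpt : ∀ y ∈ B, ‖a y - c‖ₑ ^ q ≤
      ∑' j : ℕ, (T j).indicator (fun _ => (2 * D * κ * (j + 1 : ℕ)) ^ q) y := by
    intro y hy
    rcases eq_or_ne ‖a y - c‖ₑ 0 with h | h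
    · rw [h, ENNReal.zero_rpow_of_pos hq]
      exact zero_le
    · have hex : ∃ j : ℕ, ‖a y - c‖ₑ ≤ 2 * D * κ * (j + 1 : ℕ) := by
        obtain ⟨j, hj⟩ := ENNReal.exists_nat_mul_gt hM0 (show ‖a y - c‖ₑ ≠ ⊤ by simp)
        refine ⟨j, hj.le.trans ?_⟩
        rw [mul_comm]
        gcongr
        exact Nat.le_succ j
      classical
      set j := Nat.find hex with hj
      have hj1 : ‖a y - c‖ₑ ≤ 2 * D * κ * (j + 1 : ℕ) := Nat.find_spec hex
      have hj2 : y ∈ T j := by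
        refine ⟨hy, ?_⟩
        rcases Nat.eq_zero_or_pos j with h0 | h0
        · rw [h0]
          simpa using pos_iff_ne_zero.2 h
        · have := Nat.find_min hex (Nat.sub_lt h0 one_pos)
          rw [not_le] at this
          rwa [← hj, show j - 1 + 1 = j by omega] at this
      calc ‖a y - c‖ₑ ^ q ≤ (2 * D * κ * (j + 1 : ℕ)) ^ q := by gcongr
        _ = (T j).indicator (fun _ => (2 * D * κ * (j + 1 : ℕ)) ^ q) y := by
          rw [Set.indicator_of_mem hj2]
        _ ≤ _ := ENNReal.le_tsum (f := fun j =>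
          (T j).indicator (fun _ => (2 * D * κ * (j + 1 : ℕ)) ^ q) y) j
  calc ∫⁻ y in B, ‖a y - c‖ₑ ^ q ∂μ
      ≤ ∫⁻ y in B, ∑' j : ℕ, (T j).indicator (fun _ => (2 * D * κ * (j + 1 : ℕ)) ^ q) y ∂μ :=
        setLIntegral_mono' (hπ.measurableSet_cell k₀ x₀) hpt
    _ = ∑' j : ℕ, ∫⁻ y in B, (T j).indicator (fun _ => (2 * D * κ * (j + 1 : ℕ)) ^ q) y ∂μ :=
        lintegral_tsum fun j => (measurable_const.indicator (hTm j)).aemeasurable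
    _ ≤ ∑' j : ℕ, κ ^ q * μ B * ((2 * D * (j + 1 : ℕ)) ^ q * 2⁻¹ ^ j) := by
        refine ENNReal.tsum_le_tsum fun j => ?_
        rw [lintegral_indicator (hTm j), setLIntegral_const]
        calc (2 * D * κ * (j + 1 : ℕ)) ^ q * (μ.restrict B) (T j)
            ≤ (2 * D * κ * (j + 1 : ℕ)) ^ q * (2⁻¹ ^ j * μ B) := by
              gcongr
              exact (Measure.restrict_apply_le _ _).trans
                (hπ.measure_oscillation_le ham hD hκ hκt h0 hfin hdbl hint hosc j k₀ le_rfl x₀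
                  rfl)
          _ = _ := by
            rw [show 2 * D * κ * ((j + 1 : ℕ) : ℝ≥0∞) = κ * (2 * D * (j + 1 : ℕ)) by ring,
              ENNReal.mul_rpow_of_nonneg _ _ hq.le]
            ring
    _ = jnConst D q * κ ^ q * μ B := by
        rw [ENNReal.tsum_mul_left, jnConst]
        ring

theorem jnConst_ne_top {D : ℝ≥0∞} (hD : D ≠ ⊤) {q : ℝ} (hq : 0 < q) : jnConst D q ≠ ⊤ := by
  obtain ⟨N, hN⟩ := exists_nat_ge q
  have hle : jnConst D q ≤
      ∑' j : ℕ, (2 * D) ^ q * ENNReal.ofReal ((j + 1 : ℕ) ^ N * (1 / 2) ^ j) := by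
    refine ENNReal.tsum_le_tsum fun j => ?_
    rw [ENNReal.mul_rpow_of_nonneg _ _ hq.le, mul_assoc]
    gcongr
    rw [ENNReal.ofReal_mul (by positivity), ENNReal.ofReal_pow (by positivity),
      ENNReal.ofReal_pow (by positivity), ENNReal.ofReal_natCast]
    have : ENNReal.ofReal (1 / 2) = 2⁻¹ := by
      rw [one_div, ENNReal.ofReal_inv_of_pos (by norm_num)]
      simp
    rw [this]
    gcongr
    rw [← ENNReal.rpow_natCast _ N]
    exact ENNReal.rpow_le_rpow_of_exponent_le (by exact_mod_cast Nat.le_add_left 1 j) hN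
  refine ne_top_of_le_ne_top ?_ hle
  rw [ENNReal.tsum_mul_left]
  refine ENNReal.mul_ne_top (ENNReal.rpow_ne_top_of_nonneg hq.le (by finiteness)) ?_
  have hs : Summable fun j : ℕ => ((j + 1 : ℕ) : ℝ) ^ N * (1 / 2 : ℝ) ^ j := by
    have h1 := summable_pow_mul_geometric_of_norm_lt_one N
      (show ‖(1 / 2 : ℝ)‖ < 1 by norm_num)
    have h2 := ((summable_nat_add_iff 1).2 h1).mul_left 2
    refine h2.congr fun j => ?_
    rw [pow_succ (1 / 2 : ℝ)]
    ring
  rw [← ENNReal.ofReal_tsum_of_nonneg (fun j => by positivity) hs]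
  exact ENNReal.ofReal_ne_top

end Dyadic

/-! ### Parabolic boxes -/

section Boxes

variable {n : ℕ}

/-- The parabolic homogeneity of the coordinates: `2` for time and `1` for the others. -/
def paraExp (n : ℕ) (i : Fin (n + 1)) : ℕ := if i = Fin.last n then 2 else 1

@[simp] theorem paraExp_last : paraExp n (Fin.last n) = 2 := by simp [paraExp]

@[simp] theorem paraExp_castSucc (i : Fin n) : paraExp n i.castSucc = 1 := by
  simp [paraExp, (Fin.castSucc_lt_last i).ne]

theorem one_le_paraExp (i : Fin (n + 1)) : 1 ≤ paraExp n i := by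
  unfold paraExp; split_ifs <;> norm_num

theorem paraExp_ne_zero (i : Fin (n + 1)) : paraExp n i ≠ 0 :=
  Nat.one_le_iff_ne_zero.1 (one_le_paraExp i)

theorem prod_pow_paraExp (r : ℝ) : ∏ i, r ^ paraExp n i = r ^ (n + 2) := by
  rw [Fin.prod_univ_castSucc]
  simp [← pow_add]

/-- The half-open parabolic box with lower corner `o`, spatial side `ℓ` and time side `ℓ²`. -/
def paraBox (o : ParaSpace n) (ℓ : ℝ) : Set (ParaSpace n) :=
  {x | ∀ i, o i < x i ∧ x i ≤ o i + ℓ ^ paraExp n i}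

theorem setOf_coord_Ioc_eq (l u : Fin (n + 1) → ℝ) :
    {x : ParaSpace n | ∀ i, l i < x i ∧ x i ≤ u i} =
    WithLp.ofLp ⁻¹' (Set.univ.pi fun i => Set.Ioc (l i) (u i)) := by
  ext x
  simp

theorem measurableSet_coord_Ioc (l u : Fin (n + 1) → ℝ) :
    MeasurableSet {x : ParaSpace n | ∀ i, l i < x i ∧ x i ≤ u i} := by
  rw [setOf_coord_Ioc_eq]
  exact (MeasurableSet.univ_pi fun i => measurableSet_Ioc).preimage
    (PiLp.volume_preserving_ofLp (Fin (n + 1))).measurable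

theorem volume_coord_Ioc (l u : Fin (n + 1) → ℝ) :
    volume {x : ParaSpace n | ∀ i, l i < x i ∧ x i ≤ u i} = ∏ i, ENNReal.ofReal (u i - l i) := by
  rw [setOf_coord_Ioc_eq, (PiLp.volume_preserving_ofLp (Fin (n + 1))).measure_preimage
    (MeasurableSet.univ_pi fun i => measurableSet_Ioc).nullMeasurableSet, Real.volume_pi_Ioc]

theorem measurableSet_paraBox (o : ParaSpace n) (ℓ : ℝ) : MeasurableSet (paraBox o ℓ) :=
  measurableSet_coord_Ioc _ _

theorem volume_paraBox (o : ParaSpace n) {ℓ : ℝ} (hℓ : 0 ≤ ℓ) :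
    volume (paraBox o ℓ) = ENNReal.ofReal (ℓ ^ (n + 2)) := by
  rw [paraBox, volume_coord_Ioc, ← prod_pow_paraExp, ENNReal.ofReal_prod_of_nonneg
    fun i _ => by positivity]
  simp

theorem volume_paraBox_ne_zero (o : ParaSpace n) {ℓ : ℝ} (hℓ : 0 < ℓ) :
    volume (paraBox o ℓ) ≠ 0 := by
  rw [volume_paraBox o hℓ.le]
  simpa using pow_pos hℓ _

theorem volume_paraBox_ne_top (o : ParaSpace n) {ℓ : ℝ} (hℓ : 0 ≤ ℓ) :
    volume (paraBox o ℓ) ≠ ⊤ := by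
  rw [volume_paraBox o hℓ]
  exact ENNReal.ofReal_ne_top

/-- The labelling of the parabolic dyadic grid with origin `o` and base side `ℓ`. The boxes of level
`k` have spatial side `ℓ / 2 ^ k`; as these contain their upper but not
their lower faces, labels are ceilings. -/
noncomputable def gridLabel (o : ParaSpace n) (ℓ : ℝ) (k : ℕ) (x : ParaSpace n) : Fin (n + 1) → ℤ :=
  fun i => ⌈(x i - o i) / (ℓ / 2 ^ k) ^ paraExp n i⌉

/-- The lower corner of the box with label `v` in the grid of boxes of side `ℓ` with origin `o`. -/
noncomputable def gridCorner (o : ParaSpace n) (ℓ : ℝ) (v : Fin (n + 1) → ℤ) : ParaSpace n :=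
  WithLp.toLp 2 fun i => o i + (v i - 1) * ℓ ^ paraExp n i

theorem setOf_ceil_eq_paraBox (o : ParaSpace n) {ℓ : ℝ} (hℓ : 0 < ℓ) (v : Fin (n + 1) → ℤ) :
    {x : ParaSpace n | (fun i => ⌈(x i - o i) / ℓ ^ paraExp n i⌉) = v} =
      paraBox (gridCorner o ℓ v) ℓ := by
  ext x
  simp only [Set.mem_ofPred_eq, paraBox, gridCorner, funext_iff, Int.ceil_eq_iff]
  refine forall_congr' fun i => ?_
  have h : 0 < ℓ ^ paraExp n i := by positivity
  rw [lt_div_iff₀ h, div_le_iff₀ h]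
  constructor
  · rintro ⟨h1, h2⟩
    constructor <;> linarith
  · rintro ⟨h1, h2⟩
    constructor <;> linarith

theorem cell_gridLabel (o : ParaSpace n) {ℓ : ℝ} (hℓ : 0 < ℓ) (k : ℕ) (x : ParaSpace n) :
    cell (gridLabel o ℓ) k x =
      paraBox (gridCorner o (ℓ / 2 ^ k) (gridLabel o ℓ k x)) (ℓ / 2 ^ k) :=
  setOf_ceil_eq_paraBox o (by positivity) _

theorem cell_gridLabel_zero (o : ParaSpace n) {ℓ : ℝ} (hℓ : 0 < ℓ) {x : ParaSpace n}
    (hx : x ∈ paraBox o ℓ) : cell (gridLabel o ℓ) 0 x = paraBox o ℓ := by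
  have hlab : gridLabel o ℓ 0 x = fun _ => 1 := by
    funext i
    have h : 0 < ℓ ^ paraExp n i := by positivity
    have := hx i
    simp only [gridLabel, pow_zero, div_one, Int.ceil_eq_iff]
    rw [lt_div_iff₀ h, div_le_iff₀ h]
    push_cast
    constructor <;> linarith
  rw [cell_gridLabel o hℓ, hlab]
  congr 1
  · ext i
    simp [gridCorner]
  · simp

theorem ceil_div_natCast_congr {a b : ℝ} (h : ⌈a⌉ = ⌈b⌉) {N : ℕ} (hN : 0 < N) :
    ⌈a / N⌉ = ⌈b / N⌉ := by
  refine eq_of_forall_ge_iff fun z => ?_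
  have hN' : (0 : ℝ) < N := by exact_mod_cast hN
  have key : ∀ c : ℝ, ⌈c / N⌉ ≤ z ↔ ⌈c⌉ ≤ z * N := by
    intro c
    rw [Int.ceil_le, Int.ceil_le, div_le_iff₀ hN']
    push_cast
    rfl
  rw [key, key, h]

theorem exists_coord_nhds {x : ParaSpace n} {U : Set (ParaSpace n)} (hU : IsOpen U) (hx : x ∈ U) :
    ∃ δ > 0, ∀ y : ParaSpace n, (∀ i, |y i - x i| < δ) → y ∈ U := by
  have hV : IsOpen (WithLp.toLp 2 ⁻¹' U : Set (Fin (n + 1) → ℝ)) :=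
    hU.preimage (PiLp.continuous_toLp 2 _)
  obtain ⟨δ, hδ, hball⟩ := Metric.isOpen_iff.1 hV (WithLp.ofLp x) (by simpa using hx)
  refine ⟨δ, hδ, fun y hy => ?_⟩
  have : WithLp.ofLp y ∈ Metric.ball (WithLp.ofLp x) δ := by
    rw [Metric.mem_ball, dist_pi_lt_iff hδ]
    intro i
    rw [Real.dist_eq]
    exact hy i
  simpa using hball this

theorem abs_sub_lt_of_mem_paraBox {o : ParaSpace n} {ℓ : ℝ} {x y : ParaSpace n}
    (hx : x ∈ paraBox o ℓ) (hy : y ∈ paraBox o ℓ) (i : Fin (n + 1)) :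
    |y i - x i| < ℓ ^ paraExp n i := by
  have h1 := hx i
  have h2 := hy i
  rw [abs_lt]
  constructor <;> linarith

theorem isDyadicSystem_gridLabel (o : ParaSpace n) {ℓ : ℝ} (hℓ : 0 < ℓ) :
    IsDyadicSystem (gridLabel o ℓ) where
  measurableSet_fiber k v := by
    have := setOf_ceil_eq_paraBox o (show 0 < ℓ / 2 ^ k by positivity) v
    change MeasurableSet
      {x : ParaSpace n | (fun i => ⌈(x i - o i) / (ℓ / 2 ^ k) ^ paraExp n i⌉) = v}
    rw [this]
    exact measurableSet_paraBox _ _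
  refine_succ k x y h := by
    funext i
    have hi := congrFun h i
    simp only [gridLabel] at hi ⊢
    have key : ∀ t : ℝ, t / (ℓ / 2 ^ k) ^ paraExp n i =
        t / (ℓ / 2 ^ (k + 1)) ^ paraExp n i / (2 ^ paraExp n i : ℕ) := by
      intro t
      rw [div_div]
      congr 1
      push_cast
      rw [← mul_pow]
      congr 1
      field_simp
      ring
    rw [key, key]
    exact ceil_div_natCast_congr hi (by positivity)
  exists_cell_subset x U hU hx := by
    obtain ⟨δ, hδ, hδU⟩ := exists_coord_nhds hU hx
    obtain ⟨k, hk⟩ := exists_pow_lt_of_lt_one (show 0 < min δ 1 / ℓ by positivity)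
      (show (1 / 2 : ℝ) < 1 by norm_num)
    refine ⟨k, fun l hl y hy => hδU y fun i => ?_⟩
    rw [cell_gridLabel o hℓ] at hy
    have hx' : x ∈ cell (gridLabel o ℓ) l x := mem_cell_self l x
    rw [cell_gridLabel o hℓ] at hx'
    have h1 : ℓ / 2 ^ l < min δ 1 := by
      have h2 : (1 / 2 : ℝ) ^ l ≤ (1 / 2) ^ k := pow_le_pow_of_le_one (by norm_num) (by norm_num) hl
      have h3 := h2.trans_lt hk
      rw [lt_div_iff₀ hℓ, one_div, inv_pow] at h3
      rw [div_eq_mul_inv]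
      linarith
    calc |y i - x i| < (ℓ / 2 ^ l) ^ paraExp n i := abs_sub_lt_of_mem_paraBox hx' hy i
      _ ≤ (ℓ / 2 ^ l) ^ 1 := pow_le_pow_of_le_one (by positivity)
          (h1.le.trans (min_le_right _ _)) (one_le_paraExp i)
      _ < δ := by rw [pow_one]; exact h1.trans_le (min_le_left _ _)

end Boxes

/-! ### Bounded mean oscillation on boxes -/

section BoxBMO

variable {n : ℕ}

/-- The John–Nirenberg constant for parabolic boxes: a child has `2^{n+2}` times less volume. -/
noncomputable def boxJN (n : ℕ) (q : ℝ) : ℝ≥0∞ := jnConst (2 ^ (n + 2)) q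

theorem boxJN_ne_top {q : ℝ} (hq : 0 < q) : boxJN n q ≠ ⊤ :=
  jnConst_ne_top (by finiteness) hq

variable [NeZero n]

/-- The coordinates that are constrained to be positive in `upperDomain n`. -/
def IsConstrained (n : ℕ) [NeZero n] (i : Fin (n + 1)) : Prop :=
  i = (lastSpatial n).castSucc ∨ i = Fin.last n

theorem mem_upperDomain_iff {x : ParaSpace n} :
    x ∈ upperDomain n ↔ ∀ i, IsConstrained n i → 0 < x i := by
  constructor
  · rintro ⟨h1, h2⟩ i (rfl | rfl) <;> assumption
  · intro h
    exact ⟨h _ (Or.inl rfl), h _ (Or.inr rfl)⟩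

/-- The lower corner of a box lies in the closure of `upperDomain n`, in the constrained
coordinates. -/
def CornerInDomain (o : ParaSpace n) : Prop := ∀ i, IsConstrained n i → 0 ≤ o i

theorem paraBox_subset_upperDomain {o : ParaSpace n} (ho : CornerInDomain o) (ℓ : ℝ) :
    paraBox o ℓ ⊆ upperDomain n := by
  intro x hx
  rw [mem_upperDomain_iff]
  intro i hi
  exact (ho i hi).trans_lt (hx i).1

theorem measurableSet_upperDomain : MeasurableSet (upperDomain n) := by
  have h : ∀ i : Fin (n + 1), MeasurableSet {x : ParaSpace n | 0 < x i} := fun i =>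
    measurableSet_lt measurable_const (by fun_prop)
  exact (h _).inter (h _)

/-- The mean oscillations of `a` over the parabolic boxes contained in `upperDomain n` are at most
`κ`. -/
def BoxBMO (a : ParaSpace n → ℝ) (κ : ℝ≥0∞) : Prop :=
  ∀ (o : ParaSpace n) (ℓ : ℝ), 0 < ℓ → CornerInDomain o →
    IntegrableOn a (paraBox o ℓ) ∧
    ∫⁻ y in paraBox o ℓ, ‖a y - ⨍ z in paraBox o ℓ, a z‖ₑ ≤ κ * volume (paraBox o ℓ)

theorem gridCorner_cornerInDomain {o : ParaSpace n} (ho : CornerInDomain o) {ℓ : ℝ} (hℓ : 0 < ℓ)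
    {k : ℕ} {x : ParaSpace n} (hx : x ∈ paraBox o ℓ) :
    CornerInDomain (gridCorner o (ℓ / 2 ^ k) (gridLabel o ℓ k x)) := by
  intro i hi
  have h1 : (0 : ℝ) ≤ gridLabel o ℓ k x i - 1 := by
    have : 0 < gridLabel o ℓ k x i := by
      rw [gridLabel, Int.ceil_pos]
      have := (hx i).1
      have h2 : 0 < x i - o i := by linarith
      positivity
    have : 1 ≤ gridLabel o ℓ k x i := this
    have : (1 : ℝ) ≤ gridLabel o ℓ k x i := by exact_mod_cast this
    linarith
  have h3 : 0 ≤ o i := ho i hi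
  simp only [gridCorner]
  positivity

/-- The John–Nirenberg inequality on a box of the domain. Its dyadic grid stays in the domain, so
the abstract inequality applies to it. -/
theorem BoxBMO.lintegral_rpow_le {a : ParaSpace n → ℝ} {κ : ℝ≥0∞} (ha : BoxBMO a κ)
    (ham : Measurable a) (hκ : κ ≠ 0) (hκt : κ ≠ ⊤) {q : ℝ} (hq : 0 < q) {o : ParaSpace n} {ℓ : ℝ}
    (hℓ : 0 < ℓ) (ho : CornerInDomain o) :
    ∫⁻ y in paraBox o ℓ, ‖a y - ⨍ z in paraBox o ℓ, a z‖ₑ ^ q ≤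
      boxJN n q * κ ^ q * volume (paraBox o ℓ) := by
  obtain ⟨x₀, hx₀⟩ : (paraBox o ℓ).Nonempty :=
    nonempty_of_measure_ne_zero (volume_paraBox_ne_zero o hℓ)
  have hcell : cell (gridLabel o ℓ) 0 x₀ = paraBox o ℓ := cell_gridLabel_zero o hℓ hx₀
  rw [← hcell]
  refine (isDyadicSystem_gridLabel o hℓ).lintegral_oscillation_rpow_le ham
    (one_le_pow_of_one_le' (by norm_num) _) (by finiteness) hκ hκt ?_ ?_ ?_ ?_ ?_ hq
  · intro k _ x _
    rw [cell_gridLabel o hℓ]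
    exact volume_paraBox_ne_zero _ (by positivity)
  · rw [hcell]
    exact volume_paraBox_ne_top _ hℓ.le
  · intro k _ x _
    rw [cell_gridLabel o hℓ, cell_gridLabel o hℓ, volume_paraBox _ (by positivity),
      volume_paraBox _ (by positivity)]
    have h2 : (2 : ℝ≥0∞) ^ (n + 2) = ENNReal.ofReal (2 ^ (n + 2)) := by
      rw [ENNReal.ofReal_pow (by norm_num)]
      simp
    rw [h2, ← ENNReal.ofReal_mul (by positivity), ← mul_pow]
    refine le_of_eq ?_
    congr 2
    field_simp
    ring
  · rw [hcell]
    exact (ha o ℓ hℓ ho).1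
  · intro k _ x hx
    rw [hcell] at hx
    rw [cell_gridLabel o hℓ]
    exact (ha _ _ (by positivity) (gridCorner_cornerInDomain ho hℓ hx)).2

end BoxBMO

/-! ### Boxes and cylinders in the domain -/

section Domains

variable {n : ℕ}

theorem spatialNorm_eq_norm (x : ParaSpace n) :
    spatialNorm x = ‖(WithLp.toLp 2 fun i : Fin n => x i.castSucc : EuclideanSpace ℝ (Fin n))‖ := by
  rw [spatialNorm, EuclideanSpace.norm_eq]
  simp

theorem spatialNorm_nonneg (x : ParaSpace n) : 0 ≤ spatialNorm x := Real.sqrt_nonneg _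

theorem spatialNorm_add_le (x y : ParaSpace n) :
    spatialNorm (x + y) ≤ spatialNorm x + spatialNorm y := by
  set u : EuclideanSpace ℝ (Fin n) := WithLp.toLp 2 fun i : Fin n => x i.castSucc with hu
  set v : EuclideanSpace ℝ (Fin n) := WithLp.toLp 2 fun i : Fin n => y i.castSucc with hv
  have h : spatialNorm (x + y) = ‖u + v‖ := by
    rw [spatialNorm_eq_norm]
    rfl
  rw [h, spatialNorm_eq_norm, spatialNorm_eq_norm]
  exact norm_add_le u v

theorem spatialNorm_sub_comm (x y : ParaSpace n) : spatialNorm (x - y) = spatialNorm (y - x) := by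
  unfold spatialNorm
  congr 1
  refine Finset.sum_congr rfl fun i _ => ?_
  simp only [PiLp.sub_apply]
  ring

theorem continuous_spatialNorm : Continuous (spatialNorm : ParaSpace n → ℝ) := by
  unfold spatialNorm
  fun_prop

theorem abs_castSucc_le_spatialNorm (x : ParaSpace n) (i : Fin n) :
    |x i.castSucc| ≤ spatialNorm x := by
  rw [spatialNorm]
  refine Real.abs_le_sqrt ?_
  exact Finset.single_le_sum (f := fun i : Fin n => x i.castSucc ^ 2) (fun _ _ => sq_nonneg _)
    (Finset.mem_univ i)

theorem spatialNorm_le_of_forall_abs_le {x : ParaSpace n} {t : ℝ} (ht : 0 ≤ t)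
    (h : ∀ i : Fin n, |x i.castSucc| ≤ t) : spatialNorm x ≤ n * t := by
  rw [spatialNorm]
  refine Real.sqrt_le_iff.2 ⟨by positivity, ?_⟩
  calc ∑ i : Fin n, x i.castSucc ^ 2 ≤ ∑ _i : Fin n, t ^ 2 := by
        refine Finset.sum_le_sum fun i _ => ?_
        rw [← sq_abs]
        exact pow_le_pow_left₀ (abs_nonneg _) (h i) 2
    _ = n * t ^ 2 := by simp
    _ ≤ (n * t) ^ 2 := by
      rw [mul_pow]
      gcongr
      exact_mod_cast Nat.le_self_pow two_ne_zero n

theorem measurableSet_paraCylinder (x : ParaSpace n) (r : ℝ) :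
    MeasurableSet (paraCylinder x r) := by
  have h : Measurable fun y : ParaSpace n => spatialNorm (x - y) :=
    (continuous_spatialNorm.comp (continuous_const.sub continuous_id)).measurable
  have h1 : MeasurableSet {y : ParaSpace n | spatialNorm (x - y) < r} :=
    measurableSet_lt h measurable_const
  have h2 : MeasurableSet {y : ParaSpace n | |x (Fin.last n) - y (Fin.last n)| < r ^ 2} :=
    measurableSet_lt (by fun_prop) measurable_const
  exact h1.inter h2

theorem paraCylinder_mono (x : ParaSpace n) {r s : ℝ} (hr : 0 ≤ r) (hrs : r ≤ s) :
    paraCylinder x r ⊆ paraCylinder x s := by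
  rintro y ⟨h1, h2⟩
  exact ⟨h1.trans_le hrs, h2.trans_le (by gcongr)⟩

theorem abs_sub_lt_of_mem_paraCylinder {x y : ParaSpace n} {r : ℝ} (h : y ∈ paraCylinder x r)
    (i : Fin (n + 1)) : |y i - x i| < r ^ paraExp n i := by
  rw [abs_sub_comm]
  refine Fin.lastCases ?_ (fun i => ?_) i
  · simpa using h.2
  · rw [paraExp_castSucc, pow_one]
    exact (abs_castSucc_le_spatialNorm (x - y) i).trans_lt h.1

variable [NeZero n]

open Classical in
/-- The lower corner of a box of side `2R` containing the part of `upperDomain n` at parabolic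
distance less than `R` from `x`: the corner is moved to the boundary where it would leave the
domain. -/
noncomputable def domainCorner (x : ParaSpace n) (R : ℝ) : ParaSpace n :=
  WithLp.toLp 2 fun i =>
    if IsConstrained n i then max 0 (x i - R ^ paraExp n i) else x i - R ^ paraExp n i

theorem domainCorner_cornerInDomain (x : ParaSpace n) (R : ℝ) :
    CornerInDomain (domainCorner x R) := by
  intro i hi
  simp [domainCorner, hi]

theorem mem_paraBox_domainCorner {x z : ParaSpace n} {R : ℝ} (hR : 0 ≤ R)
    (hz : z ∈ upperDomain n) (h : ∀ i, |z i - x i| < R ^ paraExp n i) :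
    z ∈ paraBox (domainCorner x R) (2 * R) := by
  intro i
  have h1 := abs_lt.1 (h i)
  have h2 : 2 * R ^ paraExp n i ≤ (2 * R) ^ paraExp n i := by
    rw [mul_pow]
    gcongr
    exact le_self_pow₀ (by norm_num) (paraExp_ne_zero i)
  simp only [domainCorner]
  split_ifs with hi
  · have h3 := mem_upperDomain_iff.1 hz i hi
    refine ⟨max_lt h3 (by linarith), ?_⟩
    have := le_max_right 0 (x i - R ^ paraExp n i)
    linarith
  · constructor <;> linarith

theorem paraBox_domainCorner_mono {x : ParaSpace n} (hx : x ∈ upperDomain n) {R S : ℝ}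
    (hR : 0 ≤ R) (hRS : R ≤ S) :
    paraBox (domainCorner x R) (2 * R) ⊆ paraBox (domainCorner x S) (2 * S) := by
  intro z hz i
  have h := hz i
  have h2 : ∀ t : ℝ, (2 * t) ^ paraExp n i = 2 ^ paraExp n i * t ^ paraExp n i :=
    fun t => mul_pow _ _ _
  have h3 : R ^ paraExp n i ≤ S ^ paraExp n i := by gcongr
  have h4 : (2 : ℝ) ≤ 2 ^ paraExp n i := le_self_pow₀ (by norm_num) (paraExp_ne_zero i)
  have h5 : (2 : ℝ) ^ paraExp n i * R ^ paraExp n i - R ^ paraExp n i ≤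
      2 ^ paraExp n i * S ^ paraExp n i - S ^ paraExp n i := by nlinarith
  rw [h2] at h ⊢
  simp only [domainCorner] at h ⊢
  have hS : 0 ≤ S ^ paraExp n i := pow_nonneg (hR.trans hRS) _
  have hR' : 0 ≤ R ^ paraExp n i := pow_nonneg hR _
  split_ifs at h ⊢ with hi
  · have hxi := mem_upperDomain_iff.1 hx i hi
    refine ⟨(max_le_max le_rfl (by linarith)).trans_lt h.1, h.2.trans ?_⟩
    rcases le_total 0 (x i - R ^ paraExp n i) with h6 | h6
    · rw [max_eq_right h6]
      have := le_max_right 0 (x i - S ^ paraExp n i)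
      linarith
    · rw [max_eq_left h6]
      have := le_max_left 0 (x i - S ^ paraExp n i)
      nlinarith
  · constructor <;> linarith

theorem inter_paraCylinder_subset_paraBox (x : ParaSpace n) {r : ℝ}
    (hr : 0 ≤ r) :
    upperDomain n ∩ paraCylinder x r ⊆ paraBox (domainCorner x r) (2 * r) := fun _ hy =>
  mem_paraBox_domainCorner hr hy.1 (abs_sub_lt_of_mem_paraCylinder hy.2)

theorem volume_inter_paraCylinder_le (x : ParaSpace n) {r : ℝ}
    (hr : 0 ≤ r) :
    volume (upperDomain n ∩ paraCylinder x r) ≤ ENNReal.ofReal ((2 * r) ^ (n + 2)) :=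
  (measure_mono (inter_paraCylinder_subset_paraBox x hr)).trans_eq
    (volume_paraBox _ (by positivity))

/-- Every box in the domain is contained in a set `D_r(z)` of comparable size. -/
theorem exists_paraBox_subset_paraCylinder {o : ParaSpace n} (ho : CornerInDomain o) {ℓ : ℝ}
    (hℓ : 0 < ℓ) :
    ∃ z ∈ upperDomain n, paraBox o ℓ ⊆ upperDomain n ∩ paraCylinder z (n * ℓ) := by
  have hn : (1 : ℝ) ≤ n := by exact_mod_cast Nat.one_le_iff_ne_zero.2 (NeZero.ne n)
  refine ⟨WithLp.toLp 2 fun i => o i + ℓ ^ paraExp n i / 2, ?_, ?_⟩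
  · rw [mem_upperDomain_iff]
    intro i hi
    have := ho i hi
    simp only
    positivity
  · intro y hy
    refine ⟨paraBox_subset_upperDomain ho ℓ hy, ?_, ?_⟩
    · refine (spatialNorm_le_of_forall_abs_le (t := ℓ / 2) (by positivity) fun i => ?_).trans_lt ?_
      · have h := hy i.castSucc
        simp only [paraExp_castSucc, pow_one] at h
        simp only [PiLp.sub_apply, paraExp_castSucc, pow_one]
        rw [abs_le]
        constructor <;> linarith
      · nlinarith
    · have h := hy (Fin.last n)
      simp only [paraExp_last] at h ⊢
      have h2 : ℓ ^ 2 ≤ (n * ℓ) ^ 2 := by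
        gcongr
        nlinarith
      have h3 : 0 < ℓ ^ 2 := by positivity
      rw [abs_lt]
      constructor <;> linarith

/-! ### Averages over boxes -/

theorem BoxBMO.congr {a b : ParaSpace n → ℝ} {κ : ℝ≥0∞} (ha : BoxBMO a κ)
    (hab : a =ᵐ[volume.restrict (upperDomain n)] b) : BoxBMO b κ := by
  intro o ℓ hℓ ho
  have hab' : a =ᵐ[volume.restrict (paraBox o ℓ)] b :=
    ae_restrict_of_ae_restrict_of_subset (paraBox_subset_upperDomain ho ℓ) hab
  obtain ⟨h1, h2⟩ := ha o ℓ hℓ ho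
  refine ⟨h1.congr hab', ?_⟩
  have h3 : ⨍ z in paraBox o ℓ, b z = ⨍ z in paraBox o ℓ, a z := by
    rw [setAverage_eq, setAverage_eq, integral_congr_ae hab']
  rw [h3]
  refine le_trans (le_of_eq (lintegral_congr_ae ?_)) h2
  filter_upwards [hab'] with y hy
  rw [hy]

/-- The ratio between box oscillation and the `BMO` seminorm: a box of side `ℓ` lies in some
`D_r(z)` with `r = nℓ` and of at most `(2n)^{n+2}` times its volume, and replacing the average over
`D_r(z)` by that over the box costs a factor `2`. -/
noncomputable def boxConst (n : ℕ) : ℝ≥0∞ := 2 * ENNReal.ofReal ((2 * n) ^ (n + 2))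

theorem boxBMO_of_memBMO {a : ParaSpace n → ℝ} (ha : MemBMO (upperDomain n) a) {κ : ℝ≥0∞}
    (hκ : bmoNorm (upperDomain n) a ≤ κ) : BoxBMO a (boxConst n * κ) := by
  intro o ℓ hℓ ho
  obtain ⟨z, hz, hsub⟩ := exists_paraBox_subset_paraCylinder ho hℓ
  have hn : (1 : ℝ) ≤ n := by exact_mod_cast Nat.one_le_iff_ne_zero.2 (NeZero.ne n)
  have hr : 0 < n * ℓ := by positivity
  set D := upperDomain n ∩ paraCylinder z (n * ℓ) with hD
  have hint := ha.1 z hz (n * ℓ) hr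
  refine ⟨hint.mono_set hsub, ?_⟩
  set B := paraBox o ℓ with hB
  have hB0 : volume B ≠ 0 := volume_paraBox_ne_zero o hℓ
  have hBt : volume B ≠ ⊤ := volume_paraBox_ne_top o hℓ.le
  have hD0 : volume D ≠ 0 := fun h => hB0 (measure_mono_null hsub h)
  have hDle : volume D ≤ ENNReal.ofReal ((2 * (n * ℓ)) ^ (n + 2)) :=
    volume_inter_paraCylinder_le z hr.le
  have hDt : volume D ≠ ⊤ := ne_top_of_le_ne_top ENNReal.ofReal_ne_top hDle
  set c := ⨍ y in D, a y with hc
  have hosc : ∫⁻ y in D, ‖a y - c‖ₑ ≤ κ * volume D := by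
    have h1 : (volume D)⁻¹ * ∫⁻ y in D, ‖a y - c‖ₑ ≤ κ := by
      refine le_trans ?_ hκ
      unfold bmoNorm
      exact le_iSup₂_of_le z hz (le_iSup₂_of_le (n * ℓ) hr le_rfl)
    rwa [mul_comm, ← div_eq_mul_inv, ENNReal.div_le_iff hD0 hDt] at h1
  have havg := enorm_setAverage_sub_mul_measure_le hBt (hint.mono_set hsub) c
  have hBD : ∫⁻ y in B, ‖a y - c‖ₑ ≤ κ * volume D := (lintegral_mono_set hsub).trans hosc
  calc ∫⁻ y in B, ‖a y - ⨍ z in B, a z‖ₑ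
      ≤ ∫⁻ y in B, (‖a y - c‖ₑ + ‖(⨍ z in B, a z) - c‖ₑ) := by
        refine lintegral_mono fun y => ?_
        calc ‖a y - ⨍ z in B, a z‖ₑ = ‖(a y - c) - ((⨍ z in B, a z) - c)‖ₑ := by congr 1; ring
          _ ≤ _ := enorm_sub_le
    _ = (∫⁻ y in B, ‖a y - c‖ₑ) + ‖(⨍ z in B, a z) - c‖ₑ * volume B := by
        rw [lintegral_add_right _ measurable_const, setLIntegral_const]
    _ ≤ κ * volume D + κ * volume D := add_le_add hBD (havg.trans hBD)
    _ = 2 * κ * volume D := by ring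
    _ ≤ 2 * κ * ENNReal.ofReal ((2 * (n * ℓ)) ^ (n + 2)) := by gcongr
    _ = boxConst n * κ * volume B := by
        rw [hB, volume_paraBox o hℓ.le, boxConst, ← mul_assoc 2, mul_pow,
          ENNReal.ofReal_mul (by positivity)]
        ring

theorem setLIntegral_le_Lp_mul {X : Type*} [MeasurableSpace X] {μ : Measure X} {s : Set X}
    {g : X → ℝ≥0∞} (hg : Measurable g) {p q : ℝ} (hpq : p.HolderConjugate q) :
    ∫⁻ y in s, g y ∂μ ≤ (∫⁻ y in s, g y ^ p ∂μ) ^ (1 / p) * μ s ^ (1 / q) := by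
  have := ENNReal.lintegral_mul_le_Lp_mul_Lq (μ.restrict s) hpq hg.aemeasurable
    (measurable_const (a := (1 : ℝ≥0∞))).aemeasurable
  simpa using this

/-- The averages over nested boxes differ by at most a power of the ratio of their sides, which can
be made small by taking `q` large. -/
theorem BoxBMO.enorm_average_sub_le {a : ParaSpace n → ℝ} {κ : ℝ≥0∞} (ha : BoxBMO a κ)
    (ham : Measurable a) (hκ : κ ≠ 0) (hκt : κ ≠ ⊤) {q : ℝ} (hq : 1 < q) {o₁ o₂ : ParaSpace n}
    {ℓ₁ ℓ₂ : ℝ} (hℓ₁ : 0 < ℓ₁) (hℓ₂ : 0 < ℓ₂) (ho₁ : CornerInDomain o₁) (ho₂ : CornerInDomain o₂)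
    (hsub : paraBox o₁ ℓ₁ ⊆ paraBox o₂ ℓ₂) :
    ‖(⨍ z in paraBox o₁ ℓ₁, a z) - ⨍ z in paraBox o₂ ℓ₂, a z‖ₑ ≤
      boxJN n q ^ (1 / q) * κ * ENNReal.ofReal ((ℓ₂ / ℓ₁) ^ ((n + 2 : ℝ) / q)) := by
  have hq0 : 0 < q := by linarith
  set B₁ := paraBox o₁ ℓ₁ with hB₁
  set B₂ := paraBox o₂ ℓ₂ with hB₂
  set c := ⨍ z in B₂, a z with hc
  have hB0 : volume B₁ ≠ 0 := volume_paraBox_ne_zero _ hℓ₁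
  have hBt : volume B₁ ≠ ⊤ := volume_paraBox_ne_top _ hℓ₁.le
  have hconj := Real.HolderConjugate.conjExponent hq
  have h1 : ‖(⨍ z in B₁, a z) - c‖ₑ * volume B₁ ≤
      (boxJN n q * κ ^ q * volume B₂) ^ (1 / q) * volume B₁ ^ (1 / q.conjExponent) :=
    calc ‖(⨍ z in B₁, a z) - c‖ₑ * volume B₁ ≤ ∫⁻ y in B₁, ‖a y - c‖ₑ :=
          enorm_setAverage_sub_mul_measure_le hBt (ha o₁ ℓ₁ hℓ₁ ho₁).1 c
      _ ≤ (∫⁻ y in B₁, ‖a y - c‖ₑ ^ q) ^ (1 / q) * volume B₁ ^ (1 / q.conjExponent) :=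
          setLIntegral_le_Lp_mul (ham.sub_const c).enorm hconj
      _ ≤ (∫⁻ y in B₂, ‖a y - c‖ₑ ^ q) ^ (1 / q) * volume B₁ ^ (1 / q.conjExponent) := by
          gcongr
      _ ≤ _ := by
          gcongr
          exact ha.lintegral_rpow_le ham hκ hκt hq0 hℓ₂ ho₂
  have h2 : volume B₁ = volume B₁ ^ (1 / q) * volume B₁ ^ (1 / q.conjExponent) := by
    rw [← ENNReal.rpow_add _ _ hB0 hBt, one_div, one_div, hconj.inv_add_inv_eq_one,
      ENNReal.rpow_one]
  have h3 : volume B₂ ^ (1 / q) =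
      ENNReal.ofReal ((ℓ₂ / ℓ₁) ^ ((n + 2 : ℝ) / q)) * volume B₁ ^ (1 / q) := by
    rw [hB₁, hB₂, volume_paraBox _ hℓ₁.le, volume_paraBox _ hℓ₂.le,
      ENNReal.ofReal_rpow_of_nonneg (by positivity) (by positivity),
      ENNReal.ofReal_rpow_of_nonneg (by positivity) (by positivity),
      ← ENNReal.ofReal_mul (by positivity), ← Real.rpow_natCast, ← Real.rpow_natCast,
      ← Real.rpow_mul hℓ₁.le, ← Real.rpow_mul hℓ₂.le, Real.div_rpow hℓ₂.le hℓ₁.le]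
    push_cast
    rw [mul_one_div, div_mul_cancel₀]
    positivity
  have h4 : ‖(⨍ z in B₁, a z) - c‖ₑ * volume B₁ ≤
      boxJN n q ^ (1 / q) * κ * ENNReal.ofReal ((ℓ₂ / ℓ₁) ^ ((n + 2 : ℝ) / q)) * volume B₁ := by
    refine h1.trans (le_of_eq ?_)
    rw [ENNReal.mul_rpow_of_nonneg _ _ (by positivity),
      ENNReal.mul_rpow_of_nonneg _ _ (by positivity), ← ENNReal.rpow_mul,
      mul_one_div_cancel hq0.ne', ENNReal.rpow_one, h3]
    nth_rewrite 3 [h2]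
    ring
  exact (ENNReal.mul_le_mul_iff_left hB0 hBt).1 h4

end Domains

/-! ### The nonsingular distance and its integrals -/

section Kernel

variable {n : ℕ} [NeZero n]

/-- The distance `xₙ` of `x` to the lateral boundary of the domain. -/
def height (x : ParaSpace n) : ℝ := x (lastSpatial n).castSucc

/-- The quantity `|x' - y'| + |t - τ|^{1/2} + xₙ + yₙ`, comparable for `x, y` in the domain to the
parabolic distance between `y` and the reflection of `x`. -/
noncomputable def reflDist (x y : ParaSpace n) : ℝ :=
  spatialNorm (x - y) + √|x (Fin.last n) - y (Fin.last n)| + height x + height y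

theorem reflDist_comm (x y : ParaSpace n) : reflDist x y = reflDist y x := by
  unfold reflDist
  rw [spatialNorm_sub_comm, abs_sub_comm]
  ring

theorem height_pos {x : ParaSpace n} (hx : x ∈ upperDomain n) : 0 < height x := hx.1

theorem height_le_reflDist_left {x y : ParaSpace n} (hy : y ∈ upperDomain n) :
    height x ≤ reflDist x y := by
  unfold reflDist
  have h1 := spatialNorm_nonneg (x - y)
  have h2 := Real.sqrt_nonneg |x (Fin.last n) - y (Fin.last n)|
  have h3 := height_pos hy
  linarith

theorem height_le_reflDist_right {x y : ParaSpace n} (hx : x ∈ upperDomain n) :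
    height y ≤ reflDist x y := by
  rw [reflDist_comm]
  exact height_le_reflDist_left hx

theorem reflDist_pos {x y : ParaSpace n} (hx : x ∈ upperDomain n) (hy : y ∈ upperDomain n) :
    0 < reflDist x y := (height_pos hx).trans_le (height_le_reflDist_left hy)

theorem abs_sub_le_reflDist {x y : ParaSpace n} (hx : x ∈ upperDomain n) (hy : y ∈ upperDomain n)
    (i : Fin (n + 1)) : |y i - x i| ≤ reflDist x y ^ paraExp n i := by
  have h1 := spatialNorm_nonneg (x - y)
  have h2 := Real.sqrt_nonneg |x (Fin.last n) - y (Fin.last n)|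
  have h3 := height_pos hy
  have h4 := height_pos hx
  rw [abs_sub_comm]
  refine Fin.lastCases ?_ (fun i => ?_) i
  · rw [paraExp_last, ← Real.sqrt_le_left (reflDist_pos hx hy).le]
    unfold reflDist
    linarith
  · rw [paraExp_castSucc, pow_one]
    refine (abs_castSucc_le_spatialNorm (x - y) i).trans ?_
    unfold reflDist
    linarith

@[fun_prop]
theorem continuous_height : Continuous (height : ParaSpace n → ℝ) := by
  unfold height
  fun_prop

@[fun_prop]
theorem measurable_height {Y : Type*} [MeasurableSpace Y] {f : Y → ParaSpace n}
    (hf : Measurable f) : Measurable fun y => height (f y) :=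
  continuous_height.measurable.comp hf

@[fun_prop]
theorem measurable_reflDist {Y : Type*} [MeasurableSpace Y] {f g : Y → ParaSpace n}
    (hf : Measurable f) (hg : Measurable g) : Measurable fun y => reflDist (f y) (g y) := by
  have h1 : Measurable fun y => spatialNorm (f y - g y) :=
    continuous_spatialNorm.measurable.comp (hf.sub hg)
  have h2 : Measurable fun y => √|f y (Fin.last n) - g y (Fin.last n)| := by fun_prop
  have h3 : Measurable fun y => height (f y) := by fun_prop
  have h4 : Measurable fun y => height (g y) := by fun_prop
  exact ((h1.add h2).add h3).add h4

/-- The set of points with `reflDist x y < s` and height at most `w` lies in a box of sides `2s` in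
the spatial directions other than the last one, `w` in the last one and `2s²` in time. -/
theorem volume_strip_le {x : ParaSpace n} (hx : x ∈ upperDomain n) {s w : ℝ} (hs : 0 < s)
    (hw : 0 ≤ w) :
    volume {y | y ∈ upperDomain n ∧ reflDist x y < s ∧ height y ≤ w} ≤
      ENNReal.ofReal (2 ^ n * s ^ (n + 1) * w) := by
  classical
  set i₀ : Fin (n + 1) := (lastSpatial n).castSucc with hi₀
  have hsub : {y | y ∈ upperDomain n ∧ reflDist x y < s ∧ height y ≤ w} ⊆
      {y : ParaSpace n | ∀ i, (if i = i₀ then 0 else x i - s ^ paraExp n i) < y i ∧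
        y i ≤ (if i = i₀ then w else x i + s ^ paraExp n i)} := by
    rintro y ⟨hy, hd, hyw⟩ i
    have h1 : |y i - x i| < s ^ paraExp n i := (abs_sub_le_reflDist hx hy i).trans_lt
      (pow_lt_pow_left₀ hd (reflDist_pos hx hy).le (paraExp_ne_zero i))
    have h2 := abs_lt.1 h1
    split_ifs with hi
    · rw [hi]
      exact ⟨hy.1, hyw⟩
    · constructor <;> linarith
  refine (measure_mono hsub).trans_eq ?_
  rw [volume_coord_Ioc, ← ENNReal.ofReal_prod_of_nonneg]
  · congr 1
    have h1 : ∀ i, (if i = i₀ then w else x i + s ^ paraExp n i) -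
        (if i = i₀ then 0 else x i - s ^ paraExp n i) =
        (2 * s ^ paraExp n i) * (if i = i₀ then w / (2 * s) else 1) := by
      intro i
      split_ifs with hi
      · rw [hi, hi₀, paraExp_castSucc]
        field_simp
        ring
      · ring
    rw [Finset.prod_congr rfl fun i _ => h1 i, Finset.prod_mul_distrib, Finset.prod_mul_distrib,
      prod_pow_paraExp, Finset.prod_ite_eq' Finset.univ i₀]
    simp only [Finset.mem_univ, if_true, Finset.prod_const, Finset.card_univ, Fintype.card_fin]
    field_simp
    ring
  · intro i _
    split_ifs
    · linarith
    · have : 0 < s ^ paraExp n i := by positivity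
      linarith

/-- The weight `yₙ^{-σ}` with `σ < 1` is integrable up to the boundary `{yₙ = 0}`, by decomposition
into the strips `{yₙ ∼ 2^{-j} s}`. -/
theorem exists_lintegral_height_rpow_le {σ : ℝ} (hσ0 : 0 < σ) (hσ1 : σ < 1) :
    ∃ C : ℝ≥0∞, C ≠ ⊤ ∧ ∀ x ∈ upperDomain n, ∀ s : ℝ, 0 < s →
      ∫⁻ y in {y | y ∈ upperDomain n ∧ reflDist x y < s}, ENNReal.ofReal (height y ^ (-σ)) ≤
        C * ENNReal.ofReal (s ^ ((n + 2 : ℝ) - σ)) := by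
  set r : ℝ := 2 ^ (σ - 1) with hr
  have hr0 : 0 < r := by positivity
  have hr1 : r < 1 := Real.rpow_lt_one_of_one_lt_of_neg (by norm_num) (by linarith)
  refine ⟨ENNReal.ofReal (2 ^ n * 2 ^ σ) * (1 - ENNReal.ofReal r)⁻¹, ?_, ?_⟩
  · refine ENNReal.mul_ne_top ENNReal.ofReal_ne_top (ENNReal.inv_ne_top.2 ?_)
    rw [← pos_iff_ne_zero, tsub_pos_iff_lt]
    simpa using hr1
  intro x hx s hs
  set S : ℕ → Set (ParaSpace n) := fun j => {y | (y ∈ upperDomain n ∧ reflDist x y < s ∧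
    height y ≤ (1 / 2) ^ j * s) ∧ (1 / 2) ^ (j + 1) * s < height y} with hS
  have hcov : {y | y ∈ upperDomain n ∧ reflDist x y < s} ⊆ ⋃ j, S j := by
    rintro y ⟨hy, hd⟩
    have h1 := height_pos hy
    have h2 : height y / s ≤ 1 := by
      rw [div_le_one hs]
      exact (height_le_reflDist_right hx).trans hd.le
    obtain ⟨j, hj1, hj2⟩ := exists_nat_pow_near_of_lt_one (div_pos h1 hs) h2
      (show (0 : ℝ) < 1 / 2 by norm_num) (by norm_num)
    rw [lt_div_iff₀ hs] at hj1
    rw [div_le_iff₀ hs] at hj2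
    exact Set.mem_iUnion.2 ⟨j, ⟨⟨hy, hd, hj2⟩, hj1⟩⟩
  calc ∫⁻ y in {y | y ∈ upperDomain n ∧ reflDist x y < s}, ENNReal.ofReal (height y ^ (-σ))
      ≤ ∫⁻ y in ⋃ j, S j, ENNReal.ofReal (height y ^ (-σ)) := lintegral_mono_set hcov
    _ ≤ ∑' j, ∫⁻ y in S j, ENNReal.ofReal (height y ^ (-σ)) := lintegral_iUnion_le _ _
    _ ≤ ∑' j : ℕ, ENNReal.ofReal (2 ^ n * 2 ^ σ * s ^ ((n + 2 : ℝ) - σ)) *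
          ENNReal.ofReal r ^ j := by
        refine ENNReal.tsum_le_tsum fun j => ?_
        have hjs : 0 < (1 / 2 : ℝ) ^ (j + 1) * s := by positivity
        calc ∫⁻ y in S j, ENNReal.ofReal (height y ^ (-σ))
            ≤ ∫⁻ _ in S j, ENNReal.ofReal (((1 / 2) ^ (j + 1) * s) ^ (-σ)) := by
              refine setLIntegral_mono measurable_const fun y hy => ?_
              refine ENNReal.ofReal_le_ofReal ?_
              exact Real.rpow_le_rpow_of_nonpos hjs hy.2.le (by linarith)
          _ = ENNReal.ofReal (((1 / 2) ^ (j + 1) * s) ^ (-σ)) * volume (S j) :=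
              setLIntegral_const _ _
          _ ≤ ENNReal.ofReal (((1 / 2) ^ (j + 1) * s) ^ (-σ)) *
                ENNReal.ofReal (2 ^ n * s ^ (n + 1) * ((1 / 2) ^ j * s)) := by
              gcongr
              refine (measure_mono fun y hy => hy.1).trans
                (volume_strip_le (w := (1 / 2) ^ j * s) hx hs (by positivity))
          _ = _ := by
              rw [← ENNReal.ofReal_mul (by positivity), ← ENNReal.ofReal_pow hr0.le,
                ← ENNReal.ofReal_mul (by positivity)]
              congr 1
              rw [Real.mul_rpow (by positivity) hs.le, sub_eq_add_neg, Real.rpow_add hs]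
              have e1 : s ^ (n + 2 : ℝ) = s ^ (n + 2) := by
                exact_mod_cast Real.rpow_natCast s (n + 2)
              have e2 : ((1 / 2 : ℝ) ^ (j + 1)) ^ (-σ) = 2 ^ σ * (2 ^ σ) ^ j := by
                rw [← Real.rpow_pow_comm (by norm_num), one_div, Real.inv_rpow (by norm_num),
                  Real.rpow_neg (by norm_num), inv_inv, pow_succ, mul_comm]
              have e3 : r ^ j = (2 ^ σ) ^ j * (1 / 2) ^ j := by
                rw [hr, sub_eq_add_neg, Real.rpow_add (by norm_num), mul_pow,
                  Real.rpow_neg_one, one_div]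
              rw [e1, e2, e3]
              ring
    _ = _ := by
        rw [ENNReal.tsum_mul_left, ENNReal.tsum_geometric, ENNReal.ofReal_mul (by positivity)]
        ring

/-- The basic potential estimate. It is scale invariant: as `reflDist x y ≥ xₙ`, only the shells
`{reflDist x y ∼ 2^k xₙ}` with `k ≥ 0` occur, and the weight `yₙ^{-σ}` supplies the decay in `k`. -/
theorem exists_lintegral_reflDist_rpow_le {τ σ : ℝ} (hτσ : τ < σ) (hσ0 : 0 < σ)
    (hσ1 : σ < 1) :
    ∃ C : ℝ≥0∞, C ≠ ⊤ ∧ ∀ x ∈ upperDomain n,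
      ∫⁻ y in upperDomain n,
          ENNReal.ofReal (reflDist x y ^ (-(n + 2 : ℝ) + τ)) * ENNReal.ofReal (height y ^ (-σ)) ≤
        C * ENNReal.ofReal (height x ^ (τ - σ)) := by
  obtain ⟨C₁, hC₁, hstrip⟩ := exists_lintegral_height_rpow_le (n := n) hσ0 hσ1
  set r : ℝ := 2 ^ (τ - σ) with hr
  have hr0 : 0 < r := by positivity
  have hr1 : r < 1 := Real.rpow_lt_one_of_one_lt_of_neg (by norm_num) (by linarith)
  refine ⟨C₁ * ENNReal.ofReal (2 ^ ((n + 2 : ℝ) - σ)) * (1 - ENNReal.ofReal r)⁻¹, ?_, ?_⟩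
  · refine ENNReal.mul_ne_top (by finiteness) (ENNReal.inv_ne_top.2 ?_)
    rw [← pos_iff_ne_zero, tsub_pos_iff_lt]
    simpa using hr1
  intro x hx
  have hh := height_pos hx
  set h := height x with hhdef
  set S : ℕ → Set (ParaSpace n) := fun k =>
    {y | (y ∈ upperDomain n ∧ reflDist x y < 2 ^ (k + 1) * h) ∧ 2 ^ k * h ≤ reflDist x y} with hS
  have hcov : upperDomain n ⊆ ⋃ k, S k := by
    intro y hy
    have h2 : 1 ≤ reflDist x y / h := by
      rw [one_le_div hh]
      exact height_le_reflDist_left hy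
    obtain ⟨k, hk1, hk2⟩ := exists_nat_pow_near h2 (show (1 : ℝ) < 2 by norm_num)
    rw [le_div_iff₀ hh] at hk1
    rw [div_lt_iff₀ hh] at hk2
    exact Set.mem_iUnion.2 ⟨k, ⟨⟨hy, hk2⟩, hk1⟩⟩
  have hm : ∀ ρ : ℝ, Measurable fun y : ParaSpace n => ENNReal.ofReal (height y ^ ρ) := by
    intro ρ; fun_prop
  calc ∫⁻ y in upperDomain n,
          ENNReal.ofReal (reflDist x y ^ (-(n + 2 : ℝ) + τ)) * ENNReal.ofReal (height y ^ (-σ))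
      ≤ ∫⁻ y in ⋃ k, S k,
          ENNReal.ofReal (reflDist x y ^ (-(n + 2 : ℝ) + τ)) * ENNReal.ofReal (height y ^ (-σ)) :=
        lintegral_mono_set hcov
    _ ≤ ∑' k, ∫⁻ y in S k,
          ENNReal.ofReal (reflDist x y ^ (-(n + 2 : ℝ) + τ)) * ENNReal.ofReal (height y ^ (-σ)) :=
        lintegral_iUnion_le _ _
    _ ≤ ∑' k : ℕ, C₁ * ENNReal.ofReal (2 ^ ((n + 2 : ℝ) - σ) * h ^ (τ - σ)) *
          ENNReal.ofReal r ^ k := by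
        refine ENNReal.tsum_le_tsum fun k => ?_
        have hu : 0 < 2 ^ k * h := by positivity
        calc ∫⁻ y in S k,
              ENNReal.ofReal (reflDist x y ^ (-(n + 2 : ℝ) + τ)) * ENNReal.ofReal (height y ^ (-σ))
            ≤ ∫⁻ y in S k,
              ENNReal.ofReal ((2 ^ k * h) ^ (-(n + 2 : ℝ) + τ)) *
                ENNReal.ofReal (height y ^ (-σ)) := by
              refine setLIntegral_mono (by fun_prop) fun y hy => ?_
              gcongr ?_ * _
              refine ENNReal.ofReal_le_ofReal ?_
              refine Real.rpow_le_rpow_of_nonpos hu hy.2 ?_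
              have : (0 : ℝ) ≤ n := n.cast_nonneg
              linarith
          _ = ENNReal.ofReal ((2 ^ k * h) ^ (-(n + 2 : ℝ) + τ)) *
                ∫⁻ y in S k, ENNReal.ofReal (height y ^ (-σ)) := lintegral_const_mul _ (hm _)
          _ ≤ ENNReal.ofReal ((2 ^ k * h) ^ (-(n + 2 : ℝ) + τ)) *
                (C₁ * ENNReal.ofReal ((2 ^ (k + 1) * h) ^ ((n + 2 : ℝ) - σ))) := by
              gcongr
              exact (lintegral_mono_set fun y hy => hy.1).trans
                (hstrip x hx (2 ^ (k + 1) * h) (by positivity))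
          _ = _ := by
              rw [mul_left_comm, mul_assoc, ← ENNReal.ofReal_mul (by positivity),
                ← ENNReal.ofReal_pow hr0.le, ← ENNReal.ofReal_mul (by positivity)]
              congr 2
              have e1 : (2 : ℝ) ^ (k + 1) * h = 2 * (2 ^ k * h) := by ring
              rw [e1, Real.mul_rpow (by norm_num) hu.le, mul_left_comm, ← Real.rpow_add hu,
                show -(n + 2 : ℝ) + τ + ((n + 2 : ℝ) - σ) = τ - σ by ring,
                Real.mul_rpow (by positivity) hh.le, ← Real.rpow_pow_comm (by norm_num)]
              ring
    _ = _ := by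
        rw [ENNReal.tsum_mul_left, ENNReal.tsum_geometric, ENNReal.ofReal_mul (by positivity)]
        ring

end Kernel

/-! ### Whitney boxes -/

section Whitney

variable {n : ℕ}

theorem add_rpow_le {q : ℝ} (hq : 0 ≤ q) (A B C : ℝ≥0∞) :
    (A + B + C) ^ q ≤ 3 ^ q * (A ^ q + B ^ q + C ^ q) := by
  set m := max (max A B) C with hm
  have h1 : A + B + C ≤ 3 * m := by
    calc A + B + C ≤ m + m + m := by
          gcongr
          · exact (le_max_left _ _).trans (le_max_left _ _)
          · exact (le_max_right _ _).trans (le_max_left _ _)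
          · exact le_max_right _ _
      _ = 3 * m := by ring
  have h2 : m ^ q ≤ A ^ q + B ^ q + C ^ q := by
    rcases max_choice (max A B) C with h | h
    · rcases max_choice A B with h' | h'
      · rw [hm, h, h', add_assoc]; exact le_self_add
      · rw [hm, h, h', add_comm (A ^ q), add_assoc]; exact le_self_add
    · rw [hm, h]; exact le_add_self
  calc (A + B + C) ^ q ≤ (3 * m) ^ q := by gcongr
    _ = 3 ^ q * m ^ q := ENNReal.mul_rpow_of_nonneg _ _ hq
    _ ≤ _ := by gcongr

/-- The constant of the shifted John–Nirenberg estimate `BoxBMO.lintegral_add_rpow_le`. -/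
noncomputable def shiftJN (n : ℕ) (q : ℝ) : ℝ≥0∞ := 2 ^ (q - 1) * (1 + boxJN n q)

theorem shiftJN_ne_top {q : ℝ} (hq : 1 ≤ q) : shiftJN n q ≠ ⊤ := by
  refine ENNReal.mul_ne_top (ENNReal.rpow_ne_top_of_nonneg (by linarith) (by norm_num)) ?_
  exact ENNReal.add_ne_top.2 ⟨by norm_num, boxJN_ne_top (by linarith)⟩

variable [NeZero n]

/-- The generation `j` of the Whitney box of `x`, for which `2 ^ j < xₙ ≤ 2 ^ (j + 1)`. -/
noncomputable def whitneyLevel (x : ParaSpace n) : ℤ := ⌈Real.logb 2 (height x)⌉ - 1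

/-- The side of the Whitney box of `x`. -/
noncomputable def whitneySide (x : ParaSpace n) : ℝ := 2 ^ whitneyLevel x

/-- The label of the Whitney box of `x`: its generation and its position in the parabolic grid of
that generation. -/
noncomputable def whitneyLabel (x : ParaSpace n) : ℤ × (Fin (n + 1) → ℤ) :=
  (whitneyLevel x, fun i => ⌈x i / whitneySide x ^ paraExp n i⌉)

/-- The lower corner of the Whitney box of `x`. -/
noncomputable def whitneyCorner (x : ParaSpace n) : ParaSpace n :=
  gridCorner 0 (whitneySide x) (whitneyLabel x).2

/-- The box of the parabolic dyadic grid that contains `x` and whose side is comparable to its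
distance to the lateral boundary `{xₙ = 0}`. -/
noncomputable def whitneyBox (x : ParaSpace n) : Set (ParaSpace n) :=
  paraBox (whitneyCorner x) (whitneySide x)

theorem whitneySide_pos (x : ParaSpace n) : 0 < whitneySide x := by
  unfold whitneySide
  positivity

theorem whitneyLevel_eq_iff {x : ParaSpace n} (hx : x ∈ upperDomain n) (j : ℤ) :
    whitneyLevel x = j ↔ (2 : ℝ) ^ j < height x ∧ height x ≤ 2 * 2 ^ j := by
  have h1 : whitneyLevel x = j ↔ ⌈Real.logb 2 (height x)⌉ = j + 1 := by
    unfold whitneyLevel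
    omega
  have h2 : (2 : ℝ) * 2 ^ j = 2 ^ (j + 1) := by
    rw [zpow_add₀ (by norm_num), zpow_one, mul_comm]
  rw [h1, Int.ceil_eq_iff, h2, Real.logb_le_iff_le_rpow (by norm_num) (height_pos hx),
    Real.lt_logb_iff_rpow_lt (by norm_num) (height_pos hx)]
  push_cast
  rw [add_sub_cancel_right, Real.rpow_intCast,
    show (j : ℝ) + 1 = ((j + 1 : ℤ) : ℝ) by push_cast; rfl, Real.rpow_intCast]

theorem whitneySide_lt_height {x : ParaSpace n} (hx : x ∈ upperDomain n) :
    whitneySide x < height x := ((whitneyLevel_eq_iff hx _).1 rfl).1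

theorem height_le_two_mul_whitneySide {x : ParaSpace n} (hx : x ∈ upperDomain n) :
    height x ≤ 2 * whitneySide x := ((whitneyLevel_eq_iff hx _).1 rfl).2

theorem mem_whitneyBox_iff_ceil {x y : ParaSpace n} : y ∈ whitneyBox x ↔
    (fun i => ⌈y i / whitneySide x ^ paraExp n i⌉) = (whitneyLabel x).2 := by
  rw [whitneyBox, whitneyCorner, ← setOf_ceil_eq_paraBox 0 (whitneySide_pos x)]
  simp

theorem mem_whitneyBox_self (x : ParaSpace n) : x ∈ whitneyBox x := mem_whitneyBox_iff_ceil.2 rfl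

theorem whitneyCorner_cornerInDomain {x : ParaSpace n} (hx : x ∈ upperDomain n) :
    CornerInDomain (whitneyCorner x) := by
  intro i hi
  have hxi := mem_upperDomain_iff.1 hx i hi
  have hs := whitneySide_pos x
  have h0 : 0 < (whitneyLabel x).2 i := by
    rw [whitneyLabel, Int.ceil_pos]
    positivity
  have h1 : (1 : ℝ) ≤ (whitneyLabel x).2 i := by exact_mod_cast h0
  have h2 : (0 : ℝ) ≤ (whitneyLabel x).2 i - 1 := by linarith
  simp only [whitneyCorner, gridCorner, PiLp.zero_apply, zero_add]
  positivity

theorem whitneyBox_subset_upperDomain {x : ParaSpace n} (hx : x ∈ upperDomain n) :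
    whitneyBox x ⊆ upperDomain n :=
  paraBox_subset_upperDomain (whitneyCorner_cornerInDomain hx) _

theorem whitneyLabel_eq_iff_mem {x y : ParaSpace n} (hx : x ∈ upperDomain n) :
    whitneyLabel y = whitneyLabel x ↔ y ∈ whitneyBox x := by
  constructor
  · intro h
    have h1 : whitneyLevel y = whitneyLevel x := congrArg Prod.fst h
    have h2 : whitneySide y = whitneySide x := by rw [whitneySide, h1, ← whitneySide]
    rw [mem_whitneyBox_iff_ceil, ← congrArg Prod.snd h, ← h2]
    rfl
  · intro h
    have hy := whitneyBox_subset_upperDomain hx h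
    have hs := whitneySide_pos x
    have h1 := mem_whitneyBox_iff_ceil.1 h
    have hlev : whitneyLevel y = whitneyLevel x := by
      rw [whitneyLevel_eq_iff hy, ← whitneySide]
      have h3 : ⌈height x / whitneySide x⌉ = 2 := by
        rw [Int.ceil_eq_iff, lt_div_iff₀ hs, div_le_iff₀ hs]
        push_cast
        have := whitneySide_lt_height hx
        have := height_le_two_mul_whitneySide hx
        constructor <;> linarith
      have h4 : ⌈height y / whitneySide x⌉ = 2 := by
        rw [← h3]
        have := congrFun h1 (lastSpatial n).castSucc
        simpa only [height, whitneyLabel, paraExp_castSucc, pow_one] using this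
      rw [Int.ceil_eq_iff, lt_div_iff₀ hs, div_le_iff₀ hs] at h4
      push_cast at h4
      constructor <;> linarith [h4.1, h4.2]
    have hside : whitneySide y = whitneySide x := by rw [whitneySide, hlev, ← whitneySide]
    refine Prod.ext hlev ?_
    rw [← h1, ← hside]
    rfl

theorem whitneySide_eq_of_label {x y : ParaSpace n} (h : whitneyLabel y = whitneyLabel x) :
    whitneySide y = whitneySide x := by
  rw [whitneySide, show whitneyLevel y = whitneyLevel x from congrArg Prod.fst h, ← whitneySide]

theorem whitneyBox_eq_of_label {x y : ParaSpace n} (h : whitneyLabel y = whitneyLabel x) :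
    whitneyBox y = whitneyBox x := by
  rw [whitneyBox, whitneyBox, whitneyCorner, whitneyCorner, whitneySide_eq_of_label h, h]

theorem measurable_whitneyLabel : Measurable (whitneyLabel : ParaSpace n → _) := by
  have h1 : Measurable (whitneyLevel : ParaSpace n → ℤ) := by
    have : Measurable fun x : ParaSpace n => Real.logb 2 (height x) := by
      unfold Real.logb
      fun_prop
    exact (this.ceil).sub_const 1
  have h2 : Measurable (whitneySide : ParaSpace n → ℝ) :=
    (measurable_from_top (f := fun z : ℤ => (2 : ℝ) ^ z)).comp h1
  refine h1.prodMk (measurable_pi_iff.2 fun i => Measurable.ceil ?_)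
  fun_prop

theorem measurableSet_whitneyLabel_eq (v : ℤ × (Fin (n + 1) → ℤ)) :
    MeasurableSet {y : ParaSpace n | whitneyLabel y = v} :=
  measurable_whitneyLabel (measurableSet_singleton v)

/-- The mean of `a` over the Whitney box of `x`. -/
noncomputable def whitneyMean (a : ParaSpace n → ℝ) (x : ParaSpace n) : ℝ :=
  ⨍ z in whitneyBox x, a z

theorem measurable_whitneyMean (a : ParaSpace n → ℝ) : Measurable (whitneyMean a) := by
  have h : whitneyMean a = (fun v : ℤ × (Fin (n + 1) → ℤ) =>
      ⨍ z in paraBox (gridCorner 0 (2 ^ v.1) v.2) (2 ^ v.1), a z) ∘ whitneyLabel := by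
    funext x
    rfl
  rw [h]
  exact (Measurable.of_discrete (f := fun v : ℤ × (Fin (n + 1) → ℤ) =>
    ⨍ z in paraBox (gridCorner 0 (2 ^ v.1) v.2) (2 ^ v.1), a z)).comp measurable_whitneyLabel

theorem BoxBMO.lintegral_add_rpow_le {a : ParaSpace n → ℝ} {κ : ℝ≥0∞} (ha : BoxBMO a κ)
    (ham : Measurable a) (hκ : κ ≠ 0) (hκt : κ ≠ ⊤) {q : ℝ} (hq : 1 ≤ q) {o : ParaSpace n} {ℓ : ℝ}
    (hℓ : 0 < ℓ) (ho : CornerInDomain o) :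
    ∫⁻ y in paraBox o ℓ, (κ + ‖a y - ⨍ z in paraBox o ℓ, a z‖ₑ) ^ q ≤
      shiftJN n q * κ ^ q * volume (paraBox o ℓ) := by
  have hq0 : 0 < q := by linarith
  set B := paraBox o ℓ with hB
  set c := ⨍ z in B, a z with hc
  have hg : Measurable fun y => ‖a y - c‖ₑ ^ q := (ham.sub_const c).enorm.pow_const q
  calc ∫⁻ y in B, (κ + ‖a y - c‖ₑ) ^ q
      ≤ ∫⁻ y in B, 2 ^ (q - 1) * (κ ^ q + ‖a y - c‖ₑ ^ q) :=
        lintegral_mono fun y => ENNReal.rpow_add_le_mul_rpow_add_rpow _ _ hq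
    _ = 2 ^ (q - 1) * (κ ^ q * volume B + ∫⁻ y in B, ‖a y - c‖ₑ ^ q) := by
        rw [lintegral_const_mul _ (by fun_prop), lintegral_add_left measurable_const,
          setLIntegral_const]
    _ ≤ 2 ^ (q - 1) * (κ ^ q * volume B + boxJN n q * κ ^ q * volume B) := by
        gcongr
        exact ha.lintegral_rpow_le ham hκ hκt hq0 hℓ ho
    _ = _ := by rw [shiftJN]; ring

/-- Oscillation factors may be averaged away: against a density that is essentially constant on
Whitney boxes, the oscillation of a `BMO` function over these boxes acts as a constant. -/
theorem BoxBMO.lintegral_mul_whitney_le {a : ParaSpace n → ℝ} {κ : ℝ≥0∞} (ha : BoxBMO a κ)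
    (ham : Measurable a) (hκ : κ ≠ 0) (hκt : κ ≠ ⊤) {q : ℝ} (hq : 1 ≤ q) {Φ : ParaSpace n → ℝ≥0∞}
    (hΦ : Measurable Φ) {M : ℝ≥0∞}
    (hM : ∀ x ∈ upperDomain n, ∀ y ∈ whitneyBox x, Φ y ≤ M * Φ x) :
    ∫⁻ y in upperDomain n, Φ y * (κ + ‖a y - whitneyMean a y‖ₑ) ^ q ≤
      M * M * shiftJN n q * κ ^ q * ∫⁻ y in upperDomain n, Φ y := by
  have hg : Measurable fun y => (κ + ‖a y - whitneyMean a y‖ₑ) ^ q :=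
    ((ham.sub (measurable_whitneyMean a)).enorm.const_add κ).pow_const q
  have hQ : MeasurableSet (upperDomain n) := measurableSet_upperDomain
  have key := measure_le_of_forall_fiber
    (ν₁ := volume.withDensity fun y => Φ y * (κ + ‖a y - whitneyMean a y‖ₑ) ^ q)
    (ν₂ := volume.withDensity fun y => M * M * shiftJN n q * κ ^ q * Φ y)
    (f := whitneyLabel) (E := upperDomain n) measurableSet_whitneyLabel_eq ?_ ?_
  · rw [withDensity_apply _ hQ, withDensity_apply _ hQ, lintegral_const_mul _ hΦ] at key
    exact key
  · intro x y hxy hx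
    exact whitneyBox_subset_upperDomain hx ((whitneyLabel_eq_iff_mem hx).1 hxy)
  · intro x hx
    have hfib : {y | whitneyLabel y = whitneyLabel x} = whitneyBox x := by
      ext y
      exact whitneyLabel_eq_iff_mem hx
    rw [hfib]
    have hBm : MeasurableSet (whitneyBox x) := measurableSet_paraBox _ _
    rw [withDensity_apply _ hBm, withDensity_apply _ hBm, lintegral_const_mul _ hΦ]
    have hmean : ∀ y ∈ whitneyBox x, whitneyMean a y = ⨍ z in whitneyBox x, a z := by
      intro y hy
      rw [whitneyMean, whitneyBox_eq_of_label ((whitneyLabel_eq_iff_mem hx).2 hy)]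
    calc ∫⁻ y in whitneyBox x, Φ y * (κ + ‖a y - whitneyMean a y‖ₑ) ^ q
        ≤ ∫⁻ y in whitneyBox x,
            M * Φ x * (κ + ‖a y - ⨍ z in whitneyBox x, a z‖ₑ) ^ q := by
          refine setLIntegral_mono' hBm fun y hy => ?_
          rw [hmean y hy]
          gcongr
          exact hM x hx y hy
      _ = M * Φ x * ∫⁻ y in whitneyBox x, (κ + ‖a y - ⨍ z in whitneyBox x, a z‖ₑ) ^ q :=
          lintegral_const_mul _ (((ham.sub_const _).enorm.const_add κ).pow_const q)
      _ ≤ M * Φ x * (shiftJN n q * κ ^ q * volume (whitneyBox x)) := by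
          gcongr
          exact ha.lintegral_add_rpow_le ham hκ hκt hq (whitneySide_pos x)
            (whitneyCorner_cornerInDomain hx)
      _ = M * shiftJN n q * κ ^ q * ∫⁻ _ in whitneyBox x, Φ x := by
          rw [setLIntegral_const]
          ring
      _ ≤ M * shiftJN n q * κ ^ q * ∫⁻ y in whitneyBox x, M * Φ y := by
          gcongr 1
          refine setLIntegral_mono' hBm fun y hy => ?_
          have hlab := (whitneyLabel_eq_iff_mem hx).2 hy
          refine hM y (whitneyBox_subset_upperDomain hx hy) x ?_
          rw [whitneyBox_eq_of_label hlab]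
          exact mem_whitneyBox_self x
      _ = _ := by
          rw [lintegral_const_mul _ hΦ]
          ring

end Whitney

/-! ### The majorant operator on `L^p` -/

section Schur

variable {n : ℕ} [NeZero n]

/-- The kernel `reflDist x y ^ (-(n + 2))`. -/
noncomputable def reflKernel (x y : ParaSpace n) : ℝ≥0∞ :=
  ENNReal.ofReal (reflDist x y ^ (-(n + 2 : ℝ)))

/-- The power weight `xₙ ^ α`. -/
noncomputable def heightPow (α : ℝ) (x : ParaSpace n) : ℝ≥0∞ := ENNReal.ofReal (height x ^ α)

/-- The positive operator `f ↦ ∫ reflDist x y ^ (-(n + 2)) (κ + |a(x) - a(y)|) f(y) dy`, which up to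
a constant factor dominates the nonsingular integral (for `a = 0`, `κ = 1`) and the commutator. -/
noncomputable def majorant (a : ParaSpace n → ℝ) (κ : ℝ≥0∞) (f : ParaSpace n → ℝ≥0∞)
    (x : ParaSpace n) : ℝ≥0∞ :=
  ∫⁻ y in upperDomain n, reflKernel x y * (κ + ‖a x - a y‖ₑ) * f y

@[fun_prop]
theorem measurable_reflKernel {Y : Type*} [MeasurableSpace Y] {f g : Y → ParaSpace n}
    (hf : Measurable f) (hg : Measurable g) : Measurable fun y => reflKernel (f y) (g y) := by
  unfold reflKernel
  fun_prop

@[fun_prop]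
theorem measurable_heightPow (α : ℝ) : Measurable (heightPow α : ParaSpace n → ℝ≥0∞) := by
  unfold heightPow
  fun_prop

theorem reflKernel_comm (x y : ParaSpace n) : reflKernel x y = reflKernel y x := by
  rw [reflKernel, reflDist_comm, ← reflKernel]

theorem heightPow_add {x : ParaSpace n} (hx : x ∈ upperDomain n) (α β : ℝ) :
    heightPow (α + β) x = heightPow α x * heightPow β x := by
  have := height_pos hx
  rw [heightPow, Real.rpow_add this, ENNReal.ofReal_mul (by positivity)]
  rfl

theorem heightPow_rpow {x : ParaSpace n} (hx : x ∈ upperDomain n) (α : ℝ) {s : ℝ} (hs : 0 ≤ s) :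
    heightPow α x ^ s = heightPow (α * s) x := by
  have := height_pos hx
  rw [heightPow, ENNReal.ofReal_rpow_of_nonneg (by positivity) hs, ← Real.rpow_mul this.le]
  rfl

theorem heightPow_zero (x : ParaSpace n) : heightPow 0 x = 1 := by simp [heightPow]

/-- The distance `reflDist · y` is essentially constant on Whitney boxes. -/
theorem reflDist_le_of_mem_whitneyBox {x y z : ParaSpace n} (hx : x ∈ upperDomain n)
    (hy : y ∈ upperDomain n) (hz : z ∈ whitneyBox x) :
    reflDist z y ≤ (n + 4) * reflDist x y := by
  have hzQ := whitneyBox_subset_upperDomain hx hz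
  set d := reflDist x y with hd
  set s := whitneySide x with hs
  have hs0 : 0 < s := whitneySide_pos x
  have hsd : s ≤ d := (whitneySide_lt_height hx).le.trans (height_le_reflDist_left hy)
  have hcoord := fun i => abs_sub_lt_of_mem_paraBox (mem_whitneyBox_self x) hz i
  have h1 : spatialNorm (z - x) ≤ n * s := by
    refine spatialNorm_le_of_forall_abs_le hs0.le fun i => ?_
    have := hcoord i.castSucc
    rw [paraExp_castSucc, pow_one] at this
    exact this.le
  have h2 : spatialNorm (z - y) ≤ spatialNorm (z - x) + spatialNorm (x - y) := by
    have := spatialNorm_add_le (z - x) (x - y)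
    rwa [sub_add_sub_cancel] at this
  have h3 : √|z (Fin.last n) - x (Fin.last n)| ≤ s := by
    have := hcoord (Fin.last n)
    rw [paraExp_last] at this
    exact Real.sqrt_le_iff.2 ⟨hs0.le, this.le⟩
  have h4 : √|z (Fin.last n) - y (Fin.last n)| ≤
      √|z (Fin.last n) - x (Fin.last n)| + √|x (Fin.last n) - y (Fin.last n)| := by
    refine (Real.sqrt_le_sqrt (abs_sub_le _ (x (Fin.last n)) _)).trans ?_
    set A := |z (Fin.last n) - x (Fin.last n)| with hA
    set B := |x (Fin.last n) - y (Fin.last n)| with hB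
    have hA0 := Real.sq_sqrt (show 0 ≤ A from abs_nonneg _)
    have hB0 := Real.sq_sqrt (show 0 ≤ B from abs_nonneg _)
    refine Real.sqrt_le_iff.2 ⟨by positivity, ?_⟩
    nlinarith [mul_nonneg (Real.sqrt_nonneg A) (Real.sqrt_nonneg B)]
  have h5 : height z ≤ 2 * s := by
    have hlab := (whitneyLabel_eq_iff_mem hx).2 hz
    have := height_le_two_mul_whitneySide hzQ
    rwa [whitneySide_eq_of_label hlab] at this
  have h6 := height_pos hx
  have h7 : (n : ℝ) * s ≤ n * d := by gcongr
  have h8 : reflDist z y = spatialNorm (z - y) + √|z (Fin.last n) - y (Fin.last n)| + height z +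
    height y := rfl
  have h9 : d = spatialNorm (x - y) + √|x (Fin.last n) - y (Fin.last n)| + height x +
    height y := rfl
  nlinarith

theorem mem_whitneyBox_symm {x z : ParaSpace n} (hx : x ∈ upperDomain n) (hz : z ∈ whitneyBox x) :
    x ∈ whitneyBox z := by
  rw [whitneyBox_eq_of_label ((whitneyLabel_eq_iff_mem hx).2 hz)]
  exact mem_whitneyBox_self x

theorem reflKernel_le_of_mem_whitneyBox {x y z : ParaSpace n} (hx : x ∈ upperDomain n)
    (hy : y ∈ upperDomain n) (hz : z ∈ whitneyBox x) :
    reflKernel z y ≤ ENNReal.ofReal ((n + 4 : ℝ) ^ (n + 2 : ℝ)) * reflKernel x y := by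
  have hzQ := whitneyBox_subset_upperDomain hx hz
  have h1 := reflDist_le_of_mem_whitneyBox hzQ hy (mem_whitneyBox_symm hx hz)
  have hx0 := reflDist_pos hx hy
  have hz0 := reflDist_pos hzQ hy
  have hn : (0 : ℝ) < n + 4 := by positivity
  rw [reflKernel, reflKernel, ← ENNReal.ofReal_mul (by positivity)]
  refine ENNReal.ofReal_le_ofReal ?_
  calc reflDist z y ^ (-(n + 2 : ℝ)) ≤ (reflDist x y / (n + 4)) ^ (-(n + 2 : ℝ)) := by
        refine Real.rpow_le_rpow_of_nonpos (by positivity) ?_ ?_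
        · rw [div_le_iff₀ hn]
          linarith
        · have : (0 : ℝ) ≤ n := n.cast_nonneg
          linarith
    _ = (n + 4 : ℝ) ^ (n + 2 : ℝ) * reflDist x y ^ (-(n + 2 : ℝ)) := by
        rw [Real.div_rpow hx0.le hn.le, Real.rpow_neg hn.le]
        field_simp

theorem heightPow_neg_le_of_mem_whitneyBox {x z : ParaSpace n} (hx : x ∈ upperDomain n)
    (hz : z ∈ whitneyBox x) {γ : ℝ} (hγ : 0 ≤ γ) :
    heightPow (-γ) z ≤ ENNReal.ofReal (2 ^ γ) * heightPow (-γ) x := by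
  have hzQ := whitneyBox_subset_upperDomain hx hz
  have hx0 := height_pos hx
  rw [heightPow, heightPow, ← ENNReal.ofReal_mul (by positivity)]
  refine ENNReal.ofReal_le_ofReal ?_
  calc height z ^ (-γ) ≤ (height x / 2) ^ (-γ) := by
        refine Real.rpow_le_rpow_of_nonpos (by positivity) ?_ (by linarith)
        have h1 := height_le_two_mul_whitneySide hx
        have h2 := whitneySide_lt_height hzQ
        rw [whitneySide_eq_of_label ((whitneyLabel_eq_iff_mem hx).2 hz)] at h2
        linarith
    _ = 2 ^ γ * height x ^ (-γ) := by
        rw [Real.div_rpow hx0.le (by norm_num), Real.rpow_neg (by norm_num : (0 : ℝ) ≤ 2)]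
        field_simp

theorem exists_lintegral_reflKernel_le {σ : ℝ} (hσ0 : 0 < σ) (hσ1 : σ < 1) :
    ∃ C : ℝ≥0∞, C ≠ ⊤ ∧ ∀ x ∈ upperDomain n,
      ∫⁻ y in upperDomain n, reflKernel x y * heightPow (-σ) y ≤ C * heightPow (-σ) x := by
  obtain ⟨C, hC, h⟩ := exists_lintegral_reflDist_rpow_le (n := n) (τ := 0) hσ0 hσ0 hσ1
  refine ⟨C, hC, fun x hx => ?_⟩
  simpa [reflKernel, heightPow] using h x hx

/-- The same bound with an oscillation factor in the integrand. -/
theorem exists_lintegral_reflKernel_osc_le {σ q : ℝ} (hσ0 : 0 < σ) (hσ1 : σ < 1) (hq : 1 ≤ q) :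
    ∃ C : ℝ≥0∞, C ≠ ⊤ ∧ ∀ (a : ParaSpace n → ℝ) (κ : ℝ≥0∞), BoxBMO a κ → Measurable a → κ ≠ 0 →
      κ ≠ ⊤ → ∀ x ∈ upperDomain n,
      ∫⁻ y in upperDomain n,
        reflKernel x y * heightPow (-σ) y * (κ + ‖a y - whitneyMean a y‖ₑ) ^ q ≤
      C * κ ^ q * heightPow (-σ) x := by
  obtain ⟨C, hC, h⟩ := exists_lintegral_reflKernel_le (n := n) hσ0 hσ1
  set M : ℝ≥0∞ := ENNReal.ofReal ((n + 4 : ℝ) ^ (n + 2 : ℝ)) * ENNReal.ofReal (2 ^ σ) with hM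
  have hJ : shiftJN n q ≠ ⊤ := shiftJN_ne_top hq
  refine ⟨M * M * shiftJN n q * C, by finiteness, fun a κ ha ham hκ hκt x hx => ?_⟩
  calc _ ≤ M * M * shiftJN n q * κ ^ q *
        ∫⁻ y in upperDomain n, reflKernel x y * heightPow (-σ) y := by
        refine ha.lintegral_mul_whitney_le ham hκ hκt hq (by fun_prop) fun y hy z hz => ?_
        rw [reflKernel_comm x z, reflKernel_comm x y]
        calc reflKernel z x * heightPow (-σ) z ≤
            (ENNReal.ofReal ((n + 4 : ℝ) ^ (n + 2 : ℝ)) * reflKernel y x) *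
              (ENNReal.ofReal (2 ^ σ) * heightPow (-σ) y) := by
              gcongr
              · exact reflKernel_le_of_mem_whitneyBox hy hx hz
              · exact heightPow_neg_le_of_mem_whitneyBox hy hz hσ0.le
          _ = _ := by rw [hM]; ring
    _ ≤ M * M * shiftJN n q * κ ^ q * (C * heightPow (-σ) x) := by
        gcongr
        exact h x hx
    _ = _ := by ring

/-- The means over the Whitney boxes of two points differ by a small power of their distance
relative to their heights. -/
theorem exists_enorm_whitneyMean_sub_le {ε : ℝ} (hε : 0 < ε) (hε1 : ε < n + 2) :
    ∃ C : ℝ≥0∞, C ≠ ⊤ ∧ ∀ (a : ParaSpace n → ℝ) (κ : ℝ≥0∞), BoxBMO a κ → Measurable a → κ ≠ 0 →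
      κ ≠ ⊤ → ∀ x ∈ upperDomain n, ∀ y ∈ upperDomain n,
      ‖whitneyMean a x - whitneyMean a y‖ₑ ≤
        C * κ * ENNReal.ofReal ((reflDist x y ^ 2 / (height x * height y)) ^ ε) := by
  set q : ℝ := (n + 2) / ε with hq
  have hq1 : 1 < q := by rwa [hq, one_lt_div hε]
  have hqε : (n + 2 : ℝ) / q = ε := by
    rw [hq]
    have : (n + 2 : ℝ) ≠ 0 := by positivity
    field_simp
  have hJ : boxJN n q ≠ ⊤ := boxJN_ne_top (by linarith)
  refine ⟨2 * boxJN n q ^ (1 / q) * ENNReal.ofReal (8 ^ ε), ?_, ?_⟩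
  · have : boxJN n q ^ (1 / q) ≠ ⊤ := ENNReal.rpow_ne_top_of_nonneg (by positivity) hJ
    finiteness
  intro a κ ha ham hκ hκt x hx y hy
  set d := reflDist x y with hd
  have hd0 : 0 < d := reflDist_pos hx hy
  have hxd : height x ≤ d := height_le_reflDist_left hy
  have hyd : height y ≤ d := height_le_reflDist_right hx
  have hx0 := height_pos hx
  have hy0 := height_pos hy
  -- both Whitney boxes lie in a box of side comparable to `d`
  have hsub : ∀ u ∈ upperDomain n, height u ≤ d → (∀ i, |u i - x i| ≤ d ^ paraExp n i) →
      whitneyBox u ⊆ paraBox (domainCorner x (2 * d)) (2 * (2 * d)) := by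
    intro u hu hud hux z hz
    refine mem_paraBox_domainCorner (by positivity) (whitneyBox_subset_upperDomain hu hz)
      fun i => ?_
    have h1 := abs_sub_lt_of_mem_paraBox (mem_whitneyBox_self u) hz i
    have h2 : whitneySide u ^ paraExp n i ≤ d ^ paraExp n i :=
      pow_le_pow_left₀ (whitneySide_pos u).le ((whitneySide_lt_height hu).le.trans hud) _
    have h3 : 2 * d ^ paraExp n i ≤ (2 * d) ^ paraExp n i := by
      rw [mul_pow]
      gcongr
      exact le_self_pow₀ (by norm_num) (paraExp_ne_zero i)
    have h4 := abs_sub_le (z i) (u i) (x i)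
    linarith [hux i]
  have hmean : ∀ u ∈ upperDomain n, height u ≤ d → (∀ i, |u i - x i| ≤ d ^ paraExp n i) →
      ‖whitneyMean a u - ⨍ z in paraBox (domainCorner x (2 * d)) (2 * (2 * d)), a z‖ₑ ≤
        boxJN n q ^ (1 / q) * κ * ENNReal.ofReal (8 ^ ε * (d / height u) ^ ε) := by
    intro u hu hud hux
    have hu0 := height_pos hu
    have hs0 := whitneySide_pos u
    refine (ha.enorm_average_sub_le ham hκ hκt hq1 hs0 (by positivity)
      (whitneyCorner_cornerInDomain hu) (domainCorner_cornerInDomain x _)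
      (hsub u hu hud hux)).trans ?_
    rw [hqε, ← Real.mul_rpow (by norm_num) (by positivity)]
    gcongr
    rw [div_le_iff₀ hs0]
    have := height_le_two_mul_whitneySide hu
    have h1 : 8 * (d / height u) * whitneySide u = 4 * d * (2 * whitneySide u / height u) := by
      field_simp
      ring
    have h2 : 1 ≤ 2 * whitneySide u / height u := by rwa [one_le_div hu0]
    rw [h1]
    nlinarith
  set c := ⨍ z in paraBox (domainCorner x (2 * d)) (2 * (2 * d)), a z with hc
  have hmx := hmean x hx hxd fun i => by simpa using pow_nonneg hd0.le _
  have hmy := hmean y hy hyd fun i => abs_sub_le_reflDist hx hy i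
  have hu1 : 1 ≤ (d / height x) ^ ε := Real.one_le_rpow ((one_le_div hx0).2 hxd) hε.le
  have hv1 : 1 ≤ (d / height y) ^ ε := Real.one_le_rpow ((one_le_div hy0).2 hyd) hε.le
  have hprod : (d ^ 2 / (height x * height y)) ^ ε = (d / height x) ^ ε * (d / height y) ^ ε := by
    rw [← Real.mul_rpow (by positivity) (by positivity)]
    congr 1
    field_simp
  calc ‖whitneyMean a x - whitneyMean a y‖ₑ
      = ‖(whitneyMean a x - c) - (whitneyMean a y - c)‖ₑ := by congr 1; ring
    _ ≤ ‖whitneyMean a x - c‖ₑ + ‖whitneyMean a y - c‖ₑ := enorm_sub_le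
    _ ≤ boxJN n q ^ (1 / q) * κ * ENNReal.ofReal (8 ^ ε * (d ^ 2 / (height x * height y)) ^ ε) +
        boxJN n q ^ (1 / q) * κ * ENNReal.ofReal (8 ^ ε * (d ^ 2 / (height x * height y)) ^ ε) := by
        refine add_le_add (hmx.trans ?_) (hmy.trans ?_)
        · gcongr _ * ENNReal.ofReal (_ * ?_)
          rw [hprod]
          exact le_mul_of_one_le_right (by positivity) hv1
        · gcongr _ * ENNReal.ofReal (_ * ?_)
          rw [hprod]
          exact le_mul_of_one_le_left (by positivity) hu1
    _ = _ := by
        rw [ENNReal.ofReal_mul (by positivity)]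
        ring

/-- The first half of the Schur test: with the factor `κ + |a(x) - a(y)|` raised to the power `q`,
the kernel of the majorant integrates the weight `yₙ^{-α}` to at most a multiple of `xₙ^{-α}` times
the `q`-th power of the oscillation at `x`. -/
theorem exists_lintegral_majorant_kernel_le {α q : ℝ} (hα0 : 0 < α) (hα1 : α ≤ 1 / 2) (hq : 1 < q) :
    ∃ C : ℝ≥0∞, C ≠ ⊤ ∧ ∀ (a : ParaSpace n → ℝ) (κ : ℝ≥0∞), BoxBMO a κ → Measurable a → κ ≠ 0 →
      κ ≠ ⊤ → ∀ x ∈ upperDomain n,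
      ∫⁻ y in upperDomain n,
        reflKernel x y * heightPow (-α) y * (κ + ‖a x - a y‖ₑ) ^ q ≤
      C * heightPow (-α) x * (κ + ‖a x - whitneyMean a x‖ₑ) ^ q := by
  have hq0 : 0 < q := by linarith
  set δ := α / 2 with hδ
  have hn : (0 : ℝ) ≤ n := n.cast_nonneg
  have hδq : δ / q < n + 2 := by
    rw [div_lt_iff₀ hq0]
    nlinarith
  obtain ⟨C₁, hC₁, h₁⟩ := exists_lintegral_reflKernel_le (n := n) hα0 (show α < 1 by linarith)
  obtain ⟨C₂, hC₂, h₂⟩ := exists_lintegral_reflKernel_osc_le (n := n) hα0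
    (show α < 1 by linarith) hq.le
  obtain ⟨C₃, hC₃, h₃⟩ := exists_enorm_whitneyMean_sub_le (n := n) (ε := δ / q)
    (by positivity) hδq
  obtain ⟨C₄, hC₄, h₄⟩ := exists_lintegral_reflDist_rpow_le (n := n) (τ := 2 * δ) (σ := α + δ)
    (by linarith) (by positivity) (by linarith)
  have hC₃' : C₃ ^ q ≠ ⊤ := ENNReal.rpow_ne_top_of_nonneg hq0.le hC₃
  refine ⟨3 ^ q * (C₁ + C₂ + C₃ ^ q * C₄), ?_, ?_⟩
  · have : (3 : ℝ≥0∞) ^ q ≠ ⊤ := ENNReal.rpow_ne_top_of_nonneg hq0.le (by norm_num)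
    finiteness
  intro a κ ha ham hκ hκt x hx
  have hx0 := height_pos hx
  set b : ParaSpace n → ℝ≥0∞ := fun y => κ + ‖a y - whitneyMean a y‖ₑ with hb
  have hbm : Measurable b := (ham.sub (measurable_whitneyMean a)).enorm.const_add κ
  have hκb : κ ^ q ≤ b x ^ q := by
    gcongr
    exact le_self_add
  set R : ParaSpace n → ℝ≥0∞ := fun y =>
    ENNReal.ofReal ((reflDist x y ^ 2 / (height x * height y)) ^ (δ / q)) with hR
  have hRm : Measurable R := by fun_prop
  -- compare `a x` and `a y` through the means over the Whitney boxes of `x` and `y`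
  have hpt : ∀ y ∈ upperDomain n, (κ + ‖a x - a y‖ₑ) ^ q ≤
      3 ^ q * (b x ^ q + b y ^ q + (C₃ * κ * R y) ^ q) := by
    intro y hy
    refine le_trans (ENNReal.rpow_le_rpow ?_ hq0.le) (add_rpow_le hq0.le _ _ _)
    calc κ + ‖a x - a y‖ₑ = κ + ‖(a x - whitneyMean a x) +
            ((whitneyMean a x - whitneyMean a y) - (a y - whitneyMean a y))‖ₑ := by
          congr 2; ring
      _ ≤ κ + (‖a x - whitneyMean a x‖ₑ +
            (‖whitneyMean a x - whitneyMean a y‖ₑ + ‖a y - whitneyMean a y‖ₑ)) := by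
          gcongr
          exact (enorm_add_le _ _).trans (by gcongr; exact enorm_sub_le)
      _ ≤ κ + (‖a x - whitneyMean a x‖ₑ + (C₃ * κ * R y + ‖a y - whitneyMean a y‖ₑ)) := by
          gcongr
          exact h₃ a κ ha ham hκ hκt x hx y hy
      _ = b x + ‖a y - whitneyMean a y‖ₑ + C₃ * κ * R y := by simp only [hb]; ring
      _ ≤ b x + b y + C₃ * κ * R y := by
          gcongr
          exact le_add_self
  -- `R ^ q` costs the power `2δ` of the distance and `-δ` of both heights, and `2δ < α + δ`
  have hRint : ∫⁻ y in upperDomain n, reflKernel x y * heightPow (-α) y * R y ^ q ≤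
      C₄ * heightPow (-α) x := by
    have heq : ∀ y ∈ upperDomain n, reflKernel x y * heightPow (-α) y * R y ^ q =
        heightPow (-δ) x * (ENNReal.ofReal (reflDist x y ^ (-(n + 2 : ℝ) + 2 * δ)) *
          ENNReal.ofReal (height y ^ (-(α + δ)))) := by
      intro y hy
      have hy0 := height_pos hy
      have hd0 := reflDist_pos hx hy
      simp only [hR, reflKernel, heightPow]
      rw [ENNReal.ofReal_rpow_of_nonneg (by positivity) hq0.le,
        ← ENNReal.ofReal_mul (by positivity),
        ← ENNReal.ofReal_mul (by positivity), ← ENNReal.ofReal_mul (by positivity),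
        ← ENNReal.ofReal_mul (by positivity), ← Real.rpow_mul (by positivity),
        div_mul_cancel₀ _ hq0.ne', Real.div_rpow (by positivity) (by positivity),
        Real.mul_rpow hx0.le hy0.le, neg_add α δ, Real.rpow_add hy0, Real.rpow_add hd0,
        Real.rpow_neg hx0.le δ, Real.rpow_neg hy0.le δ, ← Real.rpow_natCast (reflDist x y) 2,
        ← Real.rpow_mul hd0.le]
      congr 1
      push_cast
      field_simp
    rw [setLIntegral_congr_fun measurableSet_upperDomain heq, lintegral_const_mul _ (by fun_prop)]
    calc _ ≤ heightPow (-δ) x * (C₄ * ENNReal.ofReal (height x ^ (2 * δ - (α + δ)))) := by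
          gcongr
          exact h₄ x hx
      _ = C₄ * (heightPow (-δ) x * heightPow (2 * δ - (α + δ)) x) := by
          rw [heightPow]
          unfold heightPow
          ring
      _ = _ := by
          rw [← heightPow_add hx]
          congr 2
          ring
  calc ∫⁻ y in upperDomain n, reflKernel x y * heightPow (-α) y * (κ + ‖a x - a y‖ₑ) ^ q
      ≤ ∫⁻ y in upperDomain n, 3 ^ q * (b x ^ q * (reflKernel x y * heightPow (-α) y) +
          reflKernel x y * heightPow (-α) y * b y ^ q +
          C₃ ^ q * κ ^ q * (reflKernel x y * heightPow (-α) y * R y ^ q)) := by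
        refine setLIntegral_mono' measurableSet_upperDomain fun y hy => ?_
        calc reflKernel x y * heightPow (-α) y * (κ + ‖a x - a y‖ₑ) ^ q
            ≤ reflKernel x y * heightPow (-α) y *
              (3 ^ q * (b x ^ q + b y ^ q + (C₃ * κ * R y) ^ q)) := by
              gcongr
              exact hpt y hy
          _ = _ := by
              rw [ENNReal.mul_rpow_of_nonneg _ _ hq0.le, ENNReal.mul_rpow_of_nonneg _ _ hq0.le]
              ring
    _ = 3 ^ q * (b x ^ q * (∫⁻ y in upperDomain n, reflKernel x y * heightPow (-α) y) +
          (∫⁻ y in upperDomain n, reflKernel x y * heightPow (-α) y * b y ^ q) +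
          C₃ ^ q * κ ^ q *
            ∫⁻ y in upperDomain n, reflKernel x y * heightPow (-α) y * R y ^ q) := by
        have m1 : Measurable fun y => reflKernel x y * heightPow (-α) y := by fun_prop
        have m2 : Measurable fun y => reflKernel x y * heightPow (-α) y * b y ^ q :=
          m1.mul (hbm.pow_const q)
        have m3 : Measurable fun y => reflKernel x y * heightPow (-α) y * R y ^ q :=
          m1.mul (hRm.pow_const q)
        have m4 : Measurable fun y =>
            C₃ ^ q * κ ^ q * (reflKernel x y * heightPow (-α) y * R y ^ q) := m3.const_mul _
        have m5 : Measurable fun y => b x ^ q * (reflKernel x y * heightPow (-α) y) +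
            reflKernel x y * heightPow (-α) y * b y ^ q := (m1.const_mul _).add m2
        have m6 : Measurable fun y => b x ^ q * (reflKernel x y * heightPow (-α) y) +
            reflKernel x y * heightPow (-α) y * b y ^ q +
            C₃ ^ q * κ ^ q * (reflKernel x y * heightPow (-α) y * R y ^ q) := m5.add m4
        rw [lintegral_const_mul _ m6, lintegral_add_right _ m4, lintegral_add_right _ m2,
          lintegral_const_mul _ m1, lintegral_const_mul _ m3]
    _ ≤ 3 ^ q * (b x ^ q * (C₁ * heightPow (-α) x) + C₂ * b x ^ q * heightPow (-α) x +
          C₃ ^ q * b x ^ q * (C₄ * heightPow (-α) x)) := by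
        gcongr
        · exact h₁ x hx
        · refine (h₂ a κ ha ham hκ hκt x hx).trans ?_
          gcongr
    _ = _ := by ring

/-- The majorant is bounded on `L^p(upperDomain n)`, with a bound proportional to `κ`. In the second
half of the Schur test the kernel is integrated in `x`, against the power of the oscillation at `x`
left by the first half. -/
theorem exists_lintegral_majorant_rpow_le {p : ℝ} (hp : 1 < p) :
    ∃ C : ℝ≥0∞, C ≠ ⊤ ∧ ∀ (a : ParaSpace n → ℝ) (κ : ℝ≥0∞), BoxBMO a κ → Measurable a → κ ≠ 0 →
      κ ≠ ⊤ → ∀ f : ParaSpace n → ℝ≥0∞, Measurable f →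
      ∫⁻ x in upperDomain n, majorant a κ f x ^ p ≤ C * κ ^ p * ∫⁻ y in upperDomain n, f y ^ p := by
  have hp0 : 0 < p := by linarith
  have hconj := Real.HolderConjugate.conjExponent hp
  set q := p.conjExponent with hq
  have hq1 : 1 < q := hconj.symm.lt
  have hq0 : 0 < q := by linarith
  -- the first half of the test uses the weight exponent `α ≤ 1/2`, the second `γ = α(p - 1) < 1`
  set α : ℝ := 1 / (2 * p) with hα
  have hα0 : 0 < α := by positivity
  have hα1 : α ≤ 1 / 2 := by
    rw [hα]
    exact one_div_le_one_div_of_le (by norm_num) (by linarith)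
  set γ : ℝ := α * (p / q) with hγ
  have hγ0 : 0 < γ := by positivity
  have hpq : p / q = p - 1 := by
    rw [hq, Real.conjExponent]
    have : p - 1 ≠ 0 := by linarith
    field_simp
  have hγ1 : γ < 1 := by
    rw [hγ, hpq, hα, one_div, inv_mul_lt_iff₀ (by positivity)]
    linarith
  obtain ⟨C₁, hC₁, h₁⟩ := exists_lintegral_majorant_kernel_le (n := n) hα0 hα1 hq1
  obtain ⟨C₂, hC₂, h₂⟩ := exists_lintegral_reflKernel_osc_le (n := n) hγ0 hγ1 hp.le
  have hpq0 : 0 ≤ p / q := by positivity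
  refine ⟨C₁ ^ (p / q) * C₂, ENNReal.mul_ne_top (ENNReal.rpow_ne_top_of_nonneg hpq0 hC₁) hC₂, ?_⟩
  intro a κ ha ham hκ hκt f hf
  have hQ : MeasurableSet (upperDomain n) := measurableSet_upperDomain
  set b : ParaSpace n → ℝ≥0∞ := fun y => κ + ‖a y - whitneyMean a y‖ₑ with hb
  have hbm : Measurable b := (ham.sub (measurable_whitneyMean a)).enorm.const_add κ
  have hpt : ∀ x ∈ upperDomain n, majorant a κ f x ^ p ≤
      C₁ ^ (p / q) * ∫⁻ y in upperDomain n,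
        (reflKernel x y * heightPow (-γ) x * b x ^ p) * (heightPow γ y * f y ^ p) := by
    intro x hx
    have hG : Measurable fun y => κ + ‖a x - a y‖ₑ := (ham.const_sub (a x)).enorm.const_add κ
    have hkm : Measurable fun y => reflKernel x y := by fun_prop
    set F : ParaSpace n → ℝ≥0∞ := fun y =>
      reflKernel x y ^ (1 / p) * (heightPow (α / q) y * f y) with hF
    set G : ParaSpace n → ℝ≥0∞ := fun y =>
      reflKernel x y ^ (1 / q) * (heightPow (-(α / q)) y * (κ + ‖a x - a y‖ₑ)) with hGdef
    have hFm : Measurable F :=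
      (hkm.pow_const _).mul ((measurable_heightPow _).mul hf)
    have hGm : Measurable G :=
      (hkm.pow_const _).mul ((measurable_heightPow _).mul hG)
    have hFG : majorant a κ f x = ∫⁻ y in upperDomain n, (F * G) y := by
      rw [majorant]
      refine setLIntegral_congr_fun hQ fun y hy => ?_
      have e1 : reflKernel x y ^ (1 / p) * reflKernel x y ^ (1 / q) = reflKernel x y := by
        rw [← ENNReal.rpow_add_of_nonneg _ _ (by positivity) (by positivity), one_div, one_div,
          hconj.inv_add_inv_eq_one, ENNReal.rpow_one]
      have e2 : heightPow (α / q) y * heightPow (-(α / q)) y = 1 := by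
        rw [← heightPow_add hy, add_neg_cancel, heightPow_zero]
      calc reflKernel x y * (κ + ‖a x - a y‖ₑ) * f y
          = (reflKernel x y ^ (1 / p) * reflKernel x y ^ (1 / q)) *
            (heightPow (α / q) y * heightPow (-(α / q)) y) * (κ + ‖a x - a y‖ₑ) * f y := by
            rw [e1, e2, mul_one]
        _ = _ := by simp only [hF, hGdef, Pi.mul_apply]; ring
    have hFp : ∫⁻ y in upperDomain n, F y ^ p =
        ∫⁻ y in upperDomain n, reflKernel x y * (heightPow γ y * f y ^ p) := by
      refine setLIntegral_congr_fun hQ fun y hy => ?_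
      simp only [hF]
      rw [ENNReal.mul_rpow_of_nonneg _ _ hp0.le, ENNReal.mul_rpow_of_nonneg _ _ hp0.le,
        ← ENNReal.rpow_mul, one_div_mul_cancel hp0.ne', ENNReal.rpow_one,
        heightPow_rpow hy _ hp0.le]
      congr 3
      rw [hγ]
      ring
    have hGq : ∫⁻ y in upperDomain n, G y ^ q ≤ C₁ * heightPow (-α) x * b x ^ q := by
      refine le_trans (le_of_eq ?_) (h₁ a κ ha ham hκ hκt x hx)
      refine setLIntegral_congr_fun hQ fun y hy => ?_
      simp only [hGdef]
      rw [ENNReal.mul_rpow_of_nonneg _ _ hq0.le, ENNReal.mul_rpow_of_nonneg _ _ hq0.le,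
        ← ENNReal.rpow_mul, one_div_mul_cancel hq0.ne', ENNReal.rpow_one,
        heightPow_rpow hy _ hq0.le, neg_mul, div_mul_cancel₀ _ hq0.ne', mul_assoc]
    have hHold := ENNReal.lintegral_mul_le_Lp_mul_Lq (volume.restrict (upperDomain n)) hconj
      hFm.aemeasurable hGm.aemeasurable
    calc majorant a κ f x ^ p
        ≤ ((∫⁻ y in upperDomain n, F y ^ p) ^ (1 / p) *
            (∫⁻ y in upperDomain n, G y ^ q) ^ (1 / q)) ^ p := by
          rw [hFG]
          gcongr
      _ = (∫⁻ y in upperDomain n, F y ^ p) * (∫⁻ y in upperDomain n, G y ^ q) ^ (p / q) := by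
          rw [ENNReal.mul_rpow_of_nonneg _ _ hp0.le, ← ENNReal.rpow_mul, ← ENNReal.rpow_mul,
            one_div_mul_cancel hp0.ne', ENNReal.rpow_one, one_div_mul_eq_div]
      _ ≤ (∫⁻ y in upperDomain n, reflKernel x y * (heightPow γ y * f y ^ p)) *
            (C₁ * heightPow (-α) x * b x ^ q) ^ (p / q) := by
          rw [hFp]
          gcongr
      _ = C₁ ^ (p / q) * ((heightPow (-γ) x * b x ^ p) *
            ∫⁻ y in upperDomain n, reflKernel x y * (heightPow γ y * f y ^ p)) := by
          rw [ENNReal.mul_rpow_of_nonneg _ _ hpq0, ENNReal.mul_rpow_of_nonneg _ _ hpq0,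
            heightPow_rpow hx _ hpq0, ← ENNReal.rpow_mul, mul_div_cancel₀ _ hq0.ne', neg_mul, ← hγ]
          ring
      _ = _ := by
          have m1 : Measurable fun y => reflKernel x y * (heightPow γ y * f y ^ p) :=
            hkm.mul ((measurable_heightPow γ).mul (hf.pow_const p))
          rw [← lintegral_const_mul _ m1]
          congr 2
          funext y
          ring
  have hjm : Measurable fun z : ParaSpace n × ParaSpace n =>
      (reflKernel z.1 z.2 * heightPow (-γ) z.1 * b z.1 ^ p) * (heightPow γ z.2 * f z.2 ^ p) := by
    have m1 : Measurable fun z : ParaSpace n × ParaSpace n => reflKernel z.1 z.2 := by fun_prop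
    exact ((m1.mul ((measurable_heightPow _).comp measurable_fst)).mul
      ((hbm.comp measurable_fst).pow_const p)).mul
      (((measurable_heightPow _).comp measurable_snd).mul ((hf.comp measurable_snd).pow_const p))
  calc ∫⁻ x in upperDomain n, majorant a κ f x ^ p
      ≤ ∫⁻ x in upperDomain n, C₁ ^ (p / q) * ∫⁻ y in upperDomain n,
          (reflKernel x y * heightPow (-γ) x * b x ^ p) * (heightPow γ y * f y ^ p) :=
        setLIntegral_mono' hQ hpt
    _ = C₁ ^ (p / q) * ∫⁻ x in upperDomain n, ∫⁻ y in upperDomain n,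
          (reflKernel x y * heightPow (-γ) x * b x ^ p) * (heightPow γ y * f y ^ p) :=
        lintegral_const_mul _ hjm.lintegral_prod_right'
    _ = C₁ ^ (p / q) * ∫⁻ y in upperDomain n, ∫⁻ x in upperDomain n,
          (reflKernel x y * heightPow (-γ) x * b x ^ p) * (heightPow γ y * f y ^ p) := by
        rw [lintegral_lintegral_swap hjm.aemeasurable]
    _ ≤ C₁ ^ (p / q) * ∫⁻ y in upperDomain n, C₂ * κ ^ p * f y ^ p := by
        gcongr 1
        refine setLIntegral_mono' hQ fun y hy => ?_
        have m1 : Measurable fun x => reflKernel x y * heightPow (-γ) x * b x ^ p := by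
          have : Measurable fun x : ParaSpace n => reflKernel x y * heightPow (-γ) x := by fun_prop
          exact this.mul (hbm.pow_const p)
        rw [lintegral_mul_const _ m1]
        calc (∫⁻ x in upperDomain n, reflKernel x y * heightPow (-γ) x * b x ^ p) *
              (heightPow γ y * f y ^ p)
            ≤ (C₂ * κ ^ p * heightPow (-γ) y) * (heightPow γ y * f y ^ p) := by
              gcongr
              simp_rw [fun x => reflKernel_comm x y]
              exact h₂ a κ ha ham hκ hκt y hy
          _ = C₂ * κ ^ p * f y ^ p * (heightPow (-γ) y * heightPow γ y) := by ring
          _ = _ := by rw [← heightPow_add hy, neg_add_cancel, heightPow_zero, mul_one]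
    _ = _ := by
        rw [lintegral_const_mul _ (hf.pow_const p)]
        ring

end Schur

/-! ### The majorant operator on Morrey spaces -/

section Morrey

variable {n : ℕ}

theorem exists_mem_paraCylinder_four_pow (x y : ParaSpace n) {r : ℝ} (hr : 0 < r) :
    ∃ k : ℕ, y ∈ paraCylinder x (4 ^ k * r) := by
  obtain ⟨k, hk⟩ := pow_unbounded_of_one_lt
    (max (spatialNorm (x - y)) (1 + |x (Fin.last n) - y (Fin.last n)|) / r)
    (show (1 : ℝ) < 4 by norm_num)
  rw [div_lt_iff₀ hr] at hk
  have h1 := (le_max_left _ _).trans_lt hk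
  have h2 := (le_max_right _ _).trans_lt hk
  have h3 := abs_nonneg (x (Fin.last n) - y (Fin.last n))
  refine ⟨k, h1, ?_⟩
  nlinarith

/-- The essential infimum `ess inf_{s < ζ < ∞} φ(x, ζ) ζ^{(n+2)/p}`. -/
noncomputable def weightInf (p : ℝ) (φ : ParaSpace n → ℝ → ℝ) (x : ParaSpace n) (s : ℝ) : ℝ≥0∞ :=
  essInf (fun ζ : ℝ => ENNReal.ofReal (φ x ζ * ζ ^ (((n : ℝ) + 2) / p)))
    (volume.restrict (Set.Ioi s))

theorem weightInf_mono (p : ℝ) (φ : ParaSpace n → ℝ → ℝ) (x : ParaSpace n) {s t : ℝ} (h : s ≤ t) :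
    weightInf p φ x s ≤ weightInf p φ x t :=
  essInf_antitone_measure (Measure.restrict_mono (Set.Ioi_subset_Ioi h) le_rfl).absolutelyContinuous

/-- The weight condition in discrete form. The `k`-th term is compared with the integral over
`(4^{k+1} r, 4^{k+2} r]`, where the essential infimum is at least as large and the logarithm is at
least `k`. -/
theorem IsMorreyWeight.exists_tsum_le {p : ℝ} (hp : 1 < p) {φ : ParaSpace n → ℝ → ℝ}
    (hφ : IsMorreyWeight p φ) :
    ∃ C : ℝ≥0∞, C ≠ ⊤ ∧ ∀ (x : ParaSpace n) (r : ℝ), 0 < r →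
      ∑' k : ℕ, (k + 1 : ℕ) * (weightInf p φ x (4 ^ (k + 1) * r) *
        ENNReal.ofReal ((4 ^ k * r) ^ (-((n + 2 : ℝ) / p)))) ≤ C * ENNReal.ofReal (φ x r) := by
  obtain ⟨C₀, hC₀⟩ := hφ.integral_le
  set β : ℝ := ((n : ℝ) + 2) / p with hβ
  have hβ0 : 0 < β := by positivity
  refine ⟨ENNReal.ofReal (4 / 3 * 16 ^ β) * ENNReal.ofReal |C₀|, by finiteness, fun x r hr => ?_⟩
  set g : ℝ → ℝ≥0∞ := fun s => ENNReal.ofReal (1 + Real.log (s / r)) *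
    (weightInf p φ x s / ENNReal.ofReal (s ^ (β + 1))) with hg
  set I : ℕ → Set ℝ := fun k => Set.Ioc (4 ^ (k + 1) * r) (4 ^ (k + 1 + 1) * r) with hI
  have hIm : ∀ k, MeasurableSet (I k) := fun k => measurableSet_Ioc
  have hId : Pairwise (Function.onFun Disjoint I) := by
    have hmono : Monotone fun k : ℕ => (4 : ℝ) ^ (k + 1) * r := by
      intro i j hij
      have : (4 : ℝ) ^ (i + 1) ≤ 4 ^ (j + 1) := pow_le_pow_right₀ (by norm_num) (by omega)
      exact mul_le_mul_of_nonneg_right this hr.le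
    exact hmono.pairwise_disjoint_on_Ioc_succ
  have hIsub : ⋃ k, I k ⊆ Set.Ioi r := by
    refine Set.iUnion_subset fun k s hs => ?_
    refine lt_of_le_of_lt ?_ hs.1
    exact le_mul_of_one_le_left hr.le (one_le_pow₀ (by norm_num))
  have hterm : ∀ k : ℕ, (k + 1 : ℕ) * (weightInf p φ x (4 ^ (k + 1) * r) *
        ENNReal.ofReal ((4 ^ k * r) ^ (-β))) ≤
      ENNReal.ofReal (4 / 3 * 16 ^ β) * ∫⁻ s in I k, g s := by
    intro k
    set R : ℝ := 4 ^ k * r with hR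
    have hR0 : 0 < R := by positivity
    have e1 : (4 : ℝ) ^ (k + 1) * r = 4 * R := by rw [hR, pow_succ]; ring
    have e2 : (4 : ℝ) ^ (k + 1 + 1) * r = 16 * R := by rw [hR, pow_succ, pow_succ]; ring
    set w := weightInf p φ x (4 * R) with hw
    have hlow : ∀ s ∈ I k, (k + 1 : ℕ) * (w * ENNReal.ofReal ((16 * R) ^ (-(β + 1)))) ≤ g s := by
      intro s hs
      simp only [hI, e1, e2] at hs
      have hs0 : 0 < s := by linarith [hs.1]
      have hlog : ((k + 1 : ℕ) : ℝ) ≤ 1 + Real.log (s / r) := by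
        have h1 : (4 : ℝ) ^ k ≤ s / r := by
          rw [le_div_iff₀ hr]
          linarith [hs.1]
        have h2 : Real.log (4 ^ k) ≤ Real.log (s / r) := Real.log_le_log (by positivity) h1
        have h3 : (1 : ℝ) ≤ Real.log 4 := by
          rw [show (4 : ℝ) = 2 ^ 2 by norm_num, Real.log_pow]
          have := Real.log_two_gt_d9
          push_cast
          linarith
        rw [Real.log_pow] at h2
        push_cast
        have : (k : ℝ) * 1 ≤ k * Real.log 4 := by gcongr
        linarith
      simp only [hg]
      rw [div_eq_mul_inv (weightInf p φ x s), ← ENNReal.ofReal_inv_of_pos (by positivity),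
        ← Real.rpow_neg hs0.le]
      gcongr ?_ * (?_ * ENNReal.ofReal ?_)
      · rw [← ENNReal.ofReal_natCast]
        exact ENNReal.ofReal_le_ofReal hlog
      · exact weightInf_mono p φ x hs.1.le
      · exact Real.rpow_le_rpow_of_nonpos hs0 hs.2 (by linarith)
    have hvol : volume (I k) = ENNReal.ofReal (12 * R) := by
      rw [hI, Real.volume_Ioc, e1, e2]
      congr 1
      ring
    calc (k + 1 : ℕ) * (weightInf p φ x (4 ^ (k + 1) * r) * ENNReal.ofReal (R ^ (-β)))
        = ENNReal.ofReal (4 / 3 * 16 ^ β) *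
            ((k + 1 : ℕ) * (w * ENNReal.ofReal ((16 * R) ^ (-(β + 1)))) * volume (I k)) := by
          rw [e1, hvol, ← hw]
          have e3 : R ^ (-β) = 4 / 3 * 16 ^ β * ((16 * R) ^ (-(β + 1)) * (12 * R)) := by
            rw [neg_add, Real.rpow_add (by positivity), Real.rpow_neg_one,
              Real.mul_rpow (by norm_num) hR0.le, Real.rpow_neg (by norm_num : (0 : ℝ) ≤ 16)]
            field_simp
            ring
          rw [e3, ENNReal.ofReal_mul (by positivity),
            ENNReal.ofReal_mul (p := (16 * R) ^ (-(β + 1))) (by positivity)]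
          ring
      _ ≤ _ := by
          gcongr
          rw [← setLIntegral_const]
          exact setLIntegral_mono' (hIm k) hlow
  calc _ ≤ ∑' k, ENNReal.ofReal (4 / 3 * 16 ^ β) * ∫⁻ s in I k, g s := ENNReal.tsum_le_tsum hterm
    _ = ENNReal.ofReal (4 / 3 * 16 ^ β) * ∫⁻ s in ⋃ k, I k, g s := by
        rw [ENNReal.tsum_mul_left, lintegral_iUnion hIm hId]
    _ ≤ ENNReal.ofReal (4 / 3 * 16 ^ β) * ∫⁻ s in Set.Ioi r, g s := by
        gcongr
    _ ≤ ENNReal.ofReal (4 / 3 * 16 ^ β) * ENNReal.ofReal (C₀ * φ x r) := by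
        gcongr
        exact hC₀ x r hr
    _ ≤ ENNReal.ofReal (4 / 3 * 16 ^ β) * ENNReal.ofReal (|C₀| * φ x r) := by
        have := hφ.pos x r hr
        gcongr
        exact le_abs_self _
    _ = _ := by
        rw [ENNReal.ofReal_mul (abs_nonneg _)]
        ring

variable [NeZero n]

/-- The set `D_r(x)`, the part of the cylinder of radius `r` that lies in the domain. -/
def domainCylinder (x : ParaSpace n) (r : ℝ) : Set (ParaSpace n) := upperDomain n ∩ paraCylinder x r

theorem measurableSet_domainCylinder (x : ParaSpace n) (r : ℝ) :
    MeasurableSet (domainCylinder x r) :=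
  measurableSet_upperDomain.inter (measurableSet_paraCylinder x r)

theorem domainCylinder_mono (x : ParaSpace n) {r s : ℝ} (hr : 0 ≤ r) (hrs : r ≤ s) :
    domainCylinder x r ⊆ domainCylinder x s :=
  Set.inter_subset_inter_right _ (paraCylinder_mono x hr hrs)

/-- The `L^p` norm over `D_r(x)`. -/
noncomputable def localLp (p : ℝ) (f : ParaSpace n → ℝ≥0∞) (x : ParaSpace n) (r : ℝ) : ℝ≥0∞ :=
  (∫⁻ y in domainCylinder x r, f y ^ p) ^ (1 / p)

theorem measurable_majorant {a : ParaSpace n → ℝ} (ha : Measurable a) (κ : ℝ≥0∞)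
    {f : ParaSpace n → ℝ≥0∞} (hf : Measurable f) : Measurable (majorant a κ f) := by
  have h : Measurable fun z : ParaSpace n × ParaSpace n =>
      reflKernel z.1 z.2 * (κ + ‖a z.1 - a z.2‖ₑ) * f z.2 := by
    have m1 : Measurable fun z : ParaSpace n × ParaSpace n => reflKernel z.1 z.2 := by fun_prop
    exact (m1.mul ((((ha.comp measurable_fst).sub (ha.comp measurable_snd)).enorm).const_add κ)).mul
      (hf.comp measurable_snd)
  exact h.lintegral_prod_right'

/-- Points of `D_r(x₀)` are at distance at least `R / 2` from the points of the domain outside of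
`D_R(x₀)`. -/
theorem half_le_reflDist {x₀ x y : ParaSpace n} {r R : ℝ} (hr : 0 < r) (hR : 4 * r ≤ R)
    (hx : x ∈ domainCylinder x₀ r) (hy : y ∈ upperDomain n) (hyR : y ∉ paraCylinder x₀ R) :
    R / 2 ≤ reflDist x y := by
  have h1 := spatialNorm_nonneg (x - y)
  have h2 := Real.sqrt_nonneg |x (Fin.last n) - y (Fin.last n)|
  have h3 := height_pos hy
  have h4 := height_pos hx.1
  have h5 : R / 2 ≤ spatialNorm (x - y) ∨ R / 2 ≤ √|x (Fin.last n) - y (Fin.last n)| := by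
    rcases not_and_or.1 hyR with h | h
    · left
      have h6 := spatialNorm_add_le (x₀ - x) (x - y)
      rw [sub_add_sub_cancel] at h6
      have h7 := hx.2.1
      linarith
    · right
      refine Real.le_sqrt_of_sq_le ?_
      have h6 := abs_sub_le (x₀ (Fin.last n)) (x (Fin.last n)) (y (Fin.last n))
      have h7 := hx.2.2
      nlinarith
  unfold reflDist
  rcases h5 with h | h <;> linarith

/-- The averages over the boxes at the scales `4 ^ k r` drift at most linearly in `k`. -/
theorem BoxBMO.enorm_average_four_pow_sub_le {a : ParaSpace n → ℝ} {κ : ℝ≥0∞} (ha : BoxBMO a κ)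
    (ham : Measurable a) (hκ : κ ≠ 0) (hκt : κ ≠ ⊤) {x₀ : ParaSpace n} (hx₀ : x₀ ∈ upperDomain n)
    {r : ℝ} (hr : 0 < r) (k : ℕ) :
    ‖(⨍ z in paraBox (domainCorner x₀ r) (2 * r), a z) -
      ⨍ z in paraBox (domainCorner x₀ (4 ^ k * r)) (2 * (4 ^ k * r)), a z‖ₑ ≤
      k * (boxJN n 2 ^ (1 / 2 : ℝ) * ENNReal.ofReal (4 ^ ((n + 2 : ℝ) / 2)) * κ) := by
  induction k with
  | zero => simp
  | succ k ih =>
    have hRk : 0 < 4 ^ k * r := by positivity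
    have h1 := ha.enorm_average_sub_le ham hκ hκt (q := 2) (by norm_num)
      (ℓ₁ := 2 * (4 ^ k * r)) (ℓ₂ := 2 * (4 ^ (k + 1) * r)) (by positivity) (by positivity)
      (domainCorner_cornerInDomain x₀ (4 ^ k * r))
      (domainCorner_cornerInDomain x₀ (4 ^ (k + 1) * r))
      (paraBox_domainCorner_mono hx₀ hRk.le (by rw [pow_succ]; linarith))
    have h2 : 2 * (4 ^ (k + 1) * r) / (2 * (4 ^ k * r)) = 4 := by
      rw [pow_succ]
      field_simp
    rw [h2] at h1
    set c₀ := ⨍ z in paraBox (domainCorner x₀ r) (2 * r), a z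
    set c₁ := ⨍ z in paraBox (domainCorner x₀ (4 ^ k * r)) (2 * (4 ^ k * r)), a z
    set c₂ := ⨍ z in paraBox (domainCorner x₀ (4 ^ (k + 1) * r)) (2 * (4 ^ (k + 1) * r)), a z
    calc ‖c₀ - c₂‖ₑ = ‖(c₀ - c₁) + (c₁ - c₂)‖ₑ := by congr 1; ring
      _ ≤ ‖c₀ - c₁‖ₑ + ‖c₁ - c₂‖ₑ := enorm_add_le _ _
      _ ≤ _ := add_le_add ih h1
      _ = _ := by push_cast; ring

/-- The contribution to the majorant of a shell at distance `4 ^ k r`. The factor `k + 1` comes from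
the drift of the averages of `a` between the scales `r` and `4 ^ (k + 1) r`. -/
theorem exists_lintegral_shell_le {p : ℝ} (hp : 1 < p) :
    ∃ C : ℝ≥0∞, C ≠ ⊤ ∧ ∀ (a : ParaSpace n → ℝ) (κ : ℝ≥0∞), BoxBMO a κ → Measurable a → κ ≠ 0 →
      κ ≠ ⊤ → ∀ f : ParaSpace n → ℝ≥0∞, Measurable f → ∀ x₀ ∈ upperDomain n, ∀ r : ℝ, 0 < r →
      ∀ x ∈ domainCylinder x₀ r, ∀ k : ℕ, 1 ≤ k →
      ∫⁻ y in domainCylinder x₀ (4 ^ (k + 1) * r) \ domainCylinder x₀ (4 ^ k * r),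
        reflKernel x y * (κ + ‖a x - a y‖ₑ) * f y ≤
      C * (κ + ‖a x - ⨍ z in paraBox (domainCorner x₀ r) (2 * r), a z‖ₑ) *
        ((k + 1 : ℕ) * (localLp p f x₀ (4 ^ (k + 1) * r) *
          ENNReal.ofReal ((4 ^ k * r) ^ (-((n + 2 : ℝ) / p))))) := by
  have hp0 : 0 < p := by linarith
  have hconj := Real.HolderConjugate.conjExponent hp
  set q := p.conjExponent with hq
  have hq1 : 1 < q := hconj.symm.lt
  have hq0 : 0 < q := by linarith
  set C₅ : ℝ≥0∞ := boxJN n 2 ^ (1 / 2 : ℝ) * ENNReal.ofReal (4 ^ ((n + 2 : ℝ) / 2)) with hC₅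
  have hC₅t : C₅ ≠ ⊤ := ENNReal.mul_ne_top
    (ENNReal.rpow_ne_top_of_nonneg (by norm_num) (boxJN_ne_top (by norm_num))) ENNReal.ofReal_ne_top
  set J : ℝ≥0∞ := shiftJN n q ^ (1 / q) with hJ
  have hJt : J ≠ ⊤ := ENNReal.rpow_ne_top_of_nonneg (by positivity) (shiftJN_ne_top hq1.le)
  refine ⟨ENNReal.ofReal (2 ^ (n + 2 : ℝ) * 8 ^ ((n + 2 : ℝ) / q)) * (1 + C₅ + J),
    by finiteness, ?_⟩
  intro a κ ha ham hκ hκt f hf x₀ hx₀ r hr x hx k hk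
  set R := 4 ^ k * r with hR
  have hR0 : 0 < R := by positivity
  have hR' : 4 ^ (k + 1) * r = 4 * R := by rw [hR, pow_succ]; ring
  have hR4 : 4 * r ≤ R := by
    rw [hR]
    gcongr
    exact le_self_pow₀ (by norm_num) (by omega)
  set c₀ := ⨍ z in paraBox (domainCorner x₀ r) (2 * r), a z with hc₀
  set B := paraBox (domainCorner x₀ (4 ^ (k + 1) * r)) (2 * (4 ^ (k + 1) * r)) with hB
  set c := ⨍ z in B, a z with hc
  set b := κ + ‖a x - c₀‖ₑ with hb
  set D := domainCylinder x₀ (4 ^ (k + 1) * r) with hD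
  have hDB : D ⊆ B := inter_paraCylinder_subset_paraBox x₀ (by positivity)
  have hDm : MeasurableSet D := measurableSet_domainCylinder _ _
  have hκb : κ ≤ b := le_self_add
  have hosc : ‖c₀ - c‖ₑ ≤ (k + 1 : ℕ) * (C₅ * κ) :=
    ha.enorm_average_four_pow_sub_le ham hκ hκt hx₀ hr (k + 1)
  have hgm : Measurable fun y => κ + ‖a y - c‖ₑ := (ham.sub_const c).enorm.const_add κ
  have hvolB : volume B ^ (1 / q) =
      ENNReal.ofReal (8 ^ ((n + 2 : ℝ) / q) * R ^ ((n + 2 : ℝ) / q)) := by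
    rw [hB, volume_paraBox _ (by positivity), hR', ENNReal.ofReal_rpow_of_nonneg (by positivity)
      (by positivity), ← Real.rpow_natCast, ← Real.rpow_mul (by positivity),
      ← Real.mul_rpow (by norm_num) hR0.le]
    congr 1
    push_cast
    rw [mul_one_div]
    congr 1
    ring
  have hI1 : ∫⁻ y in D, f y ≤ localLp p f x₀ (4 ^ (k + 1) * r) * volume B ^ (1 / q) := by
    refine (setLIntegral_le_Lp_mul hf hconj).trans ?_
    rw [localLp]
    gcongr
  have hI2 : ∫⁻ y in D, (κ + ‖a y - c‖ₑ) * f y ≤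
      localLp p f x₀ (4 ^ (k + 1) * r) * (J * κ * volume B ^ (1 / q)) := by
    have h1 := ENNReal.lintegral_mul_le_Lp_mul_Lq (volume.restrict D) hconj
      hf.aemeasurable hgm.aemeasurable
    have h2 : (∫⁻ y in D, (κ + ‖a y - c‖ₑ) ^ q) ^ (1 / q) ≤ J * κ * volume B ^ (1 / q) := by
      calc (∫⁻ y in D, (κ + ‖a y - c‖ₑ) ^ q) ^ (1 / q)
          ≤ (shiftJN n q * κ ^ q * volume B) ^ (1 / q) := by
            refine ENNReal.rpow_le_rpow ((lintegral_mono_set hDB).trans ?_) (by positivity)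
            exact ha.lintegral_add_rpow_le ham hκ hκt hq1.le (by positivity)
              (domainCorner_cornerInDomain _ _)
        _ = _ := by
            rw [ENNReal.mul_rpow_of_nonneg _ _ (by positivity),
              ENNReal.mul_rpow_of_nonneg _ _ (by positivity), ← ENNReal.rpow_mul,
              mul_one_div_cancel hq0.ne', ENNReal.rpow_one]
    calc ∫⁻ y in D, (κ + ‖a y - c‖ₑ) * f y = ∫⁻ y in D, (f * fun y => κ + ‖a y - c‖ₑ) y := by
          refine lintegral_congr fun y => ?_
          simp [mul_comm]
      _ ≤ _ := h1
      _ ≤ _ := by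
          rw [localLp]
          gcongr
  have hk1 : (1 : ℝ≥0∞) ≤ (k + 1 : ℕ) := by exact_mod_cast Nat.le_add_left 1 k
  set F := localLp p f x₀ (4 ^ (k + 1) * r) with hF
  calc ∫⁻ y in D \ domainCylinder x₀ R, reflKernel x y * (κ + ‖a x - a y‖ₑ) * f y
      ≤ ∫⁻ y in D \ domainCylinder x₀ R, ENNReal.ofReal ((R / 2) ^ (-(n + 2 : ℝ))) *
          ((b + (k + 1 : ℕ) * (C₅ * κ)) * f y + (κ + ‖a y - c‖ₑ) * f y) := by
        refine setLIntegral_mono' (hDm.diff (measurableSet_domainCylinder _ _)) fun y hy => ?_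
        rw [mul_assoc, ← add_mul]
        have hyQ : y ∈ upperDomain n := hy.1.1
        refine mul_le_mul' (ENNReal.ofReal_le_ofReal ?_) (mul_le_mul' ?_ le_rfl)
        · refine Real.rpow_le_rpow_of_nonpos (by positivity) ?_ ?_
          · exact half_le_reflDist hr hR4 hx hyQ fun h => hy.2 ⟨hyQ, h⟩
          · have : (0 : ℝ) ≤ n := n.cast_nonneg
            linarith
        · calc κ + ‖a x - a y‖ₑ = κ + ‖(a x - c₀) + ((c₀ - c) - (a y - c))‖ₑ := by
                congr 2; ring
            _ ≤ κ + (‖a x - c₀‖ₑ + (‖c₀ - c‖ₑ + ‖a y - c‖ₑ)) := by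
                gcongr
                exact (enorm_add_le _ _).trans (by gcongr; exact enorm_sub_le)
            _ ≤ κ + (‖a x - c₀‖ₑ + ((k + 1 : ℕ) * (C₅ * κ) + ‖a y - c‖ₑ)) := by gcongr
            _ = b + (k + 1 : ℕ) * (C₅ * κ) + ‖a y - c‖ₑ := by rw [hb]; ring
            _ ≤ b + (k + 1 : ℕ) * (C₅ * κ) + (κ + ‖a y - c‖ₑ) := by
                gcongr
                exact le_add_self
    _ ≤ ∫⁻ y in D, ENNReal.ofReal ((R / 2) ^ (-(n + 2 : ℝ))) *
          ((b + (k + 1 : ℕ) * (C₅ * κ)) * f y + (κ + ‖a y - c‖ₑ) * f y) :=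
        lintegral_mono_set Set.sdiff_subset
    _ = ENNReal.ofReal ((R / 2) ^ (-(n + 2 : ℝ))) *
          ((b + (k + 1 : ℕ) * (C₅ * κ)) * (∫⁻ y in D, f y) +
            ∫⁻ y in D, (κ + ‖a y - c‖ₑ) * f y) := by
        have m1 : Measurable fun y => (κ + ‖a y - c‖ₑ) * f y := hgm.mul hf
        have m2 : Measurable fun y => (b + (k + 1 : ℕ) * (C₅ * κ)) * f y := hf.const_mul _
        have m3 : Measurable fun y => (b + (k + 1 : ℕ) * (C₅ * κ)) * f y + (κ + ‖a y - c‖ₑ) * f y :=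
          m2.add m1
        rw [lintegral_const_mul _ m3, lintegral_add_right _ m1, lintegral_const_mul _ hf]
    _ ≤ ENNReal.ofReal ((R / 2) ^ (-(n + 2 : ℝ))) *
          (((k + 1 : ℕ) * b + (k + 1 : ℕ) * (C₅ * b)) * (F * volume B ^ (1 / q)) +
            (k + 1 : ℕ) * (F * (J * b * volume B ^ (1 / q)))) := by
        gcongr
        · exact le_mul_of_one_le_left' hk1
        · refine hI2.trans ?_
          refine le_trans ?_ (le_mul_of_one_le_left' hk1)
          gcongr
    _ = (1 + C₅ + J) * b * ((k + 1 : ℕ) * (F *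
          (ENNReal.ofReal ((R / 2) ^ (-(n + 2 : ℝ))) * volume B ^ (1 / q)))) := by ring
    _ = _ := by
        have e1 : ENNReal.ofReal ((R / 2) ^ (-(n + 2 : ℝ))) * volume B ^ (1 / q) =
            ENNReal.ofReal (2 ^ (n + 2 : ℝ) * 8 ^ ((n + 2 : ℝ) / q)) *
              ENNReal.ofReal (R ^ (-((n + 2 : ℝ) / p))) := by
          rw [hvolB, ← ENNReal.ofReal_mul (by positivity), ← ENNReal.ofReal_mul (by positivity)]
          congr 1
          have e2 : -((n + 2 : ℝ) / p) = -(n + 2 : ℝ) + (n + 2) / q := by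
            have := hconj.inv_add_inv_eq_one
            have e3 : q⁻¹ = 1 - p⁻¹ := by linarith
            rw [div_eq_mul_inv, div_eq_mul_inv, e3]
            ring
          rw [e2, Real.rpow_add hR0, Real.div_rpow hR0.le (by norm_num),
            Real.rpow_neg (by norm_num : (0 : ℝ) ≤ 2)]
          field_simp
        rw [e1]
        ring

/-- The local estimate for the majorant: near points are controlled by the `L^p` bound, far ones by
shells. -/
theorem exists_localLp_majorant_le {p : ℝ} (hp : 1 < p) :
    ∃ C : ℝ≥0∞, C ≠ ⊤ ∧ ∀ (a : ParaSpace n → ℝ) (κ : ℝ≥0∞), BoxBMO a κ → Measurable a → κ ≠ 0 →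
      κ ≠ ⊤ → ∀ f : ParaSpace n → ℝ≥0∞, Measurable f → ∀ x₀ ∈ upperDomain n, ∀ r : ℝ, 0 < r →
      localLp p (majorant a κ f) x₀ r ≤ C * κ * ENNReal.ofReal (r ^ ((n + 2 : ℝ) / p)) *
        ∑' k : ℕ, (k + 1 : ℕ) * (localLp p f x₀ (4 ^ (k + 1) * r) *
          ENNReal.ofReal ((4 ^ k * r) ^ (-((n + 2 : ℝ) / p)))) := by
  have hp0 : 0 < p := by linarith
  obtain ⟨C₁, hC₁, h₁⟩ := exists_lintegral_majorant_rpow_le (n := n) hp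
  obtain ⟨C₂, hC₂, h₂⟩ := exists_lintegral_shell_le (n := n) hp
  set J : ℝ≥0∞ := shiftJN n p ^ (1 / p) with hJ
  have hJt : J ≠ ⊤ := ENNReal.rpow_ne_top_of_nonneg (by positivity) (shiftJN_ne_top hp.le)
  have hC₁' : C₁ ^ (1 / p) ≠ ⊤ := ENNReal.rpow_ne_top_of_nonneg (by positivity) hC₁
  refine ⟨C₁ ^ (1 / p) + C₂ * J * ENNReal.ofReal (2 ^ ((n + 2 : ℝ) / p)), by finiteness, ?_⟩
  intro a κ ha ham hκ hκt f hf x₀ hx₀ r hr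
  set term : ℕ → ℝ≥0∞ := fun k => (k + 1 : ℕ) * (localLp p f x₀ (4 ^ (k + 1) * r) *
    ENNReal.ofReal ((4 ^ k * r) ^ (-((n + 2 : ℝ) / p)))) with hterm
  set S := ∑' k, term k with hS
  set D₁ := domainCylinder x₀ (4 ^ 1 * r) with hD₁
  have hD₁m : MeasurableSet D₁ := measurableSet_domainCylinder _ _
  set D := domainCylinder x₀ r with hD
  have hDm : MeasurableSet D := measurableSet_domainCylinder _ _
  set B := paraBox (domainCorner x₀ r) (2 * r) with hB
  have hDB : D ⊆ B := inter_paraCylinder_subset_paraBox x₀ hr.le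
  set c₀ := ⨍ z in B, a z with hc₀
  set f₀ : ParaSpace n → ℝ≥0∞ := D₁.indicator f with hf₀
  have hf₀m : Measurable f₀ := hf.indicator hD₁m
  have hpt : ∀ x ∈ D, majorant a κ f x ≤
      majorant a κ f₀ x + C₂ * S * (κ + ‖a x - c₀‖ₑ) := by
    intro x hx
    set g : ParaSpace n → ℝ≥0∞ := fun y => reflKernel x y * (κ + ‖a x - a y‖ₑ) with hg
    set T : ℕ → Set (ParaSpace n) := fun k =>
      domainCylinder x₀ (4 ^ (k + 1 + 1) * r) \ domainCylinder x₀ (4 ^ (k + 1) * r) with hT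
    have hcov : upperDomain n ⊆ D₁ ∪ ⋃ k, T k := by
      intro y hy
      by_cases hy1 : y ∈ D₁
      · exact Or.inl hy1
      right
      classical
      have hex := exists_mem_paraCylinder_four_pow x₀ y hr
      set m := Nat.find hex with hm
      have hm1 : y ∈ paraCylinder x₀ (4 ^ m * r) := Nat.find_spec hex
      have hm2 : 1 < m := by
        by_contra hcon
        refine hy1 ⟨hy, paraCylinder_mono x₀ (by positivity) ?_ hm1⟩
        gcongr
        · norm_num
        · omega
      obtain ⟨k, hk⟩ : ∃ k, m = k + 1 + 1 := ⟨m - 2, by omega⟩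
      refine Set.mem_iUnion.2 ⟨k, ⟨hy, ?_⟩, fun h => ?_⟩
      · rwa [← hk]
      · exact Nat.find_min hex (show k + 1 < m by omega) h.2
    have hnear : ∫⁻ y in D₁, g y * f y ≤ majorant a κ f₀ x := by
      have hle : ∫⁻ y in D₁, g y * f₀ y ≤ ∫⁻ y in upperDomain n, g y * f₀ y :=
        lintegral_mono_set Set.inter_subset_left
      refine le_trans (le_of_eq ?_) hle
      refine setLIntegral_congr_fun hD₁m fun y hy => ?_
      simp only [hf₀, Set.indicator_of_mem hy]
    calc majorant a κ f x ≤ ∫⁻ y in D₁ ∪ ⋃ k, T k, g y * f y := lintegral_mono_set hcov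
      _ ≤ (∫⁻ y in D₁, g y * f y) + ∫⁻ y in ⋃ k, T k, g y * f y := lintegral_union_le _ _ _
      _ ≤ (∫⁻ y in D₁, g y * f y) + ∑' k, ∫⁻ y in T k, g y * f y := by
          gcongr
          exact lintegral_iUnion_le _ _
      _ ≤ majorant a κ f₀ x + ∑' k, C₂ * (κ + ‖a x - c₀‖ₑ) * term (k + 1) := by
          refine add_le_add hnear (ENNReal.tsum_le_tsum fun k => ?_)
          exact h₂ a κ ha ham hκ hκt f hf x₀ hx₀ r hr x hx (k + 1) (by omega)
      _ ≤ majorant a κ f₀ x + C₂ * (κ + ‖a x - c₀‖ₑ) * S := by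
          rw [ENNReal.tsum_mul_left]
          gcongr
          exact ENNReal.tsum_comp_le_tsum_of_injective Nat.succ_injective term
      _ = _ := by ring
  have hF1 : localLp p f x₀ (4 ^ 1 * r) ≤ ENNReal.ofReal (r ^ ((n + 2 : ℝ) / p)) * S := by
    have h3 : term 0 ≤ S := ENNReal.le_tsum 0
    calc localLp p f x₀ (4 ^ 1 * r)
        = ENNReal.ofReal (r ^ ((n + 2 : ℝ) / p)) * term 0 := by
          simp only [hterm, zero_add, Nat.cast_one, one_mul, pow_zero]
          rw [mul_left_comm, ← ENNReal.ofReal_mul (by positivity), ← Real.rpow_add hr,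
            add_neg_cancel, Real.rpow_zero, ENNReal.ofReal_one, mul_one]
      _ ≤ _ := by gcongr
  have hmaj : Measurable (majorant a κ f₀) := measurable_majorant ham κ hf₀m
  have hbm : Measurable fun x => κ + ‖a x - c₀‖ₑ := (ham.sub_const c₀).enorm.const_add κ
  have hfar : Measurable fun x => C₂ * S * (κ + ‖a x - c₀‖ₑ) := hbm.const_mul _
  have hA : (∫⁻ x in D, majorant a κ f₀ x ^ p) ^ (1 / p) ≤
      C₁ ^ (1 / p) * κ * localLp p f x₀ (4 ^ 1 * r) := by
    calc (∫⁻ x in D, majorant a κ f₀ x ^ p) ^ (1 / p)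
        ≤ (C₁ * κ ^ p * ∫⁻ y in upperDomain n, f₀ y ^ p) ^ (1 / p) := by
          refine ENNReal.rpow_le_rpow ?_ (by positivity)
          exact (lintegral_mono_set Set.inter_subset_left).trans
            (h₁ a κ ha ham hκ hκt f₀ hf₀m)
      _ = C₁ ^ (1 / p) * κ * (∫⁻ y in upperDomain n, f₀ y ^ p) ^ (1 / p) := by
          rw [ENNReal.mul_rpow_of_nonneg _ _ (by positivity),
            ENNReal.mul_rpow_of_nonneg _ _ (by positivity), ← ENNReal.rpow_mul,
            mul_one_div_cancel hp0.ne', ENNReal.rpow_one]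
      _ = _ := by
          congr 2
          have h4 : ∀ y, f₀ y ^ p = D₁.indicator (fun y => f y ^ p) y := by
            intro y
            by_cases hy : y ∈ D₁
            · simp [hf₀, hy]
            · simp [hf₀, hy, hp0]
          simp_rw [h4]
          rw [lintegral_indicator hD₁m, Measure.restrict_restrict hD₁m,
            Set.inter_eq_left.2 (show D₁ ⊆ upperDomain n from Set.inter_subset_left)]
  have hBint : (∫⁻ x in D, (C₂ * S * (κ + ‖a x - c₀‖ₑ)) ^ p) ^ (1 / p) ≤
      C₂ * S * (J * κ * ENNReal.ofReal (2 ^ ((n + 2 : ℝ) / p) * r ^ ((n + 2 : ℝ) / p))) := by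
    have hvol : volume B ^ (1 / p) =
        ENNReal.ofReal (2 ^ ((n + 2 : ℝ) / p) * r ^ ((n + 2 : ℝ) / p)) := by
      rw [hB, volume_paraBox _ (by positivity), ENNReal.ofReal_rpow_of_nonneg (by positivity)
        (by positivity), ← Real.rpow_natCast, ← Real.rpow_mul (by positivity),
        ← Real.mul_rpow (by norm_num) hr.le]
      congr 1
      push_cast
      rw [mul_one_div]
    calc (∫⁻ x in D, (C₂ * S * (κ + ‖a x - c₀‖ₑ)) ^ p) ^ (1 / p)
        = ((C₂ * S) ^ p * ∫⁻ x in D, (κ + ‖a x - c₀‖ₑ) ^ p) ^ (1 / p) := by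
          congr 1
          rw [← lintegral_const_mul _ (hbm.pow_const p)]
          refine lintegral_congr fun x => ?_
          rw [ENNReal.mul_rpow_of_nonneg _ _ hp0.le]
      _ ≤ ((C₂ * S) ^ p * (shiftJN n p * κ ^ p * volume B)) ^ (1 / p) := by
          refine ENNReal.rpow_le_rpow ?_ (by positivity)
          gcongr
          refine (lintegral_mono_set hDB).trans ?_
          exact ha.lintegral_add_rpow_le ham hκ hκt hp.le (by positivity)
            (domainCorner_cornerInDomain _ _)
      _ = C₂ * S * (J * κ * volume B ^ (1 / p)) := by
          rw [ENNReal.mul_rpow_of_nonneg _ (shiftJN n p * κ ^ p * volume B) (by positivity),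
            ENNReal.mul_rpow_of_nonneg _ (volume B) (by positivity),
            ENNReal.mul_rpow_of_nonneg _ (κ ^ p) (by positivity), ← ENNReal.rpow_mul,
            ← ENNReal.rpow_mul, mul_one_div_cancel hp0.ne', ENNReal.rpow_one, ENNReal.rpow_one]
      _ = _ := by rw [hvol]
  calc localLp p (majorant a κ f) x₀ r
      ≤ (∫⁻ x in D, (majorant a κ f₀ + fun x => C₂ * S * (κ + ‖a x - c₀‖ₑ)) x ^ p) ^ (1 / p) := by
        refine ENNReal.rpow_le_rpow (setLIntegral_mono' hDm fun x hx => ?_) (by positivity)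
        exact ENNReal.rpow_le_rpow (hpt x hx) hp0.le
    _ ≤ (∫⁻ x in D, majorant a κ f₀ x ^ p) ^ (1 / p) +
          (∫⁻ x in D, (C₂ * S * (κ + ‖a x - c₀‖ₑ)) ^ p) ^ (1 / p) :=
        ENNReal.lintegral_Lp_add_le hmaj.aemeasurable hfar.aemeasurable hp.le
    _ ≤ C₁ ^ (1 / p) * κ * (ENNReal.ofReal (r ^ ((n + 2 : ℝ) / p)) * S) +
          C₂ * S * (J * κ * ENNReal.ofReal (2 ^ ((n + 2 : ℝ) / p) * r ^ ((n + 2 : ℝ) / p))) := by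
        refine add_le_add (hA.trans ?_) hBint
        gcongr
    _ = _ := by
        rw [ENNReal.ofReal_mul (by positivity)]
        ring

end Morrey

/-! ### The size of the reflected kernel -/

section KernelBound

variable {n : ℕ}

theorem norm_paraDilation_sq (μ : ℝ) (ξ : ParaSpace n) :
    ‖paraDilation μ ξ‖ ^ 2 = μ ^ 2 * spatialNorm ξ ^ 2 + μ ^ 4 * ξ (Fin.last n) ^ 2 := by
  rw [EuclideanSpace.norm_sq_eq, Fin.sum_univ_castSucc, spatialNorm,
    Real.sq_sqrt (Finset.sum_nonneg fun i _ => sq_nonneg _), Finset.mul_sum]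
  congr 1
  · refine Finset.sum_congr rfl fun i _ => ?_
    simp [paraDilation, mul_pow]
  · simp only [paraDilation, Fin.snoc_last, Real.norm_eq_abs, sq_abs]
    ring

/-- A parabolically homogeneous kernel bounded by `M` on the unit sphere is at most `M N ^ (-(n+2))`
at parabolic distance at least `N` from the origin: a dilation by some `μ ≤ 1 / N` moves the point
to the sphere. -/
theorem IsParaCZKernel.abs_le {k : ParaSpace n → ℝ} (hk : IsParaCZKernel k) {M : ℝ}
    (hM : ∀ ξ ∈ Metric.sphere (0 : ParaSpace n) 1, |k ξ| ≤ M) {ξ : ParaSpace n} {N : ℝ} (hN : 0 < N)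
    (h : N ≤ spatialNorm ξ ∨ N ≤ √|ξ (Fin.last n)|) : |k ξ| ≤ |M| * N ^ (-(n + 2 : ℝ)) := by
  set g : ℝ → ℝ := fun μ => μ ^ 2 * spatialNorm ξ ^ 2 + μ ^ 4 * ξ (Fin.last n) ^ 2 with hg
  have hgc : Continuous g := by fun_prop
  have hg1 : 1 ≤ g N⁻¹ := by
    rcases h with h | h
    · have h1 : 1 ≤ N⁻¹ * spatialNorm ξ := by rwa [inv_mul_eq_div, one_le_div hN]
      have h2 : 1 ≤ (N⁻¹ * spatialNorm ξ) ^ 2 := one_le_pow₀ h1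
      rw [mul_pow] at h2
      have h3 : 0 ≤ N⁻¹ ^ 4 * ξ (Fin.last n) ^ 2 := by positivity
      simp only [hg]
      linarith
    · have h1 : 1 ≤ N⁻¹ * √|ξ (Fin.last n)| := by rwa [inv_mul_eq_div, one_le_div hN]
      have h2 : 1 ≤ (N⁻¹ * √|ξ (Fin.last n)|) ^ 4 := one_le_pow₀ h1
      have h4 : √|ξ (Fin.last n)| ^ 4 = ξ (Fin.last n) ^ 2 := by
        rw [show (4 : ℕ) = 2 * 2 by rfl, pow_mul, Real.sq_sqrt (abs_nonneg _), sq_abs]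
      rw [mul_pow, h4] at h2
      have h3 : 0 ≤ N⁻¹ ^ 2 * spatialNorm ξ ^ 2 := by positivity
      simp only [hg]
      linarith
  have hg0 : g 0 ≤ 1 := by simp [hg]
  obtain ⟨μ, ⟨hμ0, hμN⟩, hμ⟩ := intermediate_value_Icc (inv_nonneg.2 hN.le) hgc.continuousOn
    ⟨hg0, hg1⟩
  have hμpos : 0 < μ := by
    refine lt_of_le_of_ne hμ0 ?_
    rintro rfl
    simp [hg] at hμ
  have hsph : paraDilation μ ξ ∈ Metric.sphere (0 : ParaSpace n) 1 := by
    rw [mem_sphere_zero_iff_norm]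
    have : ‖paraDilation μ ξ‖ ^ 2 = 1 := by rw [norm_paraDilation_sq]; exact hμ
    exact (pow_eq_one_iff_of_nonneg (norm_nonneg _) two_ne_zero).1 this
  have hξ : ξ ≠ 0 := by
    rintro rfl
    simp [spatialNorm] at h
    linarith
  have hhom := hk.homogeneous μ hμpos ξ hξ
  have hkξ : k ξ = μ ^ (n + 2) * k (paraDilation μ ξ) := by
    rw [hhom]
    field_simp
  have hNpow : N ^ (-(n + 2 : ℝ)) = N⁻¹ ^ (n + 2) := by
    rw [Real.rpow_neg hN.le, inv_pow]
    congr 1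
    exact_mod_cast Real.rpow_natCast N (n + 2)
  rw [hkξ, abs_mul, abs_of_pos (pow_pos hμpos _), hNpow, mul_comm]
  exact mul_le_mul ((hM _ hsph).trans (le_abs_self M)) (pow_le_pow_left₀ hμ0 hμN _) (by positivity)
    (abs_nonneg M)

/-- Bounds for the entries of an elliptic matrix; those off the diagonal follow by testing with
`eᵢ ± eⱼ`. -/
theorem abs_le_of_elliptic {A : Matrix (Fin n) (Fin n) ℝ} {Λ : ℝ} (hΛ : 0 < Λ)
    (hsymm : ∀ i j, A i j = A j i)
    (hell : ∀ ξ : Fin n → ℝ, Λ⁻¹ * ∑ i, ξ i ^ 2 ≤ ∑ i, ∑ j, A i j * ξ i * ξ j ∧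
      ∑ i, ∑ j, A i j * ξ i * ξ j ≤ Λ * ∑ i, ξ i ^ 2) (i j : Fin n) :
    Λ⁻¹ ≤ A i i ∧ |A i j| ≤ Λ := by
  have hdiag : ∀ i, Λ⁻¹ ≤ A i i ∧ A i i ≤ Λ := by
    intro i
    have := hell (Pi.single i 1)
    simpa [Pi.single_apply, ite_pow] using this
  have hΛ' : 0 < Λ⁻¹ := inv_pos.2 hΛ
  refine ⟨(hdiag i).1, ?_⟩
  rcases eq_or_ne i j with rfl | hij
  · rw [abs_of_pos (hΛ'.trans_le (hdiag i).1)]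
    exact (hdiag i).2
  · have key : ∀ s : ℝ, s ^ 2 = 1 → A i i + 2 * s * A i j + A j j ≤ 2 * Λ := by
      intro s hs
      have h1 := (hell fun k => (if k = i then 1 else 0) + s * if k = j then 1 else 0).2
      have h2 : ∑ k, ((if k = i then (1 : ℝ) else 0) + s * if k = j then 1 else 0) ^ 2 = 2 := by
        have : ∀ k, ((if k = i then (1 : ℝ) else 0) + s * if k = j then 1 else 0) ^ 2 =
            (if k = i then 1 else 0) + if k = j then 1 else 0 := by
          intro k
          by_cases h3 : k = i
          · subst h3
            simp [hij]
          · by_cases h4 : k = j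
            · subst h4
              simp [h3, hs]
            · simp [h3, h4]
        rw [Finset.sum_congr rfl fun k _ => this k, Finset.sum_add_distrib]
        simp only [Finset.sum_ite_eq', Finset.mem_univ, if_true]
        norm_num
      rw [h2] at h1
      simp only [mul_add, add_mul, Finset.sum_add_distrib, mul_ite, ite_mul, mul_one, mul_zero,
        zero_mul, Finset.sum_ite_eq', Finset.mem_univ, if_true] at h1
      have h5 : A j j * s * s = A j j := by rw [mul_assoc, ← sq, hs, mul_one]
      rw [← hsymm i j] at h1
      linarith
    have h1 := key 1 (by norm_num)
    have h2 := key (-1) (by norm_num)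
    have h3 := hΛ'.trans_le (hdiag i).1
    have h4 := hΛ'.trans_le (hdiag j).1
    rw [abs_le]
    constructor <;> linarith

variable [NeZero n]

/-- The reflected point `𝒯(x)` is at least as far from `y` as a multiple of `reflDist x y`, as its
last spatial coordinate is `-xₙ` and it moves `x` by at most a multiple of `xₙ`. -/
theorem reflDist_le_genReflection {A : ParaSpace n → Matrix (Fin n) (Fin n) ℝ} {x y : ParaSpace n}
    {L : ℝ} (hL : 0 ≤ L) (hA0 : A x (lastSpatial n) (lastSpatial n) ≠ 0)
    (hA : ∀ i, |A x (lastSpatial n) i / A x (lastSpatial n) (lastSpatial n)| ≤ L)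
    (hx : x ∈ upperDomain n) (hy : y ∈ upperDomain n) :
    reflDist x y / (2 * n * L + 3) ≤ spatialNorm (genReflection A x - y) ∨
      reflDist x y / (2 * n * L + 3) ≤ √|(genReflection A x - y) (Fin.last n)| := by
  set ξ := genReflection A x - y with hξ
  have hx0 := height_pos hx
  have hy0 := height_pos hy
  have hlast : ξ (Fin.last n) = x (Fin.last n) - y (Fin.last n) := by
    simp [hξ, genReflection]
  have hn : height x + height y ≤ spatialNorm ξ := by
    have h1 := abs_castSucc_le_spatialNorm ξ (lastSpatial n)
    have h2 : ξ (lastSpatial n).castSucc = -(height x + height y) := by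
      simp only [hξ, genReflection, PiLp.sub_apply, Fin.snoc_castSucc, div_self hA0, height]
      ring
    rwa [h2, abs_neg, abs_of_pos (by positivity)] at h1
  have hmove : spatialNorm (x - genReflection A x) ≤ n * (2 * height x * L) := by
    refine spatialNorm_le_of_forall_abs_le (by positivity) fun i => ?_
    have h1 : (x - genReflection A x) i.castSucc = 2 * height x *
        (A x (lastSpatial n) i / A x (lastSpatial n) (lastSpatial n)) := by
      simp only [genReflection, PiLp.sub_apply, Fin.snoc_castSucc, height]
      ring
    rw [h1, abs_mul, abs_of_pos (by positivity)]
    gcongr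
    exact hA i
  have htri : spatialNorm (x - y) ≤ spatialNorm (x - genReflection A x) + spatialNorm ξ := by
    have := spatialNorm_add_le (x - genReflection A x) ξ
    rwa [hξ, sub_add_sub_cancel] at this
  have hd : reflDist x y = spatialNorm (x - y) + √|ξ (Fin.last n)| + height x + height y := by
    rw [hlast]
    rfl
  set S := spatialNorm ξ with hS
  set t := √|ξ (Fin.last n)| with ht
  have hnL : 0 ≤ 2 * n * L := by positivity
  rw [div_le_iff₀ (by positivity), div_le_iff₀ (by positivity)]
  by_contra hcon
  rw [not_or, not_le, not_le] at hcon
  have h1 : (n : ℝ) * (2 * height x * L) ≤ 2 * n * L * S := by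
    calc (n : ℝ) * (2 * height x * L) = 2 * n * L * height x := by ring
      _ ≤ _ := by
        gcongr
        linarith
  have h2 : reflDist x y ≤ (2 * n * L + 2) * S + t := by linarith
  have h3 : (2 * n * L + 3) * ((2 * n * L + 2) * S + t) < (2 * n * L + 3) * reflDist x y := by
    nlinarith
  have h4 := lt_of_mul_lt_mul_left h3 (by positivity)
  linarith

/-- The reflected kernel is dominated by `reflKernel`. -/
theorem exists_enorm_kernel_le {K : ParaSpace n → ParaSpace n → ℝ} (hK : IsVariableParaCZKernel K)
    {A : ParaSpace n → Matrix (Fin n) (Fin n) ℝ} (hA : IsUniformlyElliptic (upperDomain n) A) :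
    ∃ C : ℝ≥0∞, C ≠ ⊤ ∧ ∀ᵐ x ∂(volume.restrict (upperDomain n)), ∀ y ∈ upperDomain n,
      ‖K x (genReflection A x - y)‖ₑ ≤ C * reflKernel x y := by
  obtain ⟨-, Λ, hΛ, hell⟩ := hA
  obtain ⟨M, hM⟩ := hK.bounded 0 Fin.elim0
  set L : ℝ := Λ * Λ with hL
  have hL0 : 0 ≤ L := by positivity
  have hc : (0 : ℝ) < 2 * n * L + 3 := by positivity
  refine ⟨ENNReal.ofReal (|M| * (2 * n * L + 3) ^ (n + 2 : ℝ)), ENNReal.ofReal_ne_top, ?_⟩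
  filter_upwards [hell, ae_restrict_of_ae hK.kernel, ae_restrict_of_ae hM,
    ae_restrict_mem measurableSet_upperDomain] with x hx1 hx2 hx3 hx y hy
  have hbd := abs_le_of_elliptic hΛ hx1.1 hx1.2
  have hpos : 0 < A x (lastSpatial n) (lastSpatial n) :=
    (inv_pos.2 hΛ).trans_le (hbd _ (lastSpatial n)).1
  have hratio : ∀ i, |A x (lastSpatial n) i / A x (lastSpatial n) (lastSpatial n)| ≤ L := by
    intro i
    have h1 := (hbd (lastSpatial n) i).2
    have h2 := (hbd (lastSpatial n) i).1
    rw [abs_div, abs_of_pos hpos, div_le_iff₀ hpos]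
    have h3 : 1 ≤ Λ * A x (lastSpatial n) (lastSpatial n) := by
      calc 1 = Λ * Λ⁻¹ := (mul_inv_cancel₀ hΛ.ne').symm
        _ ≤ _ := by gcongr
    nlinarith
  have hd := reflDist_pos hx hy
  have hM' : ∀ ξ ∈ Metric.sphere (0 : ParaSpace n) 1, |K x ξ| ≤ M := by
    intro ξ hξ
    have := hx3 ξ hξ
    rwa [iteratedFDeriv_zero_apply] at this
  have h := hx2.abs_le hM' (div_pos hd hc)
    (reflDist_le_genReflection hL0 hpos.ne' hratio hx hy)
  rw [reflKernel, ← ENNReal.ofReal_mul (by positivity), Real.enorm_eq_ofReal_abs]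
  refine ENNReal.ofReal_le_ofReal (h.trans (le_of_eq ?_))
  rw [Real.div_rpow hd.le hc.le, Real.rpow_neg hc.le]
  field_simp

/-- Joint measurability of the reflected kernel. A null set of pairs `(x, ξ)` pulls back to a null
set of pairs `(x, y)`, as `y ↦ 𝒯(x) - y` preserves the volume for each `x`. -/
theorem aestronglyMeasurable_reflected_kernel {K : ParaSpace n → ParaSpace n → ℝ}
    (hK : IsVariableParaCZKernel K) {A : ParaSpace n → Matrix (Fin n) (Fin n) ℝ}
    (hA : IsUniformlyElliptic (upperDomain n) A) :
    AEStronglyMeasurable (fun z : ParaSpace n × ParaSpace n => K z.1 (genReflection A z.1 - z.2))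
      ((volume.restrict (upperDomain n)).prod (volume.restrict (upperDomain n))) := by
  set ν := volume.restrict (upperDomain n) with hν
  have hT : AEMeasurable (genReflection A) ν := by
    have hcoord : AEMeasurable (fun x => (genReflection A x).ofLp) ν := by
      refine aemeasurable_pi_iff.2 fun i => ?_
      refine Fin.lastCases ?_ (fun i => ?_) i
      · simp only [genReflection, Fin.snoc_last]
        fun_prop
      · simp only [genReflection, Fin.snoc_castSucc]
        have h1 := hA.1 (lastSpatial n) i
        have h2 := hA.1 (lastSpatial n) (lastSpatial n)
        have h3 : AEMeasurable (fun x : ParaSpace n => x i.castSucc) ν := by fun_prop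
        have h4 : AEMeasurable (fun x : ParaSpace n => 2 * x (lastSpatial n).castSucc) ν := by
          fun_prop
        exact h3.sub (h4.mul (h1.div h2))
    have hmk : Measurable (WithLp.toLp 2 : (Fin (n + 1) → ℝ) → ParaSpace n) :=
      (PiLp.continuous_toLp 2 _).measurable
    exact hmk.comp_aemeasurable hcoord
  obtain ⟨T, hTm, hTeq⟩ := hT
  set Ψ : ParaSpace n × ParaSpace n → ParaSpace n × ParaSpace n := fun z => (z.1, T z.1 - z.2)
    with hΨ
  have hmp : MeasurePreserving Ψ (ν.prod volume) (ν.prod volume) := by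
    refine (MeasurePreserving.id ν).skew_product (g := fun x y => T x - y) ?_ ?_
    · exact (hTm.comp measurable_fst).sub measurable_snd
    · exact Filter.Eventually.of_forall fun x =>
        (Measure.measurePreserving_sub_left volume (T x)).map_eq
  have hKν : AEMeasurable (fun z : ParaSpace n × ParaSpace n => K z.1 z.2) (ν.prod volume) := by
    refine hK.measurable.mono_measure ?_
    rw [Measure.volume_eq_prod]
    exact Measure.prod_mono Measure.restrict_le_self le_rfl
  have h1 : AEMeasurable (fun z : ParaSpace n × ParaSpace n => K z.1 (T z.1 - z.2))
      (ν.prod volume) := hKν.comp_quasiMeasurePreserving hmp.quasiMeasurePreserving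
  have h2 : AEMeasurable (fun z : ParaSpace n × ParaSpace n => K z.1 (T z.1 - z.2)) (ν.prod ν) :=
    h1.mono_measure (Measure.prod_mono le_rfl Measure.restrict_le_self)
  refine (h2.congr ?_).aestronglyMeasurable
  have h3 : ∀ᵐ z ∂(ν.prod ν), genReflection A z.1 = T z.1 :=
    Measure.quasiMeasurePreserving_fst.ae hTeq
  filter_upwards [h3] with z hz
  rw [hz]

end KernelBound

/-! ### Morrey spaces and dominated operators -/

section MorreySpace

variable {n : ℕ} [NeZero n]

theorem iUnion_domainCylinder (x : ParaSpace n) :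
    ⋃ k : ℕ, domainCylinder x (4 ^ k * 1) = upperDomain n := by
  refine Set.Subset.antisymm (Set.iUnion_subset fun k => Set.inter_subset_left) fun y hy => ?_
  obtain ⟨k, hk⟩ := exists_mem_paraCylinder_four_pow x y one_pos
  exact Set.mem_iUnion.2 ⟨k, hy, hk⟩

theorem upperDomain_nonempty : (upperDomain n).Nonempty :=
  ⟨WithLp.toLp 2 fun _ => 1, by simp [mem_upperDomain_iff]⟩

theorem aestronglyMeasurable_of_domainCylinder {f : ParaSpace n → ℝ}
    (h : ∀ x ∈ upperDomain n, ∀ r : ℝ, 0 < r →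
      AEStronglyMeasurable f (volume.restrict (domainCylinder x r))) :
    AEStronglyMeasurable f (volume.restrict (upperDomain n)) := by
  obtain ⟨x, hx⟩ := upperDomain_nonempty (n := n)
  rw [← iUnion_domainCylinder x, aestronglyMeasurable_iUnion_iff]
  exact fun k => h x hx _ (by positivity)

theorem MemMorrey.aestronglyMeasurable {p : ℝ} {φ : ParaSpace n → ℝ → ℝ} {f : ParaSpace n → ℝ}
    (hf : MemMorrey (upperDomain n) p φ f) :
    AEStronglyMeasurable f (volume.restrict (upperDomain n)) :=
  aestronglyMeasurable_of_domainCylinder fun x hx r hr => (hf.1 x hx r hr).1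

theorem morreyNorm_eq_iSup_localLp {p : ℝ} (hp : 0 < p) (φ : ParaSpace n → ℝ → ℝ)
    (f : ParaSpace n → ℝ) :
    morreyNorm (upperDomain n) p φ f = ⨆ x ∈ upperDomain n, ⨆ r : ℝ, ⨆ _ : 0 < r,
      (ENNReal.ofReal (φ x r))⁻¹ * (ENNReal.ofReal (r ^ (-((n + 2 : ℝ) / p))) *
        localLp p (fun y => ‖f y‖ₑ) x r) := by
  unfold morreyNorm
  congr! 7 with x hx r hr
  rw [ENNReal.mul_rpow_of_nonneg _ _ (by positivity)]
  congr 1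
  rw [← ENNReal.ofReal_inv_of_pos (by positivity), ENNReal.ofReal_rpow_of_nonneg (by positivity)
    (by positivity)]
  congr 1
  rw [Real.inv_rpow (by positivity), ← Real.rpow_natCast, ← Real.rpow_mul hr.le,
    Real.rpow_neg hr.le]
  push_cast
  rw [mul_one_div]

theorem localLp_le_morreyNorm_mul {p : ℝ} (hp : 0 < p) {φ : ParaSpace n → ℝ → ℝ}
    (hφ : ∀ (x : ParaSpace n) (r : ℝ), 0 < r → 0 < φ x r) (f : ParaSpace n → ℝ) {x : ParaSpace n}
    (hx : x ∈ upperDomain n) {r : ℝ} (hr : 0 < r) :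
    localLp p (fun y => ‖f y‖ₑ) x r ≤ morreyNorm (upperDomain n) p φ f *
      ENNReal.ofReal (φ x r * r ^ ((n + 2 : ℝ) / p)) := by
  have h1 : (ENNReal.ofReal (φ x r))⁻¹ * (ENNReal.ofReal (r ^ (-((n + 2 : ℝ) / p))) *
        localLp p (fun y => ‖f y‖ₑ) x r) ≤ morreyNorm (upperDomain n) p φ f := by
    rw [morreyNorm_eq_iSup_localLp hp]
    exact le_iSup₂_of_le x hx (le_iSup₂_of_le r hr le_rfl)
  have h2 := hφ x r hr
  rw [← ENNReal.ofReal_inv_of_pos h2, ← mul_assoc, ← ENNReal.ofReal_mul (by positivity),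
    Real.rpow_neg hr.le, ← mul_inv, ENNReal.ofReal_inv_of_pos (by positivity), mul_comm,
    ← div_eq_mul_inv, ENNReal.div_le_iff (by simpa using by positivity) ENNReal.ofReal_ne_top] at h1
  exact h1

theorem localLp_mono_radius {p : ℝ} (hp : 0 < p) (f : ParaSpace n → ℝ≥0∞) (x : ParaSpace n)
    {r s : ℝ} (hr : 0 ≤ r) (hrs : r ≤ s) : localLp p f x r ≤ localLp p f x s :=
  ENNReal.rpow_le_rpow (lintegral_mono_set (domainCylinder_mono x hr hrs)) (by positivity)

theorem localLp_congr {p : ℝ} {f g : ParaSpace n → ℝ≥0∞}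
    (h : f =ᵐ[volume.restrict (upperDomain n)] g) (x : ParaSpace n) (r : ℝ) :
    localLp p f x r = localLp p g x r := by
  unfold localLp
  congr 1
  refine lintegral_congr_ae ?_
  filter_upwards [ae_restrict_of_ae_restrict_of_subset
    (show domainCylinder x r ⊆ upperDomain n from Set.inter_subset_left) h] with y hy
  rw [hy]

/-- As the local norms increase with the radius, they are controlled by the essential infimum of the
weight over all larger radii. -/
theorem localLp_le_morreyNorm_mul_weightInf {p : ℝ} (hp : 0 < p) {φ : ParaSpace n → ℝ → ℝ}
    (hφ : ∀ (x : ParaSpace n) (r : ℝ), 0 < r → 0 < φ x r) {f : ParaSpace n → ℝ}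
    (hf : morreyNorm (upperDomain n) p φ f ≠ ⊤) {x : ParaSpace n} (hx : x ∈ upperDomain n) {s : ℝ}
    (hs : 0 < s) :
    localLp p (fun y => ‖f y‖ₑ) x s ≤ morreyNorm (upperDomain n) p φ f * weightInf p φ x s := by
  set N := morreyNorm (upperDomain n) p φ f with hN
  have h1 : ∀ ζ, s < ζ → localLp p (fun y => ‖f y‖ₑ) x s ≤
      N * ENNReal.ofReal (φ x ζ * ζ ^ (((n : ℝ) + 2) / p)) := fun ζ hζ =>
    (localLp_mono_radius hp _ x hs.le hζ.le).trans
      (localLp_le_morreyNorm_mul hp hφ f hx (hs.trans hζ))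
  rcases eq_or_ne N 0 with h0 | h0
  · have := h1 (s + 1) (by linarith)
    rw [h0, zero_mul] at this
    rw [h0, zero_mul]
    exact this
  · rw [mul_comm, ← ENNReal.div_le_iff h0 hf]
    refine le_essInf_of_ae_le _ ?_
    filter_upwards [ae_restrict_mem measurableSet_Ioi] with ζ hζ
    rw [ENNReal.div_le_iff h0 hf, mul_comm]
    exact h1 ζ hζ

theorem morreyNorm_congr {p : ℝ} (hp : 0 < p) {φ : ParaSpace n → ℝ → ℝ} {f g : ParaSpace n → ℝ}
    (h : f =ᵐ[volume.restrict (upperDomain n)] g) :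
    morreyNorm (upperDomain n) p φ f = morreyNorm (upperDomain n) p φ g := by
  rw [morreyNorm_eq_iSup_localLp hp, morreyNorm_eq_iSup_localLp hp]
  have h' : (fun y => ‖f y‖ₑ) =ᵐ[volume.restrict (upperDomain n)] fun y => ‖g y‖ₑ := by
    filter_upwards [h] with y hy
    rw [hy]
  simp_rw [localLp_congr h']

theorem MemMorrey.of_morreyNorm_ne_top {p : ℝ} (hp : 0 < p) {φ : ParaSpace n → ℝ → ℝ}
    (hφ : ∀ (x : ParaSpace n) (r : ℝ), 0 < r → 0 < φ x r) {f : ParaSpace n → ℝ}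
    (hfm : AEStronglyMeasurable f (volume.restrict (upperDomain n)))
    (hf : morreyNorm (upperDomain n) p φ f ≠ ⊤) : MemMorrey (upperDomain n) p φ f := by
  refine ⟨fun x hx r hr => ⟨?_, ?_⟩, hf.lt_top⟩
  · exact hfm.mono_measure (Measure.restrict_mono Set.inter_subset_left le_rfl)
  · rw [eLpNorm_eq_lintegral_rpow_enorm_toReal (by simpa using hp) ENNReal.ofReal_ne_top,
      ENNReal.toReal_ofReal hp.le]
    refine (localLp_le_morreyNorm_mul hp hφ f hx hr).trans_lt ?_
    exact ENNReal.mul_lt_top hf.lt_top ENNReal.ofReal_lt_top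

theorem MemMorrey.sub {p : ℝ} (hp : 1 ≤ p) {φ : ParaSpace n → ℝ → ℝ}
    (hφ : ∀ (x : ParaSpace n) (r : ℝ), 0 < r → 0 < φ x r) {f g : ParaSpace n → ℝ}
    (hf : MemMorrey (upperDomain n) p φ f) (hg : MemMorrey (upperDomain n) p φ g) :
    MemMorrey (upperDomain n) p φ (f - g) := by
  have hp0 : 0 < p := by linarith
  refine MemMorrey.of_morreyNorm_ne_top hp0 hφ (hf.aestronglyMeasurable.sub hg.aestronglyMeasurable)
    (ne_top_of_le_ne_top (ENNReal.add_ne_top.2 ⟨hf.2.ne, hg.2.ne⟩) ?_)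
  rw [morreyNorm_eq_iSup_localLp hp0 φ (f - g)]
  refine iSup₂_le fun x hx => iSup₂_le fun r hr => ?_
  have h1 : localLp p (fun y => ‖(f - g) y‖ₑ) x r ≤
      localLp p (fun y => ‖f y‖ₑ) x r + localLp p (fun y => ‖g y‖ₑ) x r := by
    refine le_trans ?_ (ENNReal.lintegral_Lp_add_le (hf.1 x hx r hr).1.enorm
      (hg.1 x hx r hr).1.enorm hp)
    refine ENNReal.rpow_le_rpow (lintegral_mono fun y => ?_) (by positivity)
    exact ENNReal.rpow_le_rpow enorm_sub_le hp0.le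
  calc _ ≤ (ENNReal.ofReal (φ x r))⁻¹ * (ENNReal.ofReal (r ^ (-((n + 2 : ℝ) / p))) *
        (localLp p (fun y => ‖f y‖ₑ) x r + localLp p (fun y => ‖g y‖ₑ) x r)) := by gcongr
    _ = (ENNReal.ofReal (φ x r))⁻¹ * (ENNReal.ofReal (r ^ (-((n + 2 : ℝ) / p))) *
          localLp p (fun y => ‖f y‖ₑ) x r) +
        (ENNReal.ofReal (φ x r))⁻¹ * (ENNReal.ofReal (r ^ (-((n + 2 : ℝ) / p))) *
          localLp p (fun y => ‖g y‖ₑ) x r) := by ring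
    _ ≤ _ := by
      rw [morreyNorm_eq_iSup_localLp hp0 φ f, morreyNorm_eq_iSup_localLp hp0 φ g]
      exact add_le_add (le_iSup₂_of_le x hx (le_iSup₂_of_le r hr le_rfl))
        (le_iSup₂_of_le x hx (le_iSup₂_of_le r hr le_rfl))

/-- The majorant maps the Morrey space to itself. -/
theorem exists_localLp_majorant_le_morreyNorm {p : ℝ} (hp : 1 < p) {φ : ParaSpace n → ℝ → ℝ}
    (hφ : IsMorreyWeight p φ) :
    ∃ C : ℝ≥0∞, C ≠ ⊤ ∧ ∀ (a : ParaSpace n → ℝ) (κ : ℝ≥0∞), BoxBMO a κ → Measurable a → κ ≠ 0 →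
      κ ≠ ⊤ → ∀ (f : ParaSpace n → ℝ) (g : ParaSpace n → ℝ≥0∞), Measurable g →
      (fun y => ‖f y‖ₑ) =ᵐ[volume.restrict (upperDomain n)] g →
      morreyNorm (upperDomain n) p φ f ≠ ⊤ → ∀ x ∈ upperDomain n, ∀ r : ℝ, 0 < r →
      localLp p (majorant a κ g) x r ≤ C * κ * ENNReal.ofReal (r ^ ((n + 2 : ℝ) / p)) *
        (morreyNorm (upperDomain n) p φ f * ENNReal.ofReal (φ x r)) := by
  have hp0 : 0 < p := by linarith
  obtain ⟨C₁, hC₁, h₁⟩ := exists_localLp_majorant_le (n := n) hp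
  obtain ⟨C₂, hC₂, h₂⟩ := hφ.exists_tsum_le hp
  refine ⟨C₁ * C₂, by finiteness, ?_⟩
  intro a κ ha ham hκ hκt f g hg hfg hf x hx r hr
  set N := morreyNorm (upperDomain n) p φ f with hN
  calc localLp p (majorant a κ g) x r
      ≤ C₁ * κ * ENNReal.ofReal (r ^ ((n + 2 : ℝ) / p)) *
        ∑' k : ℕ, (k + 1 : ℕ) * (localLp p g x (4 ^ (k + 1) * r) *
          ENNReal.ofReal ((4 ^ k * r) ^ (-((n + 2 : ℝ) / p)))) :=
        h₁ a κ ha ham hκ hκt g hg x hx r hr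
    _ ≤ C₁ * κ * ENNReal.ofReal (r ^ ((n + 2 : ℝ) / p)) *
        ∑' k : ℕ, N * ((k + 1 : ℕ) * (weightInf p φ x (4 ^ (k + 1) * r) *
          ENNReal.ofReal ((4 ^ k * r) ^ (-((n + 2 : ℝ) / p))))) := by
        refine mul_le_mul' le_rfl (ENNReal.tsum_le_tsum fun k => ?_)
        calc (k + 1 : ℕ) * (localLp p g x (4 ^ (k + 1) * r) *
              ENNReal.ofReal ((4 ^ k * r) ^ (-((n + 2 : ℝ) / p))))
            ≤ (k + 1 : ℕ) * ((N * weightInf p φ x (4 ^ (k + 1) * r)) *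
              ENNReal.ofReal ((4 ^ k * r) ^ (-((n + 2 : ℝ) / p)))) := by
              gcongr
              rw [← localLp_congr hfg]
              exact localLp_le_morreyNorm_mul_weightInf hp0 hφ.pos hf hx (by positivity)
          _ = _ := by ring
    _ ≤ C₁ * κ * ENNReal.ofReal (r ^ ((n + 2 : ℝ) / p)) * (N * (C₂ * ENNReal.ofReal (φ x r))) := by
        rw [ENNReal.tsum_mul_left]
        gcongr
        exact h₂ x r hr
    _ = _ := by ring

/-- Integral operators on the domain whose integrand is dominated by that of the majorant converge
absolutely almost everywhere and are bounded on the Morrey space. -/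
theorem exists_morreyNorm_le_of_dominated {p : ℝ} (hp : 1 < p) {φ : ParaSpace n → ℝ → ℝ}
    (hφ : IsMorreyWeight p φ) {C₁ : ℝ≥0∞} (hC₁ : C₁ ≠ ⊤) :
    ∃ C : ℝ≥0∞, C ≠ ⊤ ∧ ∀ (a : ParaSpace n → ℝ) (κ : ℝ≥0∞), BoxBMO a κ → κ ≠ 0 →
      AEStronglyMeasurable a (volume.restrict (upperDomain n)) → κ ≠ ⊤ →
      ∀ f : ParaSpace n → ℝ, MemMorrey (upperDomain n) p φ f →
      ∀ H : ParaSpace n → ParaSpace n → ℝ,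
      AEStronglyMeasurable (fun z : ParaSpace n × ParaSpace n => H z.1 z.2)
        ((volume.restrict (upperDomain n)).prod (volume.restrict (upperDomain n))) →
      (∀ᵐ x ∂(volume.restrict (upperDomain n)), ∀ y ∈ upperDomain n,
        ‖H x y‖ₑ ≤ C₁ * (reflKernel x y * (κ + ‖a x - a y‖ₑ) * ‖f y‖ₑ)) →
      (∀ᵐ x ∂(volume.restrict (upperDomain n)), IntegrableOn (H x) (upperDomain n)) ∧
      MemMorrey (upperDomain n) p φ (fun x => ∫ y in upperDomain n, H x y) ∧
      morreyNorm (upperDomain n) p φ (fun x => ∫ y in upperDomain n, H x y) ≤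
        C * κ * morreyNorm (upperDomain n) p φ f := by
  have hp0 : 0 < p := by linarith
  obtain ⟨C₂, hC₂, h₂⟩ := exists_localLp_majorant_le_morreyNorm hp hφ
  refine ⟨C₁ * C₂, by finiteness, ?_⟩
  intro a κ ha hκ ham hκt f hf H hHm hdom
  set ν := volume.restrict (upperDomain n) with hν
  -- pass to measurable representatives of `a` and `|f|`
  obtain ⟨a₀, ha₀m, haa₀⟩ : ∃ a₀, Measurable a₀ ∧ a =ᵐ[ν] a₀ :=
    ⟨ham.mk a, ham.stronglyMeasurable_mk.measurable, ham.ae_eq_mk⟩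
  have ha₀ : BoxBMO a₀ κ := ha.congr haa₀
  obtain ⟨g, hgm, hfg⟩ : ∃ g, Measurable g ∧ (fun y => ‖f y‖ₑ) =ᵐ[ν] g :=
    ⟨_, hf.aestronglyMeasurable.enorm.measurable_mk, hf.aestronglyMeasurable.enorm.ae_eq_mk⟩
  have hloc := h₂ a₀ κ ha₀ ha₀m hκ hκt f g hgm hfg hf.2.ne
  have hmaj : Measurable (majorant a₀ κ g) := measurable_majorant ha₀m κ hgm
  have hmajfin : ∀ᵐ x ∂ν, majorant a₀ κ g x < ⊤ := by
    obtain ⟨x, hx⟩ := upperDomain_nonempty (n := n)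
    rw [hν, ← iUnion_domainCylinder x, ae_restrict_iUnion_iff]
    intro k
    have hk : (0 : ℝ) < 4 ^ k * 1 := by positivity
    have h3 : localLp p (majorant a₀ κ g) x (4 ^ k * 1) ≠ ⊤ := by
      refine ne_top_of_le_ne_top ?_ (hloc x hx _ hk)
      have := hf.2.ne
      finiteness
    have h4 : ∫⁻ y in domainCylinder x (4 ^ k * 1), majorant a₀ κ g y ^ p ≠ ⊤ := by
      intro h
      rw [localLp, h, ENNReal.top_rpow_of_pos (by positivity)] at h3
      exact h3 rfl
    filter_upwards [ae_lt_top (hmaj.pow_const p) h4] with y hy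
    exact (ENNReal.rpow_lt_top_iff_of_pos hp0).1 hy
  have hbound : ∀ᵐ x ∂ν, ∫⁻ y in upperDomain n, ‖H x y‖ₑ ≤ C₁ * majorant a₀ κ g x := by
    filter_upwards [hdom, haa₀] with x hx hax
    have hm : Measurable fun y => reflKernel x y * (κ + ‖a₀ x - a₀ y‖ₑ) * g y := by
      have m1 : Measurable fun y => reflKernel x y := by fun_prop
      exact (m1.mul ((ha₀m.const_sub (a₀ x)).enorm.const_add κ)).mul hgm
    rw [majorant, ← lintegral_const_mul _ hm]
    refine lintegral_mono_ae ?_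
    filter_upwards [haa₀, hfg, ae_restrict_mem measurableSet_upperDomain] with y hay hfy hy
    rw [← hay, ← hfy, ← hax]
    exact hx y hy
  have hsm : ∀ᵐ x ∂ν, AEStronglyMeasurable (H x) ν := hHm.prodMk_left
  have hFm : AEStronglyMeasurable (fun x => ∫ y in upperDomain n, H x y) ν :=
    hHm.integral_prod_right'
  have hnorm : morreyNorm (upperDomain n) p φ (fun x => ∫ y in upperDomain n, H x y) ≤
      C₁ * C₂ * κ * morreyNorm (upperDomain n) p φ f := by
    rw [morreyNorm_eq_iSup_localLp hp0]
    refine iSup₂_le fun x hx => iSup₂_le fun r hr => ?_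
    set N := morreyNorm (upperDomain n) p φ f with hN
    have hφx := hφ.pos x r hr
    have h5 : localLp p (fun x => ‖∫ y in upperDomain n, H x y‖ₑ) x r ≤
        C₁ * localLp p (majorant a₀ κ g) x r := by
      calc localLp p (fun x => ‖∫ y in upperDomain n, H x y‖ₑ) x r
          ≤ (∫⁻ z in domainCylinder x r, C₁ ^ p * majorant a₀ κ g z ^ p) ^ (1 / p) := by
            refine ENNReal.rpow_le_rpow (lintegral_mono_ae ?_) (by positivity)
            filter_upwards [ae_restrict_of_ae_restrict_of_subset
              (show domainCylinder x r ⊆ upperDomain n from Set.inter_subset_left) hbound] with z hz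
            rw [← ENNReal.mul_rpow_of_nonneg _ _ hp0.le]
            exact ENNReal.rpow_le_rpow ((enorm_integral_le_lintegral_enorm _).trans hz) hp0.le
        _ = _ := by
            rw [lintegral_const_mul _ (hmaj.pow_const p),
              ENNReal.mul_rpow_of_nonneg _ _ (by positivity), ← ENNReal.rpow_mul,
              mul_one_div_cancel hp0.ne', ENNReal.rpow_one, localLp]
    have e1 : (ENNReal.ofReal (φ x r))⁻¹ * ENNReal.ofReal (φ x r) = 1 :=
      ENNReal.inv_mul_cancel (by simpa using hφx) ENNReal.ofReal_ne_top
    have e2 : ENNReal.ofReal (r ^ (-((n + 2 : ℝ) / p))) *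
        ENNReal.ofReal (r ^ ((n + 2 : ℝ) / p)) = 1 := by
      rw [← ENNReal.ofReal_mul (by positivity), ← Real.rpow_add hr, neg_add_cancel, Real.rpow_zero,
        ENNReal.ofReal_one]
    calc _ ≤ (ENNReal.ofReal (φ x r))⁻¹ * (ENNReal.ofReal (r ^ (-((n + 2 : ℝ) / p))) *
          (C₁ * (C₂ * κ * ENNReal.ofReal (r ^ ((n + 2 : ℝ) / p)) *
            (N * ENNReal.ofReal (φ x r))))) := by
          gcongr
          exact h5.trans (by gcongr; exact hloc x hx r hr)
      _ = ((ENNReal.ofReal (φ x r))⁻¹ * ENNReal.ofReal (φ x r)) *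
          (ENNReal.ofReal (r ^ (-((n + 2 : ℝ) / p))) * ENNReal.ofReal (r ^ ((n + 2 : ℝ) / p))) *
          (C₁ * C₂ * κ * N) := by ring
      _ = _ := by rw [e1, e2, one_mul, one_mul]
  refine ⟨?_, ?_, hnorm⟩
  · filter_upwards [hsm, hbound, hmajfin] with x h6 h7 h8
    exact ⟨h6, h7.trans_lt (ENNReal.mul_lt_top hC₁.lt_top h8)⟩
  · refine MemMorrey.of_morreyNorm_ne_top hp0 hφ.pos hFm (ne_top_of_le_ne_top ?_ hnorm)
    have := hf.2.ne
    finiteness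

end MorreySpace

/-! ### Nonsingular integrals and commutators -/

theorem boxBMO_zero {n : ℕ} [NeZero n] : BoxBMO (0 : ParaSpace n → ℝ) 1 := by
  intro o ℓ _ _
  refine ⟨integrableOn_zero, ?_⟩
  simp

theorem boxConst_ne_zero {n : ℕ} [NeZero n] : boxConst n ≠ 0 := by
  simpa [boxConst] using NeZero.ne n

theorem boxConst_ne_top {n : ℕ} : boxConst n ≠ ⊤ := by
  unfold boxConst
  finiteness

/-- An inequality `M ≤ C κ N` for all positive `κ ≥ B` extends to `κ = B`, also when `B = 0`. -/
theorem le_mul_of_forall_pos_le {M B C N : ℝ≥0∞} (hB : B ≠ ⊤) (hC : C ≠ ⊤) (hN : N ≠ ⊤)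
    (h : ∀ κ : ℝ≥0∞, κ ≠ 0 → κ ≠ ⊤ → B ≤ κ → M ≤ C * κ * N) : M ≤ C * B * N := by
  refine ENNReal.le_of_forall_pos_le_add fun ε hε _ => ?_
  set δ : ℝ≥0∞ := ε / (C * N + 1) with hδ
  have hCN : C * N + 1 ≠ ⊤ := by finiteness
  have hδ0 : δ ≠ 0 := (ENNReal.div_pos (by exact_mod_cast hε.ne') hCN).ne'
  have hδt : δ ≠ ⊤ := (ENNReal.div_lt_top ENNReal.coe_ne_top (by simp)).ne
  calc M ≤ C * (B + δ) * N := h _ (by simp [hδ0]) (by finiteness) le_self_add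
    _ = C * B * N + C * N * δ := by ring
    _ ≤ C * B * N + ε := by
      gcongr
      calc C * N * δ ≤ (C * N + 1) * δ := by gcongr; exact le_self_add
        _ ≤ ε := ENNReal.mul_div_le

section Operators

variable {n : ℕ} [NeZero n] {p : ℝ} {φ : ParaSpace n → ℝ → ℝ} {K : ParaSpace n → ParaSpace n → ℝ}
  {A : ParaSpace n → Matrix (Fin n) (Fin n) ℝ}

theorem exists_nonsingIntegral_bound (hp : 1 < p) (hφ : IsMorreyWeight p φ)
    (hK : IsVariableParaCZKernel K) (hA : IsUniformlyElliptic (upperDomain n) A) :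
    ∃ C : ℝ≥0∞, C ≠ ⊤ ∧ ∀ f : ParaSpace n → ℝ, MemMorrey (upperDomain n) p φ f →
      (∀ᵐ x ∂(volume.restrict (upperDomain n)),
        IntegrableOn (fun y => K x (genReflection A x - y) * f y) (upperDomain n)) ∧
      MemMorrey (upperDomain n) p φ (nonsingIntegral K A f) ∧
      morreyNorm (upperDomain n) p φ (nonsingIntegral K A f) ≤
        C * morreyNorm (upperDomain n) p φ f := by
  obtain ⟨C₁, hC₁, h₁⟩ := exists_enorm_kernel_le hK hA
  obtain ⟨C, hC, h⟩ := exists_morreyNorm_le_of_dominated hp hφ hC₁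
  refine ⟨C, hC, fun f hf => ?_⟩
  have hmeas := (aestronglyMeasurable_reflected_kernel hK hA).mul hf.aestronglyMeasurable.comp_snd
  have key := h 0 1 boxBMO_zero one_ne_zero aestronglyMeasurable_const ENNReal.one_ne_top f hf
    (fun x y => K x (genReflection A x - y) * f y) hmeas ?_
  · rw [mul_one] at key
    exact key
  · filter_upwards [h₁] with x hx y hy
    rw [enorm_mul]
    calc _ ≤ C₁ * reflKernel x y * ‖f y‖ₑ := by
          gcongr
          exact hx y hy
      _ = _ := by
          simp only [Pi.zero_apply, sub_zero, enorm_zero, add_zero, mul_one]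
          ring

theorem exists_nonsingCommutator_bound (hp : 1 < p) (hφ : IsMorreyWeight p φ)
    (hK : IsVariableParaCZKernel K) (hA : IsUniformlyElliptic (upperDomain n) A) :
    ∃ C : ℝ≥0∞, C ≠ ⊤ ∧ ∀ a f : ParaSpace n → ℝ, MemBMO (upperDomain n) a →
      MemMorrey (upperDomain n) p φ f →
      (∀ᵐ x ∂(volume.restrict (upperDomain n)),
        IntegrableOn (fun y => K x (genReflection A x - y) * (a y - a x) * f y) (upperDomain n)) ∧
      MemMorrey (upperDomain n) p φ (nonsingCommutator K A a f) ∧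
      morreyNorm (upperDomain n) p φ (nonsingCommutator K A a f) ≤
        C * bmoNorm (upperDomain n) a * morreyNorm (upperDomain n) p φ f := by
  obtain ⟨C₁, hC₁, h₁⟩ := exists_enorm_kernel_le hK hA
  obtain ⟨C, hC, h⟩ := exists_morreyNorm_le_of_dominated hp hφ hC₁
  have hb := boxConst_ne_top (n := n)
  refine ⟨C * boxConst n, by finiteness, fun a f ha hf => ?_⟩
  have ham : AEStronglyMeasurable a (volume.restrict (upperDomain n)) :=
    aestronglyMeasurable_of_domainCylinder fun x hx r hr => (ha.1 x hx r hr).1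
  have hmeas := ((aestronglyMeasurable_reflected_kernel hK hA).mul
    (ham.comp_snd.sub ham.comp_fst)).mul hf.aestronglyMeasurable.comp_snd
  have key : ∀ κ : ℝ≥0∞, κ ≠ 0 → κ ≠ ⊤ → bmoNorm (upperDomain n) a ≤ κ → _ :=
    fun κ hκ hκt hκa => h a (boxConst n * κ) (boxBMO_of_memBMO ha hκa)
      (mul_ne_zero boxConst_ne_zero hκ) ham (by finiteness) f hf
      (fun x y => K x (genReflection A x - y) * (a y - a x) * f y) hmeas (by
        filter_upwards [h₁] with x hx y hy
        rw [enorm_mul, enorm_mul]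
        calc _ ≤ C₁ * reflKernel x y * (boxConst n * κ + ‖a x - a y‖ₑ) * ‖f y‖ₑ := by
              gcongr
              · exact hx y hy
              · rw [← enorm_neg, neg_sub]
                exact le_add_self
          _ = _ := by ring)
  -- `κ` has to be positive, while the seminorm of `a` may vanish
  obtain ⟨h3, h4, -⟩ := key (bmoNorm (upperDomain n) a + 1) (by simp)
    (by have := ha.2.ne; finiteness) le_self_add
  refine ⟨h3, h4, le_mul_of_forall_pos_le ha.2.ne (by finiteness) hf.2.ne fun κ hκ hκt hκa => ?_⟩
  rw [mul_assoc C]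
  exact (key κ hκ hκt hκa).2.2

theorem nonsingIntegral_sub {f g : ParaSpace n → ℝ} {x : ParaSpace n}
    (hf : IntegrableOn (fun y => K x (genReflection A x - y) * f y) (upperDomain n))
    (hg : IntegrableOn (fun y => K x (genReflection A x - y) * g y) (upperDomain n)) :
    nonsingIntegral K A (f - g) x = nonsingIntegral K A f x - nonsingIntegral K A g x := by
  unfold nonsingIntegral
  rw [← integral_sub hf hg]
  simp only [Pi.sub_apply, mul_sub]

theorem nonsingCommutator_sub {a f g : ParaSpace n → ℝ} {x : ParaSpace n}
    (hf : IntegrableOn (fun y => K x (genReflection A x - y) * (a y - a x) * f y) (upperDomain n))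
    (hg : IntegrableOn (fun y => K x (genReflection A x - y) * (a y - a x) * g y)
      (upperDomain n)) :
    nonsingCommutator K A a (f - g) x =
      nonsingCommutator K A a f x - nonsingCommutator K A a g x := by
  unfold nonsingCommutator
  rw [← integral_sub hf hg]
  simp only [Pi.sub_apply, mul_sub]

end Operators

theorem mainTheorem9 (n : ℕ) [NeZero n] (p : ℝ) (hp : 1 < p)
    (φ : ParaSpace n → ℝ → ℝ) (hφ : IsMorreyWeight p φ)
    (K : ParaSpace n → ParaSpace n → ℝ) (hK : IsVariableParaCZKernel K)
    (A : ParaSpace n → Matrix (Fin n) (Fin n) ℝ) (hA : IsUniformlyElliptic (upperDomain n) A) :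
    ∃ C : ℝ, 0 < C ∧
      (∀ f : ParaSpace n → ℝ, MemMorrey (upperDomain n) p φ f →
        (∀ᵐ x ∂(volume.restrict (upperDomain n)),
          IntegrableOn (fun y => K x (genReflection A x - y) * f y) (upperDomain n)) ∧
        MemMorrey (upperDomain n) p φ (nonsingIntegral K A f) ∧
        morreyNorm (upperDomain n) p φ (nonsingIntegral K A f) ≤
          ENNReal.ofReal C * morreyNorm (upperDomain n) p φ f) ∧
      (∀ f g : ParaSpace n → ℝ,
        MemMorrey (upperDomain n) p φ f → MemMorrey (upperDomain n) p φ g →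
        morreyNorm (upperDomain n) p φ (nonsingIntegral K A f - nonsingIntegral K A g) ≤
          ENNReal.ofReal C * morreyNorm (upperDomain n) p φ (f - g)) ∧
      (∀ a f : ParaSpace n → ℝ,
        MemBMO (upperDomain n) a → MemMorrey (upperDomain n) p φ f →
        (∀ᵐ x ∂(volume.restrict (upperDomain n)),
          IntegrableOn (fun y => K x (genReflection A x - y) * (a y - a x) * f y)
            (upperDomain n)) ∧
        MemMorrey (upperDomain n) p φ (nonsingCommutator K A a f) ∧
        morreyNorm (upperDomain n) p φ (nonsingCommutator K A a f) ≤
          ENNReal.ofReal C * bmoNorm (upperDomain n) a * morreyNorm (upperDomain n) p φ f) ∧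
      (∀ a f g : ParaSpace n → ℝ, MemBMO (upperDomain n) a →
        MemMorrey (upperDomain n) p φ f → MemMorrey (upperDomain n) p φ g →
        morreyNorm (upperDomain n) p φ (nonsingCommutator K A a f - nonsingCommutator K A a g) ≤
          ENNReal.ofReal C * bmoNorm (upperDomain n) a *
            morreyNorm (upperDomain n) p φ (f - g)) := by
  have hp0 : 0 < p := by linarith
  obtain ⟨C₁, hC₁, h₁⟩ := exists_nonsingIntegral_bound hp hφ hK hA
  obtain ⟨C₂, hC₂, h₂⟩ := exists_nonsingCommutator_bound hp hφ hK hA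
  have hle : ∀ D : ℝ≥0∞, D ≤ C₁ + C₂ → D ≤ ENNReal.ofReal ((C₁ + C₂).toReal + 1) := by
    intro D hD
    refine hD.trans ?_
    rw [ENNReal.ofReal_add ENNReal.toReal_nonneg zero_le_one,
      ENNReal.ofReal_toReal (ENNReal.add_ne_top.2 ⟨hC₁, hC₂⟩)]
    exact le_self_add
  have hle₁ := hle C₁ le_self_add
  have hle₂ := hle C₂ le_add_self
  refine ⟨(C₁ + C₂).toReal + 1, by positivity, fun f hf => ?_, fun f g hf hg => ?_,
    fun a f ha hf => ?_, fun a f g ha hf hg => ?_⟩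
  · obtain ⟨h3, h4, h5⟩ := h₁ f hf
    exact ⟨h3, h4, h5.trans (by gcongr)⟩
  · have hfg := hf.sub hp.le hφ.pos hg
    have heq : nonsingIntegral K A f - nonsingIntegral K A g
        =ᵐ[volume.restrict (upperDomain n)] nonsingIntegral K A (f - g) := by
      filter_upwards [(h₁ f hf).1, (h₁ g hg).1] with x hx hx'
      exact (nonsingIntegral_sub hx hx').symm
    rw [morreyNorm_congr hp0 heq]
    exact (h₁ _ hfg).2.2.trans (by gcongr)
  · obtain ⟨h3, h4, h5⟩ := h₂ a f ha hf
    exact ⟨h3, h4, h5.trans (by gcongr)⟩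
  · have hfg := hf.sub hp.le hφ.pos hg
    have heq : nonsingCommutator K A a f - nonsingCommutator K A a g
        =ᵐ[volume.restrict (upperDomain n)] nonsingCommutator K A a (f - g) := by
      filter_upwards [(h₂ a f ha hf).1, (h₂ a g ha hg).1] with x hx hx'
      exact (nonsingCommutator_sub hx hx').symm
    rw [morreyNorm_congr hp0 heq]
    exact (h₂ a _ ha hfg).2.2.trans (by gcongr)
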